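/- Let $\beta\in\{1,2\}$, $\mathbb F=\mathbb R$ if $\beta=1$ and $\mathbb F=\mathbb C$ if $\beta=2$, and $N\le M$. Let $\mathcal G_\beta(N,M)$ be the law of an $N\times M$ random matrix $X$ with i.i.d. entries that are standard normal on $\mathbb F$ (mean $0$, $\mathbb E|X_{ij}|^2=1$; for $\beta=2$ real and imaginary parts are independent with variance $1/2$), and let $\mathcal W_\beta(N,M)$ be the law of $XX^*/M$. Let $\chi_d$ denote the usual chi distribution with $d$ degrees of freedom (the law of the Euclidean norm of $d$ independent real $\mathcal N(0,1)$ variables; $\chi_0=0$). For a positive definite $W\in\mathbb F^{N\times N}$ and $b\in\mathbb F^N$ put $\|y\|_W=(y^*Wy)^{1/2}$ and $\mathcal K_k=\mathrm{span}_{\mathbb F}\{b,Wb,\dots,W^{k-1}b\}$. The $k$-th iterate $x_k$ of the conjugate gradient algorithm (CGA) for $Wx=b$ started at $0$ is the minimizer of $\|W^{-1}b-y\|_W$ over $y\in\mathcal K_k$; the $k$-th MINRES iterate $x_k$ is the minimizer of $\|b-Wy\|_2$ over $y\in\mathcal K_k$. In both cases $r_k(W,b)=b-Wx_k$ and $e_k(W,b)=W^{-1}b-x_k$.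 Let $\alpha_j\sim\chi_{\beta(M-j)}$ and $\beta_j\sim\chi_{\beta(N-j-1)}$, $0\le j<N$, be mutually independent. All equalities in law below hold jointly in $k=0,1,\dots,N-1$; empty products equal $1$. (a) Let $W\sim\mathcal W_\beta(N,M)$ and let $b\in\mathbb F^N$ be non-zero. For the CGA applied to $Wx=b$, $$\|r_k(W,b)\|_2\overset{\mathscr L}{=}\|b\|_2\prod_{j=0}^{k-1}\frac{\beta_j}{\alpha_j},\qquad 0\le k<N.$$ Moreover there are random variables $\Sigma_k^{-1}$, $0\le k<N$, on the probability space of the $\alpha_j,\beta_j$, with $$\Sigma_k^{-1}\overset{\mathscr L}{=}\frac{\sqrt{\beta M}}{\chi_{\beta(M-N+1)}},$$ such that each $\Sigma_k^{-1}$ is independent of $(\alpha_j,\beta_j)_{j<k}$, is a measurable function of $(\alpha_j,\beta_j)_{k\le j<N}$ and is not independent of $(\alpha_j,\beta_j)_{k\le j<N}$, and $$\bigl(\|r_k(W,b)\|_2,\ \|e_k(W,b)\|_W\bigr)\overset{\mathscr L}{=}\Bigl(\|b\|_2\prod_{j=0}^{k-1}\frac{\beta_j}{\alpha_j},\ \Sigma_k^{-1}\,\|b\|_2\prod_{j=0}^{k-1}\frac{\beta_j}{\alpha_j}\Bigr),\qquad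 0\le k<N.$$ (b) Let $W$ and $b$ be as in (a). For MINRES applied to $Wx=b$, $$\|r_k(W,b)\|_2\overset{\mathscr L}{=}\Bigl(\sum_{j=0}^{k}\prod_{\ell=0}^{j-1}\frac{\alpha_\ell^2}{\beta_\ell^2}\Bigr)^{-1/2}\|b\|_2,\qquad 0\le k<N.$$ (c) There is a probability space carrying mutually independent $\alpha_j,\beta_j$ with the laws above and a random variable $\Delta_{N,M}$ (possibly correlated with them, and not depending on $k$) with $$\Delta_{N,M}\overset{\mathscr L}{=}\frac{\chi^2_{\beta N}}{\chi^2_{\beta M}}:=\frac{\sum_{i=1}^{\beta N}g_i^2}{\sum_{i=1}^{\beta M}g_i^2},\qquad g_1,\dots,g_{\beta M}\ \text{i.i.d. real}\ \mathcal N(0,1),$$ such that for every $X\sim\mathcal G_\beta(N,M)$ and every non-zero $b\in\mathbb F^M$ the CGA applied to the normal equations $Wx=\frac{X}{\sqrt M}b$, $W=\frac{XX^*}{M}$, satisfies $$\Bigl\|e_k\Bigl(W,\frac{X}{\sqrt M}b\Bigr)\Bigr\|_W\overset{\mathscr L}{=}\Delta_{N,M}^{1/2}\Bigl(\sum_{j=0}^{k}\prod_{\ell=0}^{j-1}\frac{\alpha_\ell^2}{\beta_\ell^2}\Bigr)^{-1/2}\|b\|_2,\qquad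 0\le k<N.$$ -/

import Mathlib

open MeasureTheory ProbabilityTheory

noncomputable section

/-- Matrices carry the product `σ`-algebra of their entries. -/
instance Matrix.instMeasurableSpaceEntries {m n α : Type*} [MeasurableSpace α] :
    MeasurableSpace (Matrix m n α) :=
  inferInstanceAs (MeasurableSpace (m → n → α))

namespace KrylovWishart

/-! ### The random matrices and the chi distributions -/

section Laws

/-- The Dyson index of the field: `1` for the real and `2` for the complex numbers. -/
def dyson (𝕜 : Type*) [RCLike 𝕜] : ℕ := Module.finrank ℝ 𝕜

/-- The standard normal law on `𝕜` (mean `0`, and expected squared modulus `1`): the law of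
`x + i y` with `x, y` independent centred real normal variables of variance `1 / dyson 𝕜`.
For `𝕜 = ℝ` one has `RCLike.I = 0`, and this is the real standard normal law. -/
def stdNormal (𝕜 : Type*) [RCLike 𝕜] : Measure 𝕜 :=
  ((gaussianReal 0 (1 / dyson 𝕜)).prod (gaussianReal 0 (1 / dyson 𝕜))).map
    fun p ↦ (p.1 : 𝕜) + (p.2 : 𝕜) * RCLike.I

/-- The law of an `N × M` matrix with independent standard normal entries. -/
def gaussianMatrixLaw (𝕜 : Type*) [RCLike 𝕜] (N M : ℕ) : Measure (Matrix (Fin N) (Fin M) 𝕜) :=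
  Measure.pi fun _ : Fin N ↦ Measure.pi fun _ : Fin M ↦ stdNormal 𝕜

/-- The sample covariance matrix `X X* / M`. -/
def sampleCov {𝕜 : Type*} [RCLike 𝕜] {N M : ℕ} (X : Matrix (Fin N) (Fin M) 𝕜) :
    Matrix (Fin N) (Fin N) 𝕜 :=
  (M : 𝕜)⁻¹ • (X * X.conjTranspose)

/-- The Wishart law: the law of `X X* / M` for a standard Gaussian `N × M` matrix `X`. -/
def wishartLaw (𝕜 : Type*) [RCLike 𝕜] (N M : ℕ) : Measure (Matrix (Fin N) (Fin N) 𝕜) :=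
  (gaussianMatrixLaw 𝕜 N M).map sampleCov

/-- The chi distribution with `d` degrees of freedom: the law of the Euclidean norm of a vector
of `d` independent real standard normal variables. -/
def chiLaw (d : ℕ) : Measure ℝ :=
  (Measure.pi fun _ : Fin d ↦ gaussianReal 0 1).map fun g ↦ √(∑ i, g i ^ 2)

/-- The law of `(g₁² + ⋯ + g_p²) / (g₁² + ⋯ + g_q²)` for independent real standard normal
variables `g₁, …, g_q`, where `p ≤ q`: a quotient of a chi-squared variable with `p` and one with
`q` degrees of freedom, the former being part of the sum that defines the latter. -/
def chiSqRatioLaw (p q : ℕ) : Measure ℝ :=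
  (Measure.pi fun _ : Fin q ↦ gaussianReal 0 1).map
    fun g ↦ (∑ i with i.val < p, g i ^ 2) / ∑ i, g i ^ 2

/-- All the variables `α₀, …, α_{N-1}, β₀, …, β_{N-1}` are mutually independent, `α_j` is chi
distributed with `B (M - j)`, and `β_j` with `B (N - j - 1)` degrees of freedom. -/
structure IsChiFamily (B N M : ℕ) {Ω : Type*} [MeasurableSpace Ω] (P : Measure Ω)
    (α β : Fin N → Ω → ℝ) : Prop where
  indep : iIndepFun (Sum.elim α β) P
  law_α : ∀ j, HasLaw (α j) (chiLaw (B * (M - j))) P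
  law_β : ∀ j, HasLaw (β j) (chiLaw (B * (N - j - 1))) P

end Laws

/-! ### The conjugate gradient and MINRES iterates -/

section Algorithms

variable {𝕜 : Type*} [RCLike 𝕜] {N : ℕ}

/-- The Krylov subspace spanned by `b, W b, …, W ^ (k - 1) b`. -/
def krylov (W : Matrix (Fin N) (Fin N) 𝕜) (b : EuclideanSpace 𝕜 (Fin N)) (k : ℕ) :
    Submodule 𝕜 (EuclideanSpace 𝕜 (Fin N)) :=
  Submodule.span 𝕜 (Set.range fun i : Fin k ↦ (W ^ (i : ℕ)).toEuclideanLin b)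

/-- The norm `√(y* W y)` induced by a positive definite matrix `W`. -/
def energyNorm (W : Matrix (Fin N) (Fin N) 𝕜) (y : EuclideanSpace 𝕜 (Fin N)) : ℝ :=
  √(RCLike.re (inner 𝕜 y (W.toEuclideanLin y)))

/-- `x` is a `k`-th iterate of the conjugate gradient algorithm for `W x = b` started at `0`:
it minimizes, over the Krylov subspace, the `W`-norm of the distance to the solution `W⁻¹ b`. -/
def IsCGIterate (W : Matrix (Fin N) (Fin N) 𝕜) (b : EuclideanSpace 𝕜 (Fin N)) (k : ℕ)
    (x : EuclideanSpace 𝕜 (Fin N)) : Prop :=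
  x ∈ krylov W b k ∧
    IsMinOn (fun y ↦ energyNorm W (W⁻¹.toEuclideanLin b - y)) (krylov W b k) x

/-- `x` is a `k`-th iterate of the MINRES algorithm for `W x = b`: it minimizes, over the Krylov
subspace, the Euclidean norm of the residual. -/
def IsMINRESIterate (W : Matrix (Fin N) (Fin N) 𝕜) (b : EuclideanSpace 𝕜 (Fin N)) (k : ℕ)
    (x : EuclideanSpace 𝕜 (Fin N)) : Prop :=
  x ∈ krylov W b k ∧ IsMinOn (fun y ↦ ‖b - W.toEuclideanLin y‖) (krylov W b k) x

theorem existsUnique_isMinOn {E F : Type*} [NormedAddCommGroup E] [InnerProductSpace 𝕜 E]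
    [NormedAddCommGroup F] [InnerProductSpace 𝕜 F] [FiniteDimensional 𝕜 E] (A : E →ₗ[𝕜] F)
    (hA : Function.Injective A) (c : F) (K : Submodule 𝕜 E) :
    ∃! x, x ∈ K ∧ IsMinOn (fun y ↦ ‖c - A y‖) K x := by
  have key : ∀ x ∈ K, (IsMinOn (fun y ↦ ‖c - A y‖) K x ↔
      ∀ w ∈ K.map A, inner 𝕜 (c - A x) w = 0) := by
    intro x hx
    rw [← Submodule.norm_eq_iInf_iff_inner_eq_zero _ (Submodule.mem_map_of_mem hx)]
    constructor
    · intro h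
      refine le_antisymm (le_ciInf ?_) (ciInf_le ⟨0, ?_⟩ (⟨A x, Submodule.mem_map_of_mem hx⟩ :
        K.map A))
      · rintro ⟨w, y, hy, rfl⟩
        exact h hy
      · rintro _ ⟨w, rfl⟩
        exact norm_nonneg _
    · intro h y hy
      change ‖c - A x‖ ≤ ‖c - A y‖
      rw [h]
      refine ciInf_le ⟨0, ?_⟩ (⟨A y, Submodule.mem_map_of_mem hy⟩ : K.map A)
      rintro _ ⟨w, rfl⟩
      exact norm_nonneg _
  obtain ⟨v, ⟨x, hx, rfl⟩, hv⟩ := (K.map A).exists_norm_eq_iInf_of_complete_subspace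
    (Submodule.complete_of_finiteDimensional _) c
  replace hv :=
    ((K.map A).norm_eq_iInf_iff_inner_eq_zero (Submodule.mem_map_of_mem hx)).1 hv
  refine ⟨x, ⟨hx, (key x hx).2 hv⟩, ?_⟩
  rintro y ⟨hy, hmin⟩
  have h1 := (key y hy).1 hmin
  have hd : A x - A y ∈ K.map A :=
    Submodule.sub_mem _ (Submodule.mem_map_of_mem hx) (Submodule.mem_map_of_mem hy)
  have h2 : inner 𝕜 (A x - A y) (A x - A y) = 0 := by
    have : A x - A y = (c - A y) - (c - A x) := by abel
    nth_rewrite 1 [this]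
    rw [inner_sub_left, h1 _ hd, hv _ hd, sub_zero]
  rw [inner_self_eq_zero, sub_eq_zero] at h2
  exact (hA h2).symm

open scoped ComplexOrder in
/-- For a positive definite matrix, the conjugate gradient iterates are well defined. -/
theorem existsUnique_isCGIterate {W : Matrix (Fin N) (Fin N) 𝕜} (hW : W.PosDef)
    (b : EuclideanSpace 𝕜 (Fin N)) (k : ℕ) : ∃! x, IsCGIterate W b k x := by
  obtain ⟨B, rfl⟩ : ∃ B : Matrix (Fin N) (Fin N) 𝕜, W = B.conjTranspose * B := by
    open scoped MatrixOrder in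
    exact CStarAlgebra.nonneg_iff_eq_star_mul_self.mp hW.posSemidef.nonneg
  have hB : Function.Injective B.toEuclideanLin := by
    intro x y hxy
    have h := Matrix.mulVec_injective_of_isUnit hW.isUnit
    have : B.mulVec x.ofLp = B.mulVec y.ofLp := congrArg WithLp.ofLp hxy
    have := h (a₁ := x.ofLp) (a₂ := y.ofLp) (by
      simp only [← Matrix.mulVec_mulVec, this])
    exact WithLp.ofLp_injective 2 this
  have hn : ∀ y, energyNorm (B.conjTranspose * B) y = ‖B.toEuclideanLin y‖ := by
    intro y
    have : (B.conjTranspose * B).toEuclideanLin y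
        = B.toEuclideanLin.adjoint (B.toEuclideanLin y) := by
      rw [← Matrix.toEuclideanLin_conjTranspose_eq_adjoint]
      ext i
      simp [Matrix.mulVec_mulVec]
    rw [energyNorm, this, LinearMap.adjoint_inner_right, inner_self_eq_norm_sq,
      Real.sqrt_sq (norm_nonneg _)]
  simpa only [IsCGIterate, hn, map_sub] using existsUnique_isMinOn B.toEuclideanLin hB
    (B.toEuclideanLin ((B.conjTranspose * B)⁻¹.toEuclideanLin b)) _

open scoped ComplexOrder in
/-- For a positive definite matrix, the MINRES iterates are well defined. -/
theorem existsUnique_isMINRESIterate {W : Matrix (Fin N) (Fin N) 𝕜} (hW : W.PosDef)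
    (b : EuclideanSpace 𝕜 (Fin N)) (k : ℕ) : ∃! x, IsMINRESIterate W b k x := by
  refine existsUnique_isMinOn W.toEuclideanLin ?_ b (krylov W b k)
  intro x y hxy
  exact WithLp.ofLp_injective 2
    (Matrix.mulVec_injective_of_isUnit hW.isUnit (congrArg WithLp.ofLp hxy))

/-- The `k`-th conjugate gradient iterate for `W x = b` started at `0`. -/
def cgIterate (W : Matrix (Fin N) (Fin N) 𝕜) (b : EuclideanSpace 𝕜 (Fin N)) (k : ℕ) :
    EuclideanSpace 𝕜 (Fin N) :=
  Classical.epsilon (IsCGIterate W b k)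

/-- The `k`-th MINRES iterate for `W x = b`. -/
def minresIterate (W : Matrix (Fin N) (Fin N) 𝕜) (b : EuclideanSpace 𝕜 (Fin N)) (k : ℕ) :
    EuclideanSpace 𝕜 (Fin N) :=
  Classical.epsilon (IsMINRESIterate W b k)

/-- The residual `b - W x_k` of the conjugate gradient algorithm for `W x = b`. -/
def cgResidual (W : Matrix (Fin N) (Fin N) 𝕜) (b : EuclideanSpace 𝕜 (Fin N)) (k : ℕ) :
    EuclideanSpace 𝕜 (Fin N) :=
  b - W.toEuclideanLin (cgIterate W b k)

/-- The error `W⁻¹ b - x_k` of the conjugate gradient algorithm for `W x = b`. -/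
def cgError (W : Matrix (Fin N) (Fin N) 𝕜) (b : EuclideanSpace 𝕜 (Fin N)) (k : ℕ) :
    EuclideanSpace 𝕜 (Fin N) :=
  W⁻¹.toEuclideanLin b - cgIterate W b k

/-- The residual `b - W x_k` of the MINRES algorithm for `W x = b`. -/
def minresResidual (W : Matrix (Fin N) (Fin N) 𝕜) (b : EuclideanSpace 𝕜 (Fin N)) (k : ℕ) :
    EuclideanSpace 𝕜 (Fin N) :=
  b - W.toEuclideanLin (minresIterate W b k)

end Algorithms

/-- The right-hand side `X b / √M` of the normal equations. -/
def normalRhs {𝕜 : Type*} [RCLike 𝕜] {N M : ℕ} (X : Matrix (Fin N) (Fin M) 𝕜)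
    (b : EuclideanSpace 𝕜 (Fin M)) : EuclideanSpace 𝕜 (Fin N) :=
  ((√M : ℝ) : 𝕜)⁻¹ • X.toEuclideanLin b

end KrylovWishart

end

open KrylovWishart

/-!
The Krylov quantities are functions `F (W, b)` with `F (U W U*, U b) = F (W, b)` for unitary `U`, and
`W = X X* / M` does not change if `X` is multiplied by a unitary matrix from the right. As the law of
a Gaussian matrix is invariant under unitary matrices from both sides, `b` can be rotated to
`‖b‖ e₀`, and `X` to lower bidiagonal form (`lintegral_gaussianMatrixLaw_eq_bidiag`): the first row is
rotated onto the first coordinate axis, the rest of the first column onto the second basis vector,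
and so on. The entries become independent norms of Gaussian vectors, that is, chi variables.

For a bidiagonal matrix with the diagonal `a` and the subdiagonal `b`, the algorithms are explicit.
The Krylov spaces are spanned by the vectors that the adjoint matrix maps to `e₀, e₁, …`, the `k`-th
conjugate gradient residual is `± ‖b‖ ∏ b_j / a_j` times `e_k` (`cgResidualFormula_bidiag`), the error
is its preimage under `W` (`cgErrorFormula_bidiag`), and the MINRES residual is a weighted mean of
the conjugate gradient residuals (`minresResidualFormula_bidiag`). To speak of laws, the iterates are
replaced by matrix formulas such as `cgFormula`, which are measurable everywhere, and agree with
the iterates whenever `W` is invertible and `b` generates the whole space (`IsRegular`); this holds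
almost surely, as it does for the bidiagonal model.

The quotient `1 / Σ_k` of error and residual is a function of the entries from the index `k` on, hence
independent of the earlier ones. Its law does not depend on `k`, up to a deterministic factor that
comes from `M`, and for `k = 0` it is that of the square root of a diagonal entry of `W⁻¹`, up to
unitary equivalence. That entry is computed in a second way (`lintegral_inv_gram_last`): eliminating
the first rows of `X` by row operations leaves one Gaussian row of length `M - N + 1`. As the law has
no atoms, `1 / Σ_k` is not independent of a family of which it is a function.

For the normal equations, let `X / √M = P Q` be the polar decomposition, with `P² = W` and `Q` with
orthonormal rows. The conjugate gradient error for `W x = P Q b` is the MINRES residual for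
`W x = Q b` (`cgErrorFormula_mulVec_sqrt`). By right invariance, `b` may be replaced by
`‖b‖ g / ‖g‖` with a Gaussian vector `g`. Then `Q g` is independent of `X`, and consists of `N` of the
`M` coordinates of a Gaussian vector; so the result for MINRES applies to a vector with the norm
`‖b‖ ‖Q g‖ / ‖g‖` (`identDistrib_normalEquations`).
-/

noncomputable section

namespace KrylovWishart

variable {𝕜 : Type*} [RCLike 𝕜]

open scoped ENNReal

/-! ### Gaussian vectors and chi distributions -/

lemma dyson_pos (𝕜 : Type*) [RCLike 𝕜] : 0 < dyson 𝕜 := Module.finrank_pos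

lemma real_inner_ofReal_add (p q : ℝ) (t : 𝕜) :
    inner ℝ ((p : 𝕜) + (q : 𝕜) * RCLike.I) t = p * RCLike.re t + q * RCLike.im t := by
  have h : inner ℝ ((p : 𝕜) + (q : 𝕜) * RCLike.I) t
      = RCLike.re (inner 𝕜 ((p : 𝕜) + (q : 𝕜) * RCLike.I) t) := rfl
  rw [h, RCLike.inner_apply']
  simp only [map_add, map_mul, RCLike.conj_ofReal, RCLike.conj_I, RCLike.mul_re, RCLike.ofReal_re,
    RCLike.ofReal_im, RCLike.mul_im, RCLike.I_re, map_neg]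
  have := RCLike.I_im' t
  linear_combination q * this

instance : IsProbabilityMeasure (stdNormal 𝕜) :=
  Measure.isProbabilityMeasure_map (Measurable.aemeasurable (by fun_prop))

lemma charFun_stdNormal (t : 𝕜) :
    charFun (stdNormal 𝕜) t = Complex.exp (-‖t‖ ^ 2 / (2 * dyson 𝕜)) := by
  rw [charFun_apply, stdNormal, integral_map (Measurable.aemeasurable (by fun_prop))
    (Measurable.aestronglyMeasurable (by fun_prop))]
  simp_rw [real_inner_ofReal_add, Complex.ofReal_add, add_mul, Complex.exp_add]
  rw [integral_prod_mul (fun x : ℝ ↦ Complex.exp (((x * RCLike.re t : ℝ) : ℂ) * Complex.I))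
    (fun x : ℝ ↦ Complex.exp (((x * RCLike.im t : ℝ) : ℂ) * Complex.I))]
  simp_rw [mul_comm _ (RCLike.re t), mul_comm _ (RCLike.im t), Complex.ofReal_mul,
    ← charFun_apply_real, charFun_gaussianReal, ← Complex.exp_add]
  congr 1
  have : (‖t‖ : ℂ) ^ 2 = (RCLike.re t : ℂ) ^ 2 + (RCLike.im t : ℂ) ^ 2 := by
    rw [← Complex.ofReal_pow, ← RCLike.normSq_eq_def', RCLike.normSq_apply]
    push_cast
    ring
  rw [this]
  push_cast
  have := (dyson_pos 𝕜).ne'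
  field_simp
  ring

section Vectors

variable {ι κ : Type*} [Fintype ι] [Fintype κ]

/-- The law of a vector with independent standard normal coordinates, on the Euclidean space. -/
def gaussianVec (𝕜 ι : Type*) [RCLike 𝕜] [Fintype ι] : Measure (EuclideanSpace 𝕜 ι) :=
  (Measure.pi fun _ : ι ↦ stdNormal 𝕜).map (WithLp.toLp 2)

instance : IsProbabilityMeasure (gaussianVec 𝕜 ι) :=
  Measure.isProbabilityMeasure_map (Measurable.aemeasurable (by fun_prop))

lemma charFun_gaussianVec (t : EuclideanSpace 𝕜 ι) :
    charFun (gaussianVec 𝕜 ι) t = Complex.exp (-‖t‖ ^ 2 / (2 * dyson 𝕜)) := by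
  rw [gaussianVec, charFun_pi]
  simp_rw [charFun_stdNormal, ← Complex.exp_sum, ← Finset.sum_div, Finset.sum_neg_distrib]
  rw [← Complex.ofReal_pow, EuclideanSpace.norm_sq_eq]
  push_cast
  rfl

/-- Linear isometries carry measures to each other whose characteristic functions are the same
radial function. -/
lemma map_eq_of_charFun {E F : Type*} [NormedAddCommGroup E] [InnerProductSpace ℝ E]
    [FiniteDimensional ℝ E] [MeasurableSpace E] [BorelSpace E]
    [NormedAddCommGroup F] [InnerProductSpace ℝ F]
    [MeasurableSpace F] [BorelSpace F] {μ : Measure E} {ν : Measure F} [IsFiniteMeasure μ]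
    [IsFiniteMeasure ν] {g : ℝ → ℂ} (hμ : ∀ t, charFun μ t = g ‖t‖) (hν : ∀ t, charFun ν t = g ‖t‖)
    (f : E ≃ₗᵢ[ℝ] F) : μ.map f = ν := by
  have := f.finiteDimensional
  apply Measure.ext_of_charFun
  ext t
  rw [hν, ← f.symm.norm_map t, ← hμ, charFun_apply, charFun_apply,
    integral_map (by fun_prop) (Measurable.aestronglyMeasurable (by fun_prop))]
  congr with x
  rw [← f.inner_map_map, f.apply_symm_apply]

lemma gaussianVec_map (f : EuclideanSpace 𝕜 ι ≃ₗᵢ[ℝ] EuclideanSpace 𝕜 κ) :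
    (gaussianVec 𝕜 ι).map f = gaussianVec 𝕜 κ :=
  map_eq_of_charFun (g := fun r ↦ Complex.exp (-r ^ 2 / (2 * dyson 𝕜))) charFun_gaussianVec
    charFun_gaussianVec f

lemma chiLaw_eq_map_norm (d : ℕ) :
    chiLaw d = (stdGaussian (EuclideanSpace ℝ (Fin d))).map norm := by
  rw [← map_pi_eq_stdGaussian, Measure.map_map (by fun_prop) (by fun_prop), chiLaw]
  congr with g
  simp [EuclideanSpace.norm_eq]

/-- `√(dyson 𝕜)` times the norm of a standard normal vector over `𝕜` of dimension `n` is
chi distributed with `dyson 𝕜 * n` degrees of freedom. -/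
lemma gaussianVec_map_norm :
    (gaussianVec 𝕜 ι).map (fun x ↦ √(dyson 𝕜) * ‖x‖) = chiLaw (dyson 𝕜 * Fintype.card ι) := by
  have hfin : Module.finrank ℝ (EuclideanSpace 𝕜 ι)
      = Module.finrank ℝ (EuclideanSpace ℝ (Fin (dyson 𝕜 * Fintype.card ι))) := by
    rw [← Module.finrank_mul_finrank ℝ 𝕜, finrank_euclideanSpace, finrank_euclideanSpace,
      Fintype.card_fin, dyson]
  have : FiniteDimensional ℝ (EuclideanSpace 𝕜 ι) := FiniteDimensional.trans ℝ 𝕜 _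
  have f := ((stdOrthonormalBasis ℝ (EuclideanSpace 𝕜 ι)).reindex
    (finCongr (hfin.trans finrank_euclideanSpace_fin))).repr
  have hd : (0 : ℝ) < dyson 𝕜 := by exact_mod_cast dyson_pos 𝕜
  have hp : IsProbabilityMeasure ((gaussianVec 𝕜 ι).map (√(dyson 𝕜) • ·)) :=
    Measure.isProbabilityMeasure_map (Measurable.aemeasurable (by fun_prop))
  have key := map_eq_of_charFun (μ := (gaussianVec 𝕜 ι).map (√(dyson 𝕜) • ·))
    (ν := stdGaussian (EuclideanSpace ℝ (Fin (dyson 𝕜 * Fintype.card ι))))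
    (g := fun r ↦ Complex.exp (-r ^ 2 / 2)) (fun t ↦ by
      rw [charFun_map_smul, charFun_gaussianVec, norm_smul]
      congr 1
      rw [Real.norm_of_nonneg (Real.sqrt_nonneg _)]
      push_cast
      rw [mul_pow, ← Complex.ofReal_pow, Real.sq_sqrt hd.le]
      have := (dyson_pos 𝕜).ne'
      push_cast
      field_simp) charFun_stdGaussian f
  rw [chiLaw_eq_map_norm, ← key, Measure.map_map (by fun_prop) (by fun_prop),
    Measure.map_map (by fun_prop) (by fun_prop)]
  congr with x
  simp [norm_smul, abs_of_nonneg (Real.sqrt_nonneg _)]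

end Vectors

section Chi

instance (d : ℕ) : IsProbabilityMeasure (chiLaw d) :=
  Measure.isProbabilityMeasure_map (Measurable.aemeasurable (by fun_prop))

/-- Chi distributions have no atoms: given the other coordinates of a vector, the first one takes at
most two values that lead to a given norm. -/
lemma chiLaw_singleton {d : ℕ} (hd : d ≠ 0) (c : ℝ) : chiLaw d {c} = 0 := by
  obtain ⟨d, rfl⟩ := Nat.exists_eq_succ_of_ne_zero hd
  rw [chiLaw, Measure.map_apply (by fun_prop) (measurableSet_singleton c)]
  refine measure_mono_null (t := MeasurableEquiv.piFinSuccAbove (fun _ ↦ ℝ) 0 ⁻¹'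
    {p | p.1 ^ 2 = c ^ 2 - ∑ i, p.2 i ^ 2}) ?_ ?_
  · intro g hg
    have hg : √(∑ i, g i ^ 2) = c := hg
    have h0 : 0 ≤ ∑ i, g i ^ 2 := Finset.sum_nonneg fun _ _ ↦ sq_nonneg _
    have : g 0 ^ 2 = c ^ 2 - ∑ i : Fin d, g i.succ ^ 2 := by
      rw [← hg, Real.sq_sqrt h0, Fin.sum_univ_succ]
      ring
    simpa [Fin.removeNth, Fin.tail] using this
  · have hm : MeasurableSet {p : ℝ × (Fin d → ℝ) | p.1 ^ 2 = c ^ 2 - ∑ i, p.2 i ^ 2} :=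
      measurableSet_eq_fun (by fun_prop) (by fun_prop)
    rw [(measurePreserving_piFinSuccAbove (fun _ ↦ gaussianReal 0 1) 0).measure_preimage
      hm.nullMeasurableSet, Measure.prod_apply_symm hm, lintegral_eq_zero_iff' (by
        exact (measurable_measure_prodMk_right hm).aemeasurable)]
    refine Filter.Eventually.of_forall fun y ↦ ?_
    have := nullSingletonClass_gaussianReal (μ := 0) (v := 1) one_ne_zero
    refine Set.Finite.measure_zero (Set.Finite.subset
      (Set.toFinite {√(c ^ 2 - ∑ i, y i ^ 2), -√(c ^ 2 - ∑ i, y i ^ 2)}) ?_) _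
    intro x hx
    have hx : x ^ 2 = c ^ 2 - ∑ i, y i ^ 2 := hx
    rw [← hx, Real.sqrt_sq_eq_abs]
    rcases abs_choice x with h | h <;> simp [h]

end Chi

/-! ### Unitary invariance of Gaussian matrices -/

section MatrixLaw

variable {N M : ℕ}

instance : IsProbabilityMeasure (gaussianMatrixLaw 𝕜 N M) := by
  unfold gaussianMatrixLaw
  exact inferInstanceAs (IsProbabilityMeasure
    (Measure.pi (α := fun _ : Fin N ↦ Fin M → 𝕜) fun _ ↦ Measure.pi fun _ ↦ stdNormal 𝕜))

lemma sum_norm_sq_eq_trace (X : Matrix (Fin N) (Fin M) 𝕜) :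
    ∑ i, ∑ j, ‖X i j‖ ^ 2 = RCLike.re (X * X.conjTranspose).trace := by
  simp only [Matrix.trace, Matrix.diag_apply, Matrix.mul_apply, Matrix.conjTranspose_apply, map_sum]
  refine Finset.sum_congr rfl fun i _ ↦ Finset.sum_congr rfl fun j _ ↦ ?_
  rw [RCLike.star_def, RCLike.mul_conj, ← RCLike.ofReal_pow, RCLike.ofReal_re]

lemma measurable_matrix {Ω α m n : Type*} [MeasurableSpace Ω] [MeasurableSpace α]
    {f : Ω → Matrix m n α} (h : ∀ i j, Measurable fun ω ↦ f ω i j) : Measurable f :=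
  measurable_pi_lambda _ fun i ↦ measurable_pi_lambda _ fun j ↦ h i j

lemma _root_.Measurable.matrix_entry {Ω α m n : Type*} [MeasurableSpace Ω] [MeasurableSpace α]
    {f : Ω → Matrix m n α} (hf : Measurable f) (i : m) (j : n) : Measurable fun ω ↦ f ω i j :=
  (measurable_pi_apply j).comp ((measurable_pi_apply (X := fun _ ↦ n → α) i).comp hf)

@[fun_prop]
lemma _root_.Measurable.matrix_mul {Ω l m n : Type*} [MeasurableSpace Ω] [Fintype m]
    {f : Ω → Matrix l m 𝕜} {g : Ω → Matrix m n 𝕜} (hf : Measurable f) (hg : Measurable g) :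
    Measurable fun ω ↦ f ω * g ω := by
  refine measurable_matrix fun i j ↦ ?_
  simp only [Matrix.mul_apply]
  exact Finset.measurable_sum _ fun k _ ↦ (hf.matrix_entry i k).mul (hg.matrix_entry k j)

@[fun_prop]
lemma _root_.Measurable.matrix_conjTranspose {Ω m n : Type*} [MeasurableSpace Ω]
    {f : Ω → Matrix m n 𝕜} (hf : Measurable f) :
    Measurable fun ω ↦ (f ω).conjTranspose := by
  refine measurable_matrix fun i j ↦ ?_
  simp only [Matrix.conjTranspose_apply]
  exact continuous_star.measurable.comp (hf.matrix_entry j i)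

/-- A matrix as an element of the Hilbert space of its entries, row by row. -/
def rowsToLp (X : Matrix (Fin N) (Fin M) 𝕜) :
    PiLp 2 fun _ : Fin N ↦ EuclideanSpace 𝕜 (Fin M) :=
  WithLp.toLp 2 fun i ↦ WithLp.toLp 2 (X i)

lemma measurable_rowsToLp : Measurable (rowsToLp : Matrix (Fin N) (Fin M) 𝕜 → _) := by
  unfold rowsToLp
  refine (WithLp.measurable_toLp 2 _).comp (measurable_pi_lambda _ fun i ↦ ?_)
  exact (WithLp.measurable_toLp 2 _).comp (measurable_pi_apply (X := fun _ ↦ Fin M → 𝕜) i)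

lemma gaussianMatrixLaw_map_rowsToLp : (gaussianMatrixLaw 𝕜 N M).map rowsToLp
    = (Measure.pi fun _ : Fin N ↦ gaussianVec 𝕜 (Fin M)).map (WithLp.toLp 2) := by
  unfold gaussianVec gaussianMatrixLaw
  rw [← Measure.pi_map_pi (fun _ ↦ by fun_prop), Measure.map_map (by fun_prop) (by
    refine measurable_pi_lambda _ fun i ↦ ?_
    exact (WithLp.measurable_toLp 2 _).comp (measurable_pi_apply (X := fun _ ↦ Fin M → 𝕜) i))]
  rfl

/-- The law of a standard Gaussian matrix is invariant under multiplication by unitary matrices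
from both sides. -/
lemma gaussianMatrixLaw_map_mul {U : Matrix (Fin N) (Fin N) 𝕜} {V : Matrix (Fin M) (Fin M) 𝕜}
    (hU : U ∈ Matrix.unitaryGroup (Fin N) 𝕜) (hV : V ∈ Matrix.unitaryGroup (Fin M) 𝕜) :
    (gaussianMatrixLaw 𝕜 N M).map (fun X ↦ U * X * V) = gaussianMatrixLaw 𝕜 N M := by
  set E := PiLp 2 fun _ : Fin N ↦ EuclideanSpace 𝕜 (Fin M)
  have : FiniteDimensional ℝ E := FiniteDimensional.trans ℝ 𝕜 _
  let A : E →ₗ[ℝ] E :=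
    { toFun := fun x ↦ rowsToLp (U * (Matrix.of fun i j ↦ x i j) * V)
      map_add' := fun x y ↦ by
        have : (Matrix.of fun i j ↦ (x + y) i j : Matrix (Fin N) (Fin M) 𝕜)
          = (Matrix.of fun i j ↦ x i j) + (Matrix.of fun i j ↦ y i j) := rfl
        rw [this, Matrix.mul_add, Matrix.add_mul]
        rfl
      map_smul' := fun c x ↦ by
        have : (Matrix.of fun i j ↦ (c • x) i j : Matrix (Fin N) (Fin M) 𝕜)
          = c • (Matrix.of fun i j ↦ x i j) := rfl
        rw [this, Matrix.mul_smul, Matrix.smul_mul]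
        rfl }
  have hnorm : ∀ X : Matrix (Fin N) (Fin M) 𝕜, ‖rowsToLp X‖ ^ 2
      = RCLike.re (X * X.conjTranspose).trace := fun X ↦ by
    rw [← sum_norm_sq_eq_trace, PiLp.norm_sq_eq_of_L2]
    simp_rw [EuclideanSpace.norm_sq_eq]
    rfl
  have hVV : V * V.conjTranspose = 1 := (Matrix.mem_unitaryGroup_iff).1 hV
  have hUU : U.conjTranspose * U = 1 := (Matrix.mem_unitaryGroup_iff').1 hU
  let f : E ≃ₗᵢ[ℝ] E := LinearIsometry.toLinearIsometryEquiv
    { A with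
      norm_map' := fun x ↦ by
        have h2 : ‖A x‖ ^ 2 = ‖x‖ ^ 2 := by
          have : x = rowsToLp (Matrix.of fun i j ↦ x i j) := rfl
          conv_rhs => rw [this, hnorm]
          change ‖rowsToLp _‖ ^ 2 = _
          rw [hnorm, Matrix.conjTranspose_mul, Matrix.conjTranspose_mul]
          congr 1
          rw [Matrix.mul_assoc _ V, ← Matrix.mul_assoc V, hVV, Matrix.one_mul, Matrix.mul_assoc,
            Matrix.trace_mul_comm, ← Matrix.mul_assoc, Matrix.mul_assoc _ _ U, hUU, Matrix.mul_one]
        exact (sq_eq_sq₀ (norm_nonneg _) (norm_nonneg _)).1 h2 } rfl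
  have hΓ : ∀ t, charFun ((gaussianMatrixLaw 𝕜 N M).map rowsToLp) t
      = Complex.exp (-‖t‖ ^ 2 / (2 * dyson 𝕜)) := fun t ↦ by
    rw [gaussianMatrixLaw_map_rowsToLp, charFun_pi]
    simp_rw [charFun_gaussianVec, ← Complex.exp_sum, ← Finset.sum_div, Finset.sum_neg_distrib]
    rw [← Complex.ofReal_pow, PiLp.norm_sq_eq_of_L2]
    push_cast
    rfl
  have hp : IsProbabilityMeasure ((gaussianMatrixLaw 𝕜 N M).map rowsToLp) :=
    Measure.isProbabilityMeasure_map measurable_rowsToLp.aemeasurable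
  have key := map_eq_of_charFun (g := fun r ↦ Complex.exp (-r ^ 2 / (2 * dyson 𝕜))) hΓ hΓ f
  have hm : Measurable fun X : Matrix (Fin N) (Fin M) 𝕜 ↦ U * X * V := by fun_prop
  have hm' : Measurable fun x : E ↦ (Matrix.of fun i j ↦ x i j : Matrix (Fin N) (Fin M) 𝕜) := by
    refine measurable_matrix fun i j ↦ ?_
    simp only [Matrix.of_apply]
    exact (measurable_pi_apply j).comp ((WithLp.measurable_ofLp 2 _).comp
      ((measurable_pi_apply i).comp (WithLp.measurable_ofLp 2 _)))
  have := congrArg (Measure.map fun x : E ↦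
    (Matrix.of fun i j ↦ x i j : Matrix (Fin N) (Fin M) 𝕜)) key
  rw [Measure.map_map hm' (by fun_prop), Measure.map_map (hm'.comp (by fun_prop))
    measurable_rowsToLp, Measure.map_map hm' measurable_rowsToLp] at this
  exact this.trans Measure.map_id

end MatrixLaw

/-! ### Reduction of Gaussian matrices to bidiagonal form -/

section Reduction

variable {n m N M : ℕ}

/-- The vector whose zeroth coordinate is `c`, and whose other coordinates vanish. -/
def firstCoord (𝕜 : Type*) [RCLike 𝕜] (n : ℕ) (c : ℝ) : Fin n → 𝕜 :=
  fun i ↦ if i.val = 0 then (c : 𝕜) else 0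

lemma measurable_firstCoord : Measurable (firstCoord 𝕜 n) := by
  refine measurable_pi_lambda _ fun i ↦ ?_
  by_cases h : i.val = 0
  · simpa [firstCoord, h] using RCLike.measurable_ofReal
  · simp [firstCoord, h]

lemma exists_unitary_mulVec_eq_firstCoord (y : EuclideanSpace 𝕜 (Fin n)) :
    ∃ U ∈ Matrix.unitaryGroup (Fin n) 𝕜, U.mulVec y.ofLp = firstCoord 𝕜 n ‖y‖ := by
  rcases n with - | n
  · exact ⟨1, one_mem _, Subsingleton.elim _ _⟩
  by_cases hy : y = 0
  · refine ⟨1, one_mem _, ?_⟩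
    ext i
    simp [hy, firstCoord]
  have hy' : ‖y‖ ≠ 0 := norm_ne_zero_iff.2 hy
  obtain ⟨b, hb⟩ := Orthonormal.exists_orthonormalBasis_extension_of_card_eq (𝕜 := 𝕜)
    (ι := Fin (n + 1)) (E := EuclideanSpace 𝕜 (Fin (n + 1))) (by simp)
    (v := fun _ ↦ ((‖y‖⁻¹ : ℝ) : 𝕜) • y) (s := {0}) (by
      refine ⟨fun i ↦ ?_, fun i j hij ↦ (hij (Subsingleton.elim _ _)).elim⟩
      simp [norm_smul, hy'])
  refine ⟨b.toBasis.toMatrix (EuclideanSpace.basisFun (Fin (n + 1)) 𝕜),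
    b.toMatrix_orthonormalBasis_mem_unitary _, ?_⟩
  have h1 := (EuclideanSpace.basisFun (Fin (n + 1)) 𝕜).toBasis.toMatrix_mulVec_repr b.toBasis y
  have h2 : ⇑((EuclideanSpace.basisFun (Fin (n + 1)) 𝕜).toBasis.repr y) = y.ofLp := by
    ext i
    simp
  rw [h2] at h1
  have h3 : y = (‖y‖ : 𝕜) • b 0 := by
    rw [hb 0 rfl, smul_smul, ← RCLike.ofReal_mul, mul_inv_cancel₀ hy']
    simp
  ext i
  have h4 := congrFun h1 i
  rw [OrthonormalBasis.coe_toBasis] at h4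
  rw [h4]
  conv_lhs => rw [h3]
  simp only [firstCoord, OrthonormalBasis.coe_toBasis_repr_apply, map_smul,
    OrthonormalBasis.repr_self]
  by_cases hi : i = 0
  · simp [hi, RCLike.real_smul_eq_coe_mul]
  · have : i.val ≠ 0 := fun h ↦ hi (Fin.ext h)
    simp [hi, this]

/-- The matrix `Y` with the row `x` put on top of it. -/
def consRow (x : Fin m → 𝕜) (Y : Matrix (Fin n) (Fin m) 𝕜) : Matrix (Fin (n + 1)) (Fin m) 𝕜 :=
  Matrix.of fun i j ↦ Fin.cons (α := fun _ ↦ 𝕜) (x j) (fun i ↦ Y i j) i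

/-- The matrix `X` with the column `y` put to the left of it. -/
def consCol (y : Fin n → 𝕜) (X : Matrix (Fin n) (Fin m) 𝕜) : Matrix (Fin n) (Fin (m + 1)) 𝕜 :=
  Matrix.of fun i j ↦ Fin.cons (α := fun _ ↦ 𝕜) (y i) (fun j ↦ X i j) j

/-- The matrix with first row `(a, 0)`, and `(y, X)` below it. -/
def bordered (a : ℝ) (y : Fin n → 𝕜) (X : Matrix (Fin n) (Fin m) 𝕜) :
    Matrix (Fin (n + 1)) (Fin (m + 1)) 𝕜 :=
  consRow (firstCoord 𝕜 (m + 1) a) (consCol y X)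

lemma coe_piFinSuccAbove_zero_symm (α : Type*) [MeasurableSpace α] (n : ℕ) :
    ⇑(MeasurableEquiv.piFinSuccAbove (fun _ : Fin (n + 1) ↦ α) 0).symm
      = fun p ↦ (Fin.cons p.1 p.2 : Fin (n + 1) → α) := by
  ext p i
  simp [MeasurableEquiv.piFinSuccAbove]

lemma consRow_eq (x : Fin m → 𝕜) (Y : Matrix (Fin n) (Fin m) 𝕜) :
    consRow x Y = Matrix.of (Fin.cons (α := fun _ ↦ Fin m → 𝕜) x (Matrix.of.symm Y)) := by
  ext i j
  refine Fin.cases ?_ (fun i ↦ ?_) i <;> simp [consRow]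

lemma gaussianMatrixLaw_succ_rows : gaussianMatrixLaw 𝕜 (n + 1) m =
    ((Measure.pi fun _ ↦ stdNormal 𝕜).prod (gaussianMatrixLaw 𝕜 n m)).map
      fun p ↦ consRow p.1 p.2 := by
  have := (measurePreserving_piFinSuccAbove
    (fun _ : Fin (n + 1) ↦ Measure.pi fun _ : Fin m ↦ stdNormal 𝕜) 0).symm.map_eq
  rw [coe_piFinSuccAbove_zero_symm] at this
  simp_rw [consRow_eq]
  exact this.symm

lemma gaussianMatrixLaw_succ_cols : gaussianMatrixLaw 𝕜 n (m + 1) =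
    ((Measure.pi fun _ ↦ stdNormal 𝕜).prod (gaussianMatrixLaw 𝕜 n m)).map
      fun p ↦ consCol p.1 p.2 := by
  have h1 := (measurePreserving_piFinSuccAbove (fun _ : Fin (m + 1) ↦ stdNormal 𝕜) 0).symm
  have h2 := measurePreserving_pi (fun _ : Fin n ↦ _) (fun _ : Fin n ↦ _) (fun _ ↦ h1)
  have h3 := (measurePreserving_arrowProdEquivProdArrow 𝕜 (Fin m → 𝕜) (Fin n)
    (fun _ ↦ stdNormal 𝕜) (fun _ ↦ Measure.pi fun _ ↦ stdNormal 𝕜)).symm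
  have h4 := (h2.comp h3).map_eq.symm
  rw [coe_piFinSuccAbove_zero_symm] at h4
  exact h4

lemma measurable_consRow :
    Measurable fun p : (Fin m → 𝕜) × Matrix (Fin n) (Fin m) 𝕜 ↦ consRow p.1 p.2 := by
  refine measurable_matrix fun i j ↦ ?_
  refine Fin.cases ?_ (fun i ↦ ?_) i
  · exact (measurable_pi_apply j).comp measurable_fst
  · exact measurable_snd.matrix_entry i j

lemma measurable_consCol :
    Measurable fun p : (Fin n → 𝕜) × Matrix (Fin n) (Fin m) 𝕜 ↦ consCol p.1 p.2 := by
  refine measurable_matrix fun i j ↦ ?_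
  refine Fin.cases ?_ (fun j ↦ ?_) j
  · exact (measurable_pi_apply i).comp measurable_fst
  · exact measurable_snd.matrix_entry i j

lemma measurable_bordered {Ω : Type*} [MeasurableSpace Ω] {a : Ω → ℝ} {y : Ω → Fin n → 𝕜}
    {X : Ω → Matrix (Fin n) (Fin m) 𝕜} (ha : Measurable a) (hy : Measurable y)
    (hX : Measurable X) : Measurable fun ω ↦ bordered (a ω) (y ω) (X ω) := by
  exact measurable_consRow.comp ((measurable_firstCoord.comp ha).prodMk
    (measurable_consCol.comp (hy.prodMk hX)))

lemma lintegral_norm_pi_stdNormal {h : ℝ → ℝ≥0∞} (hh : Measurable h) :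
    ∫⁻ x : Fin n → 𝕜, h ‖WithLp.toLp 2 x‖ ∂(Measure.pi fun _ ↦ stdNormal 𝕜)
      = ∫⁻ a, h (a / √(dyson 𝕜)) ∂chiLaw (dyson 𝕜 * n) := by
  have hd : √(dyson 𝕜 : ℝ) ≠ 0 := (Real.sqrt_pos.2 (by exact_mod_cast dyson_pos 𝕜)).ne'
  have h1 := gaussianVec_map_norm (𝕜 := 𝕜) (ι := Fin n)
  rw [Fintype.card_fin] at h1
  rw [← h1, lintegral_map (by fun_prop) (by fun_prop), gaussianVec,
    lintegral_map (by fun_prop) (by fun_prop)]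
  simp [hd]

/-- The first row of a Gaussian matrix can be rotated onto the first coordinate axis without
changing the law of the other rows. -/
lemma lintegral_gaussianMatrixLaw_succ {F : Matrix (Fin (n + 1)) (Fin (m + 1)) 𝕜 → ℝ≥0∞}
    (hF : Measurable F) (hV : ∀ V ∈ Matrix.unitaryGroup (Fin (m + 1)) 𝕜, ∀ X, F (X * V) = F X) :
    ∫⁻ X, F X ∂gaussianMatrixLaw 𝕜 (n + 1) (m + 1)
      = ∫⁻ a, ∫⁻ y, ∫⁻ X, F (bordered (a / √(dyson 𝕜)) y X) ∂gaussianMatrixLaw 𝕜 n m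
        ∂(Measure.pi fun _ ↦ stdNormal 𝕜) ∂chiLaw (dyson 𝕜 * (m + 1)) := by
  have hF1 : Measurable fun p : (Fin (m + 1) → 𝕜) × Matrix (Fin n) (Fin (m + 1)) 𝕜 ↦
    F (consRow p.1 p.2) := hF.comp measurable_consRow
  have hrow : ∀ x : Fin (m + 1) → 𝕜,
      ∫⁻ Y, F (consRow x Y) ∂gaussianMatrixLaw 𝕜 n (m + 1)
        = ∫⁻ Y, F (consRow (firstCoord 𝕜 (m + 1) ‖WithLp.toLp 2 x‖) Y)
          ∂gaussianMatrixLaw 𝕜 n (m + 1) := by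
    intro x
    obtain ⟨U, hU, hUx⟩ := exists_unitary_mulVec_eq_firstCoord (WithLp.toLp 2 (star x))
    have hUs : U.conjTranspose ∈ Matrix.unitaryGroup (Fin (m + 1)) 𝕜 := Unitary.star_mem hU
    have h1 : Matrix.vecMul x U.conjTranspose = firstCoord 𝕜 (m + 1) ‖WithLp.toLp 2 x‖ := by
      have := congrArg star hUx
      rw [Matrix.star_mulVec, star_star] at this
      rw [this]
      ext i
      by_cases hi : i.val = 0 <;> simp [firstCoord, hi, EuclideanSpace.norm_eq]
    have h2 : ∀ Y : Matrix (Fin n) (Fin (m + 1)) 𝕜, F (consRow x Y)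
        = F (consRow (firstCoord 𝕜 (m + 1) ‖WithLp.toLp 2 x‖)
          ((1 : Matrix (Fin n) (Fin n) 𝕜) * Y * U.conjTranspose)) := by
      intro Y
      rw [← hV _ hUs, ← h1]
      congr 1
      ext i j
      refine Fin.cases ?_ (fun i ↦ ?_) i
      · simp [consRow, Matrix.mul_apply, Matrix.vecMul, dotProduct]
      · simp [consRow, Matrix.mul_apply]
    simp_rw [h2]
    rw [← lintegral_map (f := fun Y ↦ F (consRow
      (firstCoord 𝕜 (m + 1) ‖WithLp.toLp 2 x‖) Y)) (μ := gaussianMatrixLaw 𝕜 n (m + 1))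
      (g := fun Y ↦ (1 : Matrix (Fin n) (Fin n) 𝕜) * Y * U.conjTranspose)
      (hF1.comp (measurable_const.prodMk measurable_id)) (by fun_prop),
      gaussianMatrixLaw_map_mul (one_mem _) hUs]
  rw [gaussianMatrixLaw_succ_rows, lintegral_map hF measurable_consRow,
    lintegral_prod _ hF1.aemeasurable]
  refine (lintegral_congr fun x ↦ hrow x).trans ?_
  have hm : Measurable fun r : ℝ ↦ ∫⁻ Y, F (consRow (firstCoord 𝕜 (m + 1) r) Y)
      ∂gaussianMatrixLaw 𝕜 n (m + 1) := by
    refine Measurable.lintegral_prod_right' (f := fun p : ℝ × Matrix (Fin n) (Fin (m + 1)) 𝕜 ↦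
      F (consRow (firstCoord 𝕜 (m + 1) p.1) p.2)) ?_
    exact hF1.comp ((measurable_firstCoord.comp measurable_fst).prodMk measurable_snd)
  have h3 := lintegral_norm_pi_stdNormal (𝕜 := 𝕜) (n := m + 1) hm
  rw [h3]
  refine lintegral_congr fun a ↦ ?_
  have hF2 : Measurable fun Y : Matrix (Fin n) (Fin (m + 1)) 𝕜 ↦
      F (consRow (firstCoord 𝕜 (m + 1) (a / √(dyson 𝕜))) Y) :=
    hF1.comp (measurable_const.prodMk measurable_id)
  rw [gaussianMatrixLaw_succ_cols, lintegral_map hF2 measurable_consCol,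
    lintegral_prod (fun p : (Fin n → 𝕜) × Matrix (Fin n) (Fin m) 𝕜 ↦
      F (consRow (firstCoord 𝕜 (m + 1) (a / √(dyson 𝕜))) (consCol p.1 p.2)))
      (hF2.comp measurable_consCol).aemeasurable]
  rfl

/-- The lower bidiagonal matrix with diagonal `a` and subdiagonal `b`. -/
def bidiag (𝕜 : Type*) [RCLike 𝕜] (n m : ℕ) (a b : ℕ → ℝ) : Matrix (Fin n) (Fin m) 𝕜 :=
  Matrix.of fun i j ↦ if i.val = j.val then (a i : 𝕜) else if i.val = j.val + 1 then (b j : 𝕜)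
    else 0

lemma bidiag_succ (a b : ℕ → ℝ) : bidiag 𝕜 (n + 1) (m + 1) a b =
    bordered (a 0) (firstCoord 𝕜 n (b 0)) (bidiag 𝕜 n m (a ∘ Nat.succ) (b ∘ Nat.succ)) := by
  ext i j
  refine Fin.cases ?_ (fun i ↦ ?_) i <;> refine Fin.cases ?_ (fun j ↦ ?_) j
  all_goals simp [bidiag, bordered, consRow, consCol, firstCoord]

/-- A finite sequence, continued by zeros. -/
def extendZero (a : Fin n → ℝ) (k : ℕ) : ℝ := if h : k < n then a ⟨k, h⟩ else 0

lemma extendZero_cons_zero (x : ℝ) (a : Fin n → ℝ) :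
    extendZero (Fin.cons x a : Fin (n + 1) → ℝ) 0 = x := by
  simp [extendZero]

lemma extendZero_cons_succ (x : ℝ) (a : Fin n → ℝ) (k : ℕ) :
    extendZero (Fin.cons x a : Fin (n + 1) → ℝ) (k + 1) = extendZero a k := by
  unfold extendZero
  by_cases h : k < n
  · rw [dif_pos h, dif_pos (by omega)]
    rfl
  · rw [dif_neg h, dif_neg (by omega)]

lemma extendZero_val (a : Fin n → ℝ) (i : Fin n) : extendZero a i = a i := by
  simp [extendZero]

lemma measurable_extendZero (k : ℕ) : Measurable fun a : Fin n → ℝ ↦ extendZero a k := by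
  unfold extendZero
  split_ifs <;> fun_prop

/-- The joint law of independent pairs `(α_j, β_j)`, where `α_j` is chi distributed with
`B (M - j)`, and `β_j` with `B (N - j - 1)` degrees of freedom. -/
def chiPairs (B N M : ℕ) : Measure (Fin N → ℝ × ℝ) :=
  Measure.pi fun j ↦ (chiLaw (B * (M - j))).prod (chiLaw (B * (N - j - 1)))

instance (B N M : ℕ) : IsProbabilityMeasure (chiPairs B N M) := by
  unfold chiPairs
  infer_instance

/-- The bidiagonal matrix with the entries `α_j / √B` and `β_j / √B`. -/
def chiBidiag (𝕜 : Type*) [RCLike 𝕜] {n : ℕ} (m : ℕ) (p : Fin n → ℝ × ℝ) :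
    Matrix (Fin n) (Fin m) 𝕜 :=
  bidiag 𝕜 n m (fun k ↦ extendZero (fun j ↦ (p j).1) k / √(dyson 𝕜))
    (fun k ↦ extendZero (fun j ↦ (p j).2) k / √(dyson 𝕜))

lemma measurable_chiBidiag : Measurable (chiBidiag 𝕜 m : (Fin n → ℝ × ℝ) → _) := by
  refine measurable_matrix fun i j ↦ ?_
  unfold chiBidiag bidiag
  have h1 : ∀ k, Measurable fun p : Fin n → ℝ × ℝ ↦ extendZero (fun j ↦ (p j).1) k :=
    fun k ↦ (measurable_extendZero k).comp (f := fun p : Fin n → ℝ × ℝ ↦ fun j ↦ (p j).1)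
      (by fun_prop)
  have h2 : ∀ k, Measurable fun p : Fin n → ℝ × ℝ ↦ extendZero (fun j ↦ (p j).2) k :=
    fun k ↦ (measurable_extendZero k).comp (f := fun p : Fin n → ℝ × ℝ ↦ fun j ↦ (p j).2)
      (by fun_prop)
  simp only [Matrix.of_apply]
  split_ifs
  · exact RCLike.measurable_ofReal.comp ((h1 _).div_const _)
  · exact RCLike.measurable_ofReal.comp ((h2 _).div_const _)
  · exact measurable_const

lemma chiBidiag_cons (q : ℝ × ℝ) (p : Fin n → ℝ × ℝ) :
    chiBidiag 𝕜 (m + 1) (Fin.cons q p : Fin (n + 1) → ℝ × ℝ)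
      = bordered (q.1 / √(dyson 𝕜)) (firstCoord 𝕜 n (q.2 / √(dyson 𝕜))) (chiBidiag 𝕜 m p) := by
  have h1 : (fun j ↦ ((Fin.cons q p : Fin (n + 1) → ℝ × ℝ) j).1)
      = (Fin.cons q.1 fun j ↦ (p j).1 : Fin (n + 1) → ℝ) := by
    ext j; refine Fin.cases ?_ (fun j ↦ ?_) j <;> simp
  have h2 : (fun j ↦ ((Fin.cons q p : Fin (n + 1) → ℝ × ℝ) j).2)
      = (Fin.cons q.2 fun j ↦ (p j).2 : Fin (n + 1) → ℝ) := by
    ext j; refine Fin.cases ?_ (fun j ↦ ?_) j <;> simp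
  unfold chiBidiag
  rw [bidiag_succ, h1, h2]
  simp [extendZero_cons_zero, extendZero_cons_succ, Function.comp_def]

lemma chiPairs_succ (B n m : ℕ) : chiPairs B (n + 1) (m + 1) =
    (((chiLaw (B * (m + 1))).prod (chiLaw (B * n))).prod (chiPairs B n m)).map
      fun p ↦ (Fin.cons p.1 p.2 : Fin (n + 1) → ℝ × ℝ) := by
  have := (measurePreserving_piFinSuccAbove (fun j : Fin (n + 1) ↦
    (chiLaw (B * (m + 1 - j))).prod (chiLaw (B * (n + 1 - j - 1)))) 0).symm.map_eq
  rw [coe_piFinSuccAbove_zero_symm] at this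
  unfold chiPairs
  rw [← this]
  simp

/-- The block diagonal matrix with the blocks `1` and `U`. -/
def oneBlock (U : Matrix (Fin n) (Fin n) 𝕜) : Matrix (Fin (n + 1)) (Fin (n + 1)) 𝕜 :=
  bordered 1 0 U

lemma oneBlock_mul_bordered (U : Matrix (Fin n) (Fin n) 𝕜) (a : ℝ) (y : Fin n → 𝕜)
    (X : Matrix (Fin n) (Fin m) 𝕜) :
    oneBlock U * bordered a y X = bordered a (U.mulVec y) (U * X) := by
  ext i j
  refine Fin.cases ?_ (fun i ↦ ?_) i <;> refine Fin.cases ?_ (fun j ↦ ?_) j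
  all_goals simp [oneBlock, bordered, consRow, consCol, firstCoord, Matrix.mul_apply,
    Fin.sum_univ_succ, Matrix.mulVec, dotProduct]

lemma bordered_mul_oneBlock (V : Matrix (Fin m) (Fin m) 𝕜) (a : ℝ) (y : Fin n → 𝕜)
    (X : Matrix (Fin n) (Fin m) 𝕜) :
    bordered a y X * oneBlock V = bordered a y (X * V) := by
  ext i j
  refine Fin.cases ?_ (fun i ↦ ?_) i <;> refine Fin.cases ?_ (fun j ↦ ?_) j
  all_goals simp [oneBlock, bordered, consRow, consCol, firstCoord, Matrix.mul_apply,
    Fin.sum_univ_succ]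

lemma oneBlock_one : oneBlock (1 : Matrix (Fin n) (Fin n) 𝕜) = 1 := by
  ext i j
  refine Fin.cases ?_ (fun i ↦ ?_) i <;> refine Fin.cases ?_ (fun j ↦ ?_) j
  all_goals simp [oneBlock, bordered, consRow, consCol, firstCoord, Matrix.one_apply,
    Fin.succ_ne_zero, (Fin.succ_ne_zero _).symm]

lemma conjTranspose_oneBlock (U : Matrix (Fin n) (Fin n) 𝕜) :
    (oneBlock U).conjTranspose = oneBlock U.conjTranspose := by
  ext i j
  refine Fin.cases ?_ (fun i ↦ ?_) i <;> refine Fin.cases ?_ (fun j ↦ ?_) j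
  all_goals simp [oneBlock, bordered, consRow, consCol, firstCoord]

lemma oneBlock_mem_unitaryGroup {U : Matrix (Fin n) (Fin n) 𝕜}
    (hU : U ∈ Matrix.unitaryGroup (Fin n) 𝕜) :
    oneBlock U ∈ Matrix.unitaryGroup (Fin (n + 1)) 𝕜 := by
  rw [Matrix.mem_unitaryGroup_iff, Matrix.star_eq_conjTranspose, conjTranspose_oneBlock]
  rw [Matrix.mem_unitaryGroup_iff, Matrix.star_eq_conjTranspose] at hU
  have := oneBlock_mul_bordered U 1 0 U.conjTranspose
  rw [hU, Matrix.mulVec_zero] at this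
  exact this.trans oneBlock_one

lemma oneBlock_mulVec_firstCoord (U : Matrix (Fin n) (Fin n) 𝕜) (c : ℝ) :
    (oneBlock U).mulVec (firstCoord 𝕜 (n + 1) c) = firstCoord 𝕜 (n + 1) c := by
  ext i
  refine Fin.cases ?_ (fun i ↦ ?_) i
  all_goals simp [oneBlock, bordered, consRow, consCol, firstCoord, Matrix.mulVec, dotProduct,
    Fin.sum_univ_succ]

/-- A function of a Gaussian matrix that is invariant under the unitary matrices fixing the first
basis vector from the left, and under all unitary matrices from the right, has the same law at a
bidiagonal matrix with independent chi distributed entries. -/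
theorem lintegral_gaussianMatrixLaw_eq_bidiag (hNM : N ≤ M)
    {F : Matrix (Fin N) (Fin M) 𝕜 → ℝ≥0∞} (hF : Measurable F)
    (hV : ∀ V ∈ Matrix.unitaryGroup (Fin M) 𝕜, ∀ X, F (X * V) = F X)
    (hU : ∀ U ∈ Matrix.unitaryGroup (Fin N) 𝕜, U.mulVec (firstCoord 𝕜 N 1) = firstCoord 𝕜 N 1 →
      ∀ X, F (U * X) = F X) :
    ∫⁻ X, F X ∂gaussianMatrixLaw 𝕜 N M
      = ∫⁻ p, F (chiBidiag 𝕜 M p) ∂chiPairs (dyson 𝕜) N M := by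
  induction N generalizing M with
  | zero =>
    have h : ∀ X, F X = F 0 := fun X ↦ congrArg F (Subsingleton.elim _ _)
    simp_rw [h]
    simp
  | succ n ih =>
    obtain ⟨m, rfl⟩ : ∃ m, M = m + 1 := ⟨M - 1, by omega⟩
    have hnm : n ≤ m := by omega
    have hcons : Measurable fun p : (ℝ × ℝ) × (Fin n → ℝ × ℝ) ↦
        (Fin.cons p.1 p.2 : Fin (n + 1) → ℝ × ℝ) :=
      coe_piFinSuccAbove_zero_symm (ℝ × ℝ) n ▸ MeasurableEquiv.measurable _
    have hm : Measurable fun p ↦ F (chiBidiag 𝕜 (m + 1) (n := n + 1) p) :=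
      hF.comp measurable_chiBidiag
    rw [lintegral_gaussianMatrixLaw_succ hF hV, chiPairs_succ, lintegral_map hm hcons,
      lintegral_prod (fun p : (ℝ × ℝ) × (Fin n → ℝ × ℝ) ↦ F (chiBidiag 𝕜 (m + 1)
        (Fin.cons p.1 p.2 : Fin (n + 1) → ℝ × ℝ))) (hm.comp hcons).aemeasurable,
      lintegral_prod (fun q : ℝ × ℝ ↦ ∫⁻ p, F (chiBidiag 𝕜 (m + 1)
        (Fin.cons q p : Fin (n + 1) → ℝ × ℝ)) ∂chiPairs (dyson 𝕜) n m)
        (hm.comp hcons).lintegral_prod_right'.aemeasurable]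
    refine lintegral_congr fun a ↦ ?_
    -- A unitary matrix that fixes the first basis vector rotates the rest of the first column.
    have hcol : ∀ y : Fin n → 𝕜,
        ∫⁻ X, F (bordered (a / √(dyson 𝕜)) y X) ∂gaussianMatrixLaw 𝕜 n m
          = ∫⁻ X, F (bordered (a / √(dyson 𝕜)) (firstCoord 𝕜 n ‖WithLp.toLp 2 y‖) X)
            ∂gaussianMatrixLaw 𝕜 n m := by
      intro y
      obtain ⟨U, hUm, hUy⟩ := exists_unitary_mulVec_eq_firstCoord (WithLp.toLp 2 y)
      have h1 : ∀ X, F (bordered (a / √(dyson 𝕜)) y X)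
          = F (bordered (a / √(dyson 𝕜)) (firstCoord 𝕜 n ‖WithLp.toLp 2 y‖)
            (U * X * (1 : Matrix (Fin m) (Fin m) 𝕜))) := by
        intro X
        rw [← hU _ (oneBlock_mem_unitaryGroup hUm) (oneBlock_mulVec_firstCoord U 1),
          oneBlock_mul_bordered, ← hUy, Matrix.mul_one]
      simp_rw [h1]
      rw [← lintegral_map (f := fun X ↦ F (bordered (a / √(dyson 𝕜))
        (firstCoord 𝕜 n ‖WithLp.toLp 2 y‖) X)) (μ := gaussianMatrixLaw 𝕜 n m)
        (g := fun X ↦ U * X * (1 : Matrix (Fin m) (Fin m) 𝕜))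
        (hF.comp (measurable_bordered measurable_const measurable_const measurable_id)) (by fun_prop), gaussianMatrixLaw_map_mul hUm (one_mem _)]
    refine (lintegral_congr fun y ↦ hcol y).trans ?_
    have hmr : Measurable fun r : ℝ ↦ ∫⁻ X, F (bordered (a / √(dyson 𝕜)) (firstCoord 𝕜 n r) X)
        ∂gaussianMatrixLaw 𝕜 n m :=
      Measurable.lintegral_prod_right' (f := fun p : ℝ × Matrix (Fin n) (Fin m) 𝕜 ↦
        F (bordered (a / √(dyson 𝕜)) (firstCoord 𝕜 n p.1) p.2))
        (hF.comp (measurable_bordered measurable_const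
          (measurable_firstCoord.comp measurable_fst) measurable_snd))
    have h3 := lintegral_norm_pi_stdNormal (𝕜 := 𝕜) (n := n) hmr
    rw [h3]
    refine lintegral_congr fun b ↦ ?_
    rw [ih (F := fun X ↦ F (bordered (a / √(dyson 𝕜)) (firstCoord 𝕜 n (b / √(dyson 𝕜))) X)) hnm
      (hF.comp (measurable_bordered measurable_const measurable_const measurable_id))]
    · refine lintegral_congr fun p ↦ ?_
      rw [chiBidiag_cons]
    · intro V hVm X
      rw [← bordered_mul_oneBlock, hV _ (oneBlock_mem_unitaryGroup hVm)]
    · intro U hUm hUe X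
      have h4 : U.mulVec (firstCoord 𝕜 n (b / √(dyson 𝕜))) = firstCoord 𝕜 n (b / √(dyson 𝕜)) := by
        have : firstCoord 𝕜 n (b / √(dyson 𝕜))
            = ((b / √(dyson 𝕜) : ℝ) : 𝕜) • firstCoord 𝕜 n 1 := by
          ext i
          by_cases hi : i.val = 0 <;> simp [firstCoord, hi]
        rw [this, Matrix.mulVec_smul, hUe]
      rw [← hU _ (oneBlock_mem_unitaryGroup hUm) (oneBlock_mulVec_firstCoord U 1)
        (bordered _ _ X), oneBlock_mul_bordered, h4]

end Reduction

/-! ### Closed formulas for the Krylov iterates -/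

section Formulas

variable {N M : ℕ}

/-- The matrix with the columns `b, W b, …, W ^ (k - 1) b`. -/
def krylovMatrix (W : Matrix (Fin N) (Fin N) 𝕜) (b : Fin N → 𝕜) (k : ℕ) :
    Matrix (Fin N) (Fin k) 𝕜 :=
  Matrix.of fun i j ↦ (W ^ (j : ℕ)).mulVec b i

lemma krylovMatrix_mulVec_of_intertwining {W W' S : Matrix (Fin N) (Fin N) 𝕜}
    (h : W' * S = S * W) (b : Fin N → 𝕜) (k : ℕ) :
    krylovMatrix W' (S.mulVec b) k = S * krylovMatrix W b k := by
  have hp : ∀ j : ℕ, W' ^ j * S = S * W ^ j := fun j ↦ by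
    induction j with
    | zero => simp
    | succ j ih => rw [pow_succ, Matrix.mul_assoc, h, ← Matrix.mul_assoc, ih, Matrix.mul_assoc,
        ← pow_succ]
  ext i j
  simp only [krylovMatrix, Matrix.of_apply, Matrix.mulVec_mulVec, hp, Matrix.mul_apply]
  rw [← Matrix.mulVec_mulVec]
  rfl

lemma ofLp_toEuclideanLin (A : Matrix (Fin N) (Fin M) 𝕜) (v : EuclideanSpace 𝕜 (Fin M)) :
    (A.toEuclideanLin v).ofLp = A.mulVec v.ofLp := rfl

lemma krylovMatrix_mulVec_mem (W : Matrix (Fin N) (Fin N) 𝕜) (b : EuclideanSpace 𝕜 (Fin N))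
    (k : ℕ) (t : Fin k → 𝕜) :
    WithLp.toLp 2 ((krylovMatrix W b.ofLp k).mulVec t) ∈ krylov W b k := by
  have : WithLp.toLp 2 ((krylovMatrix W b.ofLp k).mulVec t)
      = ∑ j, t j • (W ^ (j : ℕ)).toEuclideanLin b := by
    ext i
    rw [WithLp.ofLp_sum, Finset.sum_apply]
    simp only [WithLp.ofLp_smul, ofLp_toEuclideanLin]
    simp [krylovMatrix, Matrix.mulVec, dotProduct, mul_comm]
  rw [this]
  exact Submodule.sum_mem _ fun j _ ↦ Submodule.smul_mem _ _ (Submodule.subset_span ⟨j, rfl⟩)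

/-- The solution `y` in the range of `K` of the projected equations `K* A y = K* c`. -/
def galerkin {k : ℕ} (K : Matrix (Fin N) (Fin k) 𝕜) (A : Matrix (Fin N) (Fin N) 𝕜)
    (c : Fin N → 𝕜) : Fin N → 𝕜 :=
  K.mulVec ((K.conjTranspose * A * K)⁻¹.mulVec (K.conjTranspose.mulVec c))

lemma conjTranspose_mulVec_galerkin {k : ℕ} {K : Matrix (Fin N) (Fin k) 𝕜}
    {A : Matrix (Fin N) (Fin N) 𝕜} (h : IsUnit (K.conjTranspose * A * K).det) (c : Fin N → 𝕜) :
    K.conjTranspose.mulVec (A.mulVec (galerkin K A c)) = K.conjTranspose.mulVec c := by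
  rw [galerkin, Matrix.mulVec_mulVec _ A, Matrix.mulVec_mulVec _ K.conjTranspose,
    ← Matrix.mul_assoc, Matrix.mulVec_mulVec, Matrix.mul_nonsing_inv _ h, Matrix.one_mulVec]

/-- A closed formula for the conjugate gradient iterates. Its value is arbitrary if the projected
equations are singular. -/
def cgFormula (W : Matrix (Fin N) (Fin N) 𝕜) (b : Fin N → 𝕜) (k : ℕ) : Fin N → 𝕜 :=
  galerkin (krylovMatrix W b k) W b

/-- A closed formula for the MINRES iterates of a Hermitian matrix. Its value is arbitrary if the
projected equations are singular. -/
def minresFormula (W : Matrix (Fin N) (Fin N) 𝕜) (b : Fin N → 𝕜) (k : ℕ) : Fin N → 𝕜 :=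
  galerkin (krylovMatrix W b k) (W * W) (W.mulVec b)

/-- The norm of the conjugate gradient residual, according to `cgFormula`. -/
def cgResidualFormula (W : Matrix (Fin N) (Fin N) 𝕜) (b : Fin N → 𝕜) (k : ℕ) : ℝ :=
  ‖WithLp.toLp 2 (b - W.mulVec (cgFormula W b k))‖

/-- The energy norm of the conjugate gradient error, according to `cgFormula`. -/
def cgErrorFormula (W : Matrix (Fin N) (Fin N) 𝕜) (b : Fin N → 𝕜) (k : ℕ) : ℝ :=
  energyNorm W (WithLp.toLp 2 (W⁻¹.mulVec b - cgFormula W b k))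

/-- The norm of the MINRES residual, according to `minresFormula`. -/
def minresResidualFormula (W : Matrix (Fin N) (Fin N) 𝕜) (b : Fin N → 𝕜) (k : ℕ) : ℝ :=
  ‖WithLp.toLp 2 (b - W.mulVec (minresFormula W b k))‖

/-- The matrix `W` is invertible, and `b, W b, …, W ^ (N - 1) b` is a basis. For positive definite
`W`, this makes all projected equations non-singular. -/
def IsRegular (W : Matrix (Fin N) (Fin N) 𝕜) (b : Fin N → 𝕜) : Prop :=
  (W * krylovMatrix W b N).det ≠ 0

lemma IsRegular.det_ne_zero {W : Matrix (Fin N) (Fin N) 𝕜} {b : Fin N → 𝕜}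
    (h : IsRegular W b) : W.det ≠ 0 := by
  rw [IsRegular, Matrix.det_mul] at h
  exact left_ne_zero_of_mul h

lemma IsRegular.krylovMatrix_injective {W : Matrix (Fin N) (Fin N) 𝕜} {b : Fin N → 𝕜}
    (h : IsRegular W b) {k : ℕ} (hk : k ≤ N) :
    Function.Injective (krylovMatrix W b k).mulVec := by
  rw [IsRegular, Matrix.det_mul] at h
  have h1 : Function.Injective (krylovMatrix W b N).mulVec :=
    Matrix.mulVec_injective_of_isUnit ((Matrix.isUnit_iff_isUnit_det _).2
      (right_ne_zero_of_mul h).isUnit)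
  rw [Matrix.mulVec_injective_iff] at h1 ⊢
  exact h1.comp (Fin.castLE hk) (Fin.castLE_injective hk)

section Minimality

variable {W : Matrix (Fin N) (Fin N) 𝕜} {b x : EuclideanSpace 𝕜 (Fin N)} {k : ℕ}

open scoped ComplexOrder

/-- An element of the Krylov space whose residual is orthogonal to it is a conjugate gradient
iterate. -/
lemma isCGIterate_of_inner_eq_zero (hW : W.PosDef) (hx : x ∈ krylov W b k)
    (h : ∀ w ∈ krylov W b k, inner 𝕜 w (b - W.toEuclideanLin x) = 0) : IsCGIterate W b k x := by
  refine ⟨hx, fun y hy ↦ Real.sqrt_le_sqrt ?_⟩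
  change RCLike.re (inner 𝕜 (W⁻¹.toEuclideanLin b - x) _) ≤ _
  have hd : x - y ∈ krylov W b k := Submodule.sub_mem _ hx hy
  set e := W⁻¹.toEuclideanLin b - x with he
  have hWe : W.toEuclideanLin e = b - W.toEuclideanLin x := by
    rw [he, map_sub]
    congr 1
    ext i
    simp [Matrix.mulVec_mulVec,
      Matrix.mul_nonsing_inv _ ((Matrix.isUnit_iff_isUnit_det _).1 hW.isUnit)]
  have hadj : ∀ u v, inner 𝕜 (W.toEuclideanLin u) v = inner 𝕜 u (W.toEuclideanLin v) := by
    intro u v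
    rw [← LinearMap.adjoint_inner_right, ← Matrix.toEuclideanLin_conjTranspose_eq_adjoint,
      hW.isHermitian.eq]
  have h1 : W⁻¹.toEuclideanLin b - y = e + (x - y) := by rw [he]; abel
  have h0 := h _ hd
  rw [← hWe] at h0
  have h0' : inner 𝕜 e (W.toEuclideanLin (x - y)) = 0 := by
    rw [← hadj, ← inner_conj_symm, h0, map_zero]
  have h2 : 0 ≤ RCLike.re (inner 𝕜 (x - y) (W.toEuclideanLin (x - y))) := by
    have := hW.posSemidef.re_dotProduct_nonneg (x - y).ofLp
    rw [EuclideanSpace.inner_eq_star_dotProduct, dotProduct_comm]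
    exact this
  rw [h1, map_add, inner_add_left, inner_add_right, inner_add_right, h0, h0']
  simpa using h2

/-- An element of the Krylov space whose residual is orthogonal to the image of the Krylov space
is a MINRES iterate. -/
lemma isMINRESIterate_of_inner_eq_zero (hx : x ∈ krylov W b k)
    (h : ∀ w ∈ krylov W b k, inner 𝕜 (W.toEuclideanLin w) (b - W.toEuclideanLin x) = 0) :
    IsMINRESIterate W b k x := by
  refine ⟨hx, fun y hy ↦ ?_⟩
  change ‖b - W.toEuclideanLin x‖ ≤ ‖b - W.toEuclideanLin y‖
  have hd := h _ (Submodule.sub_mem _ hx hy)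
  have h1 : b - W.toEuclideanLin y = W.toEuclideanLin (x - y) + (b - W.toEuclideanLin x) := by
    rw [map_sub]; abel
  have h2 := norm_add_sq_eq_norm_sq_add_norm_sq_of_inner_eq_zero _ _ hd
  rw [← h1] at h2
  nlinarith [norm_nonneg (b - W.toEuclideanLin x), norm_nonneg (b - W.toEuclideanLin y),
    norm_nonneg (W.toEuclideanLin (x - y))]

lemma IsCGIterate.eq_cgIterate (hW : W.PosDef) (h : IsCGIterate W b k x) :
    cgIterate W b k = x :=
  (existsUnique_isCGIterate hW b k).unique (Classical.epsilon_spec ⟨x, h⟩) h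

lemma IsMINRESIterate.eq_minresIterate (hW : W.PosDef) (h : IsMINRESIterate W b k x) :
    minresIterate W b k = x :=
  (existsUnique_isMINRESIterate hW b k).unique (Classical.epsilon_spec ⟨x, h⟩) h

lemma inner_krylov_eq_zero {v : EuclideanSpace 𝕜 (Fin N)}
    (h : (krylovMatrix W b.ofLp k).conjTranspose.mulVec v.ofLp = 0) :
    ∀ w ∈ krylov W b k, inner 𝕜 w v = 0 := by
  intro w hw
  induction hw using Submodule.span_induction with
  | mem w hw =>
    obtain ⟨j, rfl⟩ := hw
    have := congrFun h j
    rw [EuclideanSpace.inner_eq_star_dotProduct, dotProduct_comm]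
    exact this
  | zero => simp
  | add u w _ _ hu hw => rw [inner_add_left, hu, hw, add_zero]
  | smul c w _ hw => rw [inner_smul_left, hw, mul_zero]

lemma cgIterate_eq_cgFormula (hW : W.PosDef) (hr : IsRegular W b.ofLp) (hk : k ≤ N) :
    cgIterate W b k = WithLp.toLp 2 (cgFormula W b.ofLp k) := by
  refine (isCGIterate_of_inner_eq_zero hW (krylovMatrix_mulVec_mem W b k _)
    (inner_krylov_eq_zero ?_)).eq_cgIterate hW
  have hpos := hW.conjTranspose_mul_mul_same (hr.krylovMatrix_injective hk)
  have := conjTranspose_mulVec_galerkin ((Matrix.isUnit_iff_isUnit_det _).1 hpos.isUnit) b.ofLp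
  have h2 : (b - W.toEuclideanLin (WithLp.toLp 2 (cgFormula W b.ofLp k))).ofLp
    = b.ofLp - W.mulVec (cgFormula W b.ofLp k) := by
    ext i; simp
  exact (congrArg _ h2).trans (by rw [Matrix.mulVec_sub, cgFormula, this, sub_self])

lemma minresIterate_eq_minresFormula (hW : W.PosDef) (hr : IsRegular W b.ofLp) (hk : k ≤ N) :
    minresIterate W b k = WithLp.toLp 2 (minresFormula W b.ofLp k) := by
  refine (isMINRESIterate_of_inner_eq_zero (krylovMatrix_mulVec_mem W b k _) ?_).eq_minresIterate hW
  have hadj : ∀ u v, inner 𝕜 (W.toEuclideanLin u) v = inner 𝕜 u (W.toEuclideanLin v) := by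
    intro u v
    rw [← LinearMap.adjoint_inner_right, ← Matrix.toEuclideanLin_conjTranspose_eq_adjoint,
      hW.isHermitian.eq]
  simp_rw [hadj]
  refine inner_krylov_eq_zero ?_
  have hWW : (W * W).PosDef := by
    have := (Matrix.PosDef.one (n := Fin N) (R := 𝕜)).conjTranspose_mul_mul_same
      (Matrix.mulVec_injective_of_isUnit hW.isUnit)
    rwa [Matrix.mul_one, hW.isHermitian.eq] at this
  have hpos := hWW.conjTranspose_mul_mul_same (hr.krylovMatrix_injective hk)
  have := conjTranspose_mulVec_galerkin ((Matrix.isUnit_iff_isUnit_det _).1 hpos.isUnit)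
    (W.mulVec b.ofLp)
  have h2 : (W.toEuclideanLin (b - W.toEuclideanLin
      (WithLp.toLp 2 (minresFormula W b.ofLp k)))).ofLp
    = W.mulVec b.ofLp - (W * W).mulVec (minresFormula W b.ofLp k) := by
    rw [← Matrix.mulVec_mulVec, ← Matrix.mulVec_sub]
    rfl
  exact (congrArg _ h2).trans (by rw [Matrix.mulVec_sub, minresFormula, this, sub_self])

lemma norm_cgResidual (hW : W.PosDef) (hr : IsRegular W b.ofLp) (hk : k ≤ N) :
    ‖cgResidual W b k‖ = cgResidualFormula W b.ofLp k := by
  rw [cgResidual, cgIterate_eq_cgFormula hW hr hk, cgResidualFormula]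
  rfl

lemma energyNorm_cgError (hW : W.PosDef) (hr : IsRegular W b.ofLp) (hk : k ≤ N) :
    energyNorm W (cgError W b k) = cgErrorFormula W b.ofLp k := by
  rw [cgError, cgIterate_eq_cgFormula hW hr hk, cgErrorFormula]
  rfl

lemma norm_minresResidual (hW : W.PosDef) (hr : IsRegular W b.ofLp) (hk : k ≤ N) :
    ‖minresResidual W b k‖ = minresResidualFormula W b.ofLp k := by
  rw [minresResidual, minresIterate_eq_minresFormula hW hr hk, minresResidualFormula]
  rfl

end Minimality

section Equivariance

variable {W U : Matrix (Fin N) (Fin N) 𝕜} {b : Fin N → 𝕜} {k : ℕ}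

lemma norm_unitary_mulVec (hU : U ∈ Matrix.unitaryGroup (Fin N) 𝕜) (v : Fin N → 𝕜) :
    ‖WithLp.toLp 2 (U.mulVec v)‖ = ‖WithLp.toLp 2 v‖ := by
  have hUU : U.conjTranspose * U = 1 := (Matrix.mem_unitaryGroup_iff').1 hU
  have h : inner 𝕜 (WithLp.toLp 2 (U.mulVec v)) (WithLp.toLp 2 (U.mulVec v))
      = inner 𝕜 (WithLp.toLp 2 v) (WithLp.toLp 2 v) := by
    rw [EuclideanSpace.inner_toLp_toLp, EuclideanSpace.inner_toLp_toLp, dotProduct_comm,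
      Matrix.star_mulVec, Matrix.dotProduct_mulVec, Matrix.vecMul_vecMul, hUU, Matrix.vecMul_one,
      dotProduct_comm]
  rw [@norm_eq_sqrt_re_inner 𝕜, @norm_eq_sqrt_re_inner 𝕜, h]

lemma krylovMatrix_unitary_conj (hU : U ∈ Matrix.unitaryGroup (Fin N) 𝕜) :
    krylovMatrix (U * W * U.conjTranspose) (U.mulVec b) k = U * krylovMatrix W b k := by
  have hUU : U.conjTranspose * U = 1 := (Matrix.mem_unitaryGroup_iff').1 hU
  refine krylovMatrix_mulVec_of_intertwining ?_ b k
  rw [Matrix.mul_assoc, hUU, Matrix.mul_one]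

lemma galerkin_unitary_conj (hU : U ∈ Matrix.unitaryGroup (Fin N) 𝕜)
    (K : Matrix (Fin N) (Fin k) 𝕜) :
    galerkin (U * K) (U * W * U.conjTranspose) (U.mulVec b) = U.mulVec (galerkin K W b) := by
  have hUU : U.conjTranspose * U = 1 := (Matrix.mem_unitaryGroup_iff').1 hU
  have h1 : (U * K).conjTranspose * (U * W * U.conjTranspose) * (U * K)
      = K.conjTranspose * W * K := by
    rw [Matrix.conjTranspose_mul]
    calc K.conjTranspose * U.conjTranspose * (U * W * U.conjTranspose) * (U * K)
        = K.conjTranspose * (U.conjTranspose * U) * W * (U.conjTranspose * U) * K := by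
          simp only [Matrix.mul_assoc]
      _ = _ := by rw [hUU]; simp [Matrix.mul_assoc]
  have h2 : (U * K).conjTranspose.mulVec (U.mulVec b) = K.conjTranspose.mulVec b := by
    rw [Matrix.mulVec_mulVec, Matrix.conjTranspose_mul, Matrix.mul_assoc, hUU, Matrix.mul_one]
  rw [galerkin, galerkin, h1, h2, ← Matrix.mulVec_mulVec]

lemma cgFormula_unitary_conj (hU : U ∈ Matrix.unitaryGroup (Fin N) 𝕜) :
    cgFormula (U * W * U.conjTranspose) (U.mulVec b) k = U.mulVec (cgFormula W b k) := by
  rw [cgFormula, krylovMatrix_unitary_conj hU, galerkin_unitary_conj hU, cgFormula]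

lemma unitary_conj_mulVec (hU : U ∈ Matrix.unitaryGroup (Fin N) 𝕜) (v : Fin N → 𝕜) :
    (U * W * U.conjTranspose).mulVec (U.mulVec v) = U.mulVec (W.mulVec v) := by
  have hUU : U.conjTranspose * U = 1 := (Matrix.mem_unitaryGroup_iff').1 hU
  rw [Matrix.mulVec_mulVec, Matrix.mul_assoc, hUU, Matrix.mul_one, Matrix.mulVec_mulVec]

lemma minresFormula_unitary_conj (hU : U ∈ Matrix.unitaryGroup (Fin N) 𝕜) :
    minresFormula (U * W * U.conjTranspose) (U.mulVec b) k = U.mulVec (minresFormula W b k) := by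
  have hUU : U.conjTranspose * U = 1 := (Matrix.mem_unitaryGroup_iff').1 hU
  have h : U * W * U.conjTranspose * (U * W * U.conjTranspose) = U * (W * W) * U.conjTranspose := by
    calc U * W * U.conjTranspose * (U * W * U.conjTranspose)
        = U * W * (U.conjTranspose * U) * W * U.conjTranspose := by simp only [Matrix.mul_assoc]
      _ = _ := by rw [hUU]; simp [Matrix.mul_assoc]
  rw [minresFormula, krylovMatrix_unitary_conj hU, h, unitary_conj_mulVec hU,
    galerkin_unitary_conj hU, minresFormula]

lemma cgResidualFormula_unitary_conj (hU : U ∈ Matrix.unitaryGroup (Fin N) 𝕜) :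
    cgResidualFormula (U * W * U.conjTranspose) (U.mulVec b) k = cgResidualFormula W b k := by
  rw [cgResidualFormula, cgFormula_unitary_conj hU, unitary_conj_mulVec hU, ← Matrix.mulVec_sub,
    norm_unitary_mulVec hU, cgResidualFormula]

lemma minresResidualFormula_unitary_conj (hU : U ∈ Matrix.unitaryGroup (Fin N) 𝕜) :
    minresResidualFormula (U * W * U.conjTranspose) (U.mulVec b) k
      = minresResidualFormula W b k := by
  rw [minresResidualFormula, minresFormula_unitary_conj hU, unitary_conj_mulVec hU,
    ← Matrix.mulVec_sub, norm_unitary_mulVec hU, minresResidualFormula]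

lemma cgErrorFormula_unitary_conj (hU : U ∈ Matrix.unitaryGroup (Fin N) 𝕜) :
    cgErrorFormula (U * W * U.conjTranspose) (U.mulVec b) k = cgErrorFormula W b k := by
  have hUU : U.conjTranspose * U = 1 := (Matrix.mem_unitaryGroup_iff').1 hU
  have hUU' : U * U.conjTranspose = 1 := (Matrix.mem_unitaryGroup_iff).1 hU
  have hinv : (U * W * U.conjTranspose)⁻¹ = U * W⁻¹ * U.conjTranspose := by
    rw [Matrix.mul_inv_rev, Matrix.mul_inv_rev, Matrix.inv_eq_right_inv hUU,
      Matrix.inv_eq_right_inv hUU', Matrix.mul_assoc]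
  have he : ∀ v, energyNorm (U * W * U.conjTranspose) (WithLp.toLp 2 (U.mulVec v))
      = energyNorm W (WithLp.toLp 2 v) := by
    intro v
    have h1 : (U * W * U.conjTranspose).toEuclideanLin (WithLp.toLp 2 (U.mulVec v))
        = WithLp.toLp 2 (U.mulVec (W.mulVec v)) := by
      rw [← unitary_conj_mulVec hU]; rfl
    have h2 : W.toEuclideanLin (WithLp.toLp 2 v) = WithLp.toLp 2 (W.mulVec v) := rfl
    rw [energyNorm, energyNorm, h1, h2, EuclideanSpace.inner_toLp_toLp,
      EuclideanSpace.inner_toLp_toLp, dotProduct_comm, Matrix.star_mulVec,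
      Matrix.dotProduct_mulVec, Matrix.vecMul_vecMul, hUU, Matrix.vecMul_one, dotProduct_comm]
  rw [cgErrorFormula, hinv, cgFormula_unitary_conj hU, unitary_conj_mulVec hU,
    ← Matrix.mulVec_sub, he, cgErrorFormula]

lemma isRegular_unitary_conj (hU : U ∈ Matrix.unitaryGroup (Fin N) 𝕜) :
    IsRegular (U * W * U.conjTranspose) (U.mulVec b) ↔ IsRegular W b := by
  have hUU : U.conjTranspose * U = 1 := (Matrix.mem_unitaryGroup_iff').1 hU
  have h : U.det ≠ 0 := fun h0 ↦ by
    have := congrArg Matrix.det hUU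
    simp [h0] at this
  unfold IsRegular
  rw [krylovMatrix_unitary_conj hU]
  have : U * W * U.conjTranspose * (U * krylovMatrix W b N) = U * (W * krylovMatrix W b N) := by
    calc U * W * U.conjTranspose * (U * krylovMatrix W b N)
        = U * W * (U.conjTranspose * U) * krylovMatrix W b N := by simp only [Matrix.mul_assoc]
      _ = _ := by rw [hUU]; simp [Matrix.mul_assoc]
  rw [this, Matrix.det_mul U]
  simp [h]

end Equivariance

section Measurability

variable {Ω : Type*} [MeasurableSpace Ω]

lemma _root_.Measurable.matrix_mulVec {m n : Type*} [Fintype n] {A : Ω → Matrix m n 𝕜}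
    {v : Ω → n → 𝕜} (hA : Measurable A) (hv : Measurable v) :
    Measurable fun ω ↦ (A ω).mulVec (v ω) := by
  refine measurable_pi_lambda _ fun i ↦ ?_
  simp only [Matrix.mulVec, dotProduct]
  exact Finset.measurable_sum _ fun j _ ↦
    (hA.matrix_entry i j).mul ((measurable_pi_apply j).comp hv)

lemma _root_.Measurable.matrix_det {n : Type*} [Fintype n] [DecidableEq n]
    {A : Ω → Matrix n n 𝕜} (hA : Measurable A) : Measurable fun ω ↦ (A ω).det := by
  simp only [Matrix.det_apply]
  exact Finset.measurable_sum _ fun σ _ ↦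
    (Finset.measurable_prod _ fun i _ ↦ hA.matrix_entry _ _).const_smul _

lemma _root_.Measurable.matrix_inv {n : Type*} [Fintype n] [DecidableEq n]
    {A : Ω → Matrix n n 𝕜} (hA : Measurable A) : Measurable fun ω ↦ (A ω)⁻¹ := by
  refine measurable_matrix fun i j ↦ ?_
  simp only [Matrix.inv_def, Ring.inverse_eq_inv, Matrix.smul_apply, smul_eq_mul,
    Matrix.adjugate_apply]
  refine hA.matrix_det.inv.mul (Measurable.matrix_det (measurable_matrix fun k l ↦ ?_))
  by_cases h : k = j
  · subst h
    simp only [Matrix.updateRow_self]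
    exact measurable_const
  · simp only [Matrix.updateRow_ne h]
    exact hA.matrix_entry k l

lemma _root_.Measurable.matrix_pow {n : Type*} [Fintype n] [DecidableEq n]
    {A : Ω → Matrix n n 𝕜} (hA : Measurable A) (k : ℕ) : Measurable fun ω ↦ (A ω) ^ k := by
  induction k with
  | zero => simp
  | succ k ih =>
    simp only [pow_succ]
    exact ih.matrix_mul hA

variable {W : Ω → Matrix (Fin N) (Fin N) 𝕜} {b : Ω → Fin N → 𝕜}

lemma measurable_krylovMatrix (hW : Measurable W) (hb : Measurable b) (k : ℕ) :
    Measurable fun ω ↦ krylovMatrix (W ω) (b ω) k :=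
  measurable_matrix fun i j ↦ (measurable_pi_apply i).comp ((hW.matrix_pow j).matrix_mulVec hb)

lemma measurable_galerkin {k : ℕ} {K : Ω → Matrix (Fin N) (Fin k) 𝕜} (hK : Measurable K)
    (hW : Measurable W) (hb : Measurable b) :
    Measurable fun ω ↦ galerkin (K ω) (W ω) (b ω) :=
  hK.matrix_mulVec (((hK.matrix_conjTranspose.matrix_mul hW).matrix_mul hK).matrix_inv.matrix_mulVec
    (hK.matrix_conjTranspose.matrix_mulVec hb))

lemma measurable_cgFormula (hW : Measurable W) (hb : Measurable b) (k : ℕ) :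
    Measurable fun ω ↦ cgFormula (W ω) (b ω) k :=
  measurable_galerkin (measurable_krylovMatrix hW hb k) hW hb

lemma measurable_minresFormula (hW : Measurable W) (hb : Measurable b) (k : ℕ) :
    Measurable fun ω ↦ minresFormula (W ω) (b ω) k :=
  measurable_galerkin (measurable_krylovMatrix hW hb k) (hW.matrix_mul hW) (hW.matrix_mulVec hb)

lemma measurable_cgResidualFormula (hW : Measurable W) (hb : Measurable b) (k : ℕ) :
    Measurable fun ω ↦ cgResidualFormula (W ω) (b ω) k :=
  ((WithLp.measurable_toLp 2 _).comp
    (hb.sub (hW.matrix_mulVec (measurable_cgFormula hW hb k)))).norm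

lemma measurable_minresResidualFormula (hW : Measurable W) (hb : Measurable b) (k : ℕ) :
    Measurable fun ω ↦ minresResidualFormula (W ω) (b ω) k :=
  ((WithLp.measurable_toLp 2 _).comp
    (hb.sub (hW.matrix_mulVec (measurable_minresFormula hW hb k)))).norm

lemma measurable_cgErrorFormula (hW : Measurable W) (hb : Measurable b) (k : ℕ) :
    Measurable fun ω ↦ cgErrorFormula (W ω) (b ω) k := by
  have h := (hW.matrix_inv.matrix_mulVec hb).sub (measurable_cgFormula hW hb k)
  refine (RCLike.measurable_re.comp (Measurable.inner ((WithLp.measurable_toLp 2 _).comp h)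
    ((WithLp.measurable_toLp 2 _).comp (hW.matrix_mulVec h)))).sqrt

lemma measurableSet_isRegular (hW : Measurable W) (hb : Measurable b) :
    MeasurableSet {ω | IsRegular (W ω) (b ω)} :=
  (measurableSet_eq_fun (hW.matrix_mul (measurable_krylovMatrix hW hb N)).matrix_det
    measurable_const).compl

lemma measurable_sampleCov : Measurable (sampleCov : Matrix (Fin N) (Fin M) 𝕜 → _) := by
  refine measurable_matrix fun i j ↦ ?_
  have : Measurable fun X : Matrix (Fin N) (Fin M) 𝕜 ↦ X * X.conjTranspose := by fun_prop
  exact (this.matrix_entry i j).const_smul (M : 𝕜)⁻¹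

end Measurability

section Reduction

lemma sampleCov_unitary_mul (U : Matrix (Fin N) (Fin N) 𝕜) (X : Matrix (Fin N) (Fin M) 𝕜) :
    sampleCov (U * X) = U * sampleCov X * U.conjTranspose := by
  simp [sampleCov, Matrix.mul_assoc]

lemma sampleCov_mul_unitary {V : Matrix (Fin M) (Fin M) 𝕜}
    (hV : V ∈ Matrix.unitaryGroup (Fin M) 𝕜) (X : Matrix (Fin N) (Fin M) 𝕜) :
    sampleCov (X * V) = sampleCov X := by
  have hVV : V * V.conjTranspose = 1 := (Matrix.mem_unitaryGroup_iff).1 hV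
  rw [sampleCov, sampleCov, Matrix.conjTranspose_mul, Matrix.mul_assoc X, ← Matrix.mul_assoc V,
    hVV, Matrix.one_mul]

/-- The law of a unitarily equivariant function of a Wishart matrix and a fixed vector is
obtained from a bidiagonal matrix and a multiple of the first basis vector. -/
theorem lintegral_sampleCov_eq_bidiag (hNM : N ≤ M)
    {G : Matrix (Fin N) (Fin N) 𝕜 → (Fin N → 𝕜) → ℝ≥0∞} (hG : ∀ b, Measurable fun W ↦ G W b)
    (hGU : ∀ U ∈ Matrix.unitaryGroup (Fin N) 𝕜, ∀ W b,
      G (U * W * U.conjTranspose) (U.mulVec b) = G W b) (b : EuclideanSpace 𝕜 (Fin N)) :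
    ∫⁻ X : Matrix (Fin N) (Fin M) 𝕜, G (sampleCov X) b.ofLp ∂gaussianMatrixLaw 𝕜 N M
      = ∫⁻ p, G (sampleCov (chiBidiag 𝕜 M p)) (firstCoord 𝕜 N ‖b‖) ∂chiPairs (dyson 𝕜) N M := by
  obtain ⟨U, hU, hUb⟩ := exists_unitary_mulVec_eq_firstCoord b
  have hm : Measurable fun X : Matrix (Fin N) (Fin M) 𝕜 ↦
    G (sampleCov X) (firstCoord 𝕜 N ‖b‖) := (hG _).comp measurable_sampleCov
  rw [← lintegral_gaussianMatrixLaw_eq_bidiag hNM hm,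
    ← gaussianMatrixLaw_map_mul hU (one_mem (Matrix.unitaryGroup (Fin M) 𝕜)),
    lintegral_map hm (by fun_prop), gaussianMatrixLaw_map_mul hU (one_mem _)]
  · refine lintegral_congr fun X ↦ ?_
    rw [Matrix.mul_one, sampleCov_unitary_mul, ← hUb, hGU U hU]
  · intro V hV X
    simp only [sampleCov_mul_unitary hV]
  · intro V hV hVe X
    have h4 : V.mulVec (firstCoord 𝕜 N ‖b‖) = firstCoord 𝕜 N ‖b‖ := by
      have : firstCoord 𝕜 N ‖b‖ = (‖b‖ : 𝕜) • firstCoord 𝕜 N 1 := by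
        ext i
        by_cases hi : i.val = 0 <;> simp [firstCoord, hi]
      rw [this, Matrix.mulVec_smul, hVe]
    rw [sampleCov_unitary_mul]
    conv_lhs => rw [← h4]
    exact hGU V hV _ _

end Reduction

end Formulas

/-! ### The Krylov methods for a bidiagonal matrix -/

section Bidiagonal

variable {N M : ℕ}

/-- The `j`-th standard basis vector, and `0` for `j ≥ n`. -/
def stdVec (𝕜 : Type*) [RCLike 𝕜] (n j : ℕ) : EuclideanSpace 𝕜 (Fin n) :=
  WithLp.toLp 2 fun i ↦ if i.val = j then 1 else 0

lemma stdVec_of_le {n j : ℕ} (h : n ≤ j) : stdVec 𝕜 n j = 0 := by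
  ext i
  simp [stdVec, (i.isLt.trans_le h).ne]

lemma inner_stdVec {n i j : ℕ} (hi : i < n) :
    inner 𝕜 (stdVec 𝕜 n i) (stdVec 𝕜 n j) = if i = j then 1 else 0 := by
  simp only [stdVec, EuclideanSpace.inner_toLp_toLp, dotProduct]
  rw [Finset.sum_eq_single ⟨i, hi⟩]
  · by_cases h : i = j <;> simp [h]
  · intro l _ hl
    have : l.val ≠ i := fun h ↦ hl (Fin.ext h)
    simp [this]
  · simp

lemma eq_top_of_stdVec_mem {n : ℕ} {S : Submodule 𝕜 (EuclideanSpace 𝕜 (Fin n))}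
    (h : ∀ j < n, stdVec 𝕜 n j ∈ S) : S = ⊤ := by
  refine eq_top_iff.2 fun x _ ↦ ?_
  have : x = ∑ i : Fin n, x i • stdVec 𝕜 n i := by
    ext l
    simp [stdVec, ← Fin.ext_iff]
  rw [this]
  exact Submodule.sum_mem _ fun i _ ↦ Submodule.smul_mem _ _ (h i i.isLt)

lemma norm_sq_sum_smul_stdVec {n : ℕ} (s : Finset ℕ) (hs : ∀ i ∈ s, i < n) (c : ℕ → 𝕜) :
    ‖∑ i ∈ s, c i • stdVec 𝕜 n i‖ ^ 2 = ∑ i ∈ s, ‖c i‖ ^ 2 := by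
  rw [← RCLike.ofReal_inj (K := 𝕜), RCLike.ofReal_pow, ← inner_self_eq_norm_sq_to_K (𝕜 := 𝕜),
    sum_inner, RCLike.ofReal_sum]
  refine Finset.sum_congr rfl fun i hi ↦ ?_
  rw [inner_sum, Finset.sum_eq_single i]
  · rw [inner_smul_left, inner_smul_right, inner_stdVec (hs i hi), if_pos rfl, mul_one,
      RCLike.conj_mul, RCLike.ofReal_pow]
  · intro j _ hj
    rw [inner_smul_left, inner_smul_right, inner_stdVec (hs i hi), if_neg hj.symm]
    simp
  · exact fun h ↦ (h hi).elim

lemma bidiag_stdVec (hNM : N ≤ M) (a b : ℕ → ℝ) {j : ℕ} (hj : j < N) :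
    (bidiag 𝕜 N M a b).toEuclideanLin (stdVec 𝕜 M j)
      = (a j : 𝕜) • stdVec 𝕜 N j + (b j : 𝕜) • stdVec 𝕜 N (j + 1) := by
  ext i
  rw [ofLp_toEuclideanLin]
  simp only [stdVec, Matrix.mulVec, dotProduct]
  rw [Finset.sum_eq_single ⟨j, hj.trans_le hNM⟩]
  · simp only [bidiag, Matrix.of_apply, PiLp.add_apply, PiLp.smul_apply, smul_eq_mul]
    by_cases h : i.val = j
    · simp [h]
    · by_cases h' : i.val = j + 1 <;> simp [h, h']
  · intro l _ hl
    have : l.val ≠ j := fun h ↦ hl (Fin.ext h)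
    simp [this]
  · simp

lemma bidiag_conjTranspose_stdVec_zero (a b : ℕ → ℝ) (hN : 0 < N) :
    (bidiag 𝕜 N M a b).conjTranspose.toEuclideanLin (stdVec 𝕜 N 0)
      = (a 0 : 𝕜) • stdVec 𝕜 M 0 := by
  ext i
  rw [ofLp_toEuclideanLin]
  simp only [stdVec, Matrix.mulVec, dotProduct]
  rw [Finset.sum_eq_single ⟨0, hN⟩]
  · by_cases h : i.val = 0
    · simp [bidiag, h, RCLike.real_smul_eq_coe_mul]
    · simp [bidiag, h, Ne.symm h]
  · intro l _ hl
    have : l.val ≠ 0 := fun h ↦ hl (Fin.ext h)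
    simp [this]
  · simp

lemma bidiag_conjTranspose_stdVec_succ (a b : ℕ → ℝ) {j : ℕ} (hj : j + 1 < N) :
    (bidiag 𝕜 N M a b).conjTranspose.toEuclideanLin (stdVec 𝕜 N (j + 1))
      = (a (j + 1) : 𝕜) • stdVec 𝕜 M (j + 1) + (b j : 𝕜) • stdVec 𝕜 M j := by
  ext i
  rw [ofLp_toEuclideanLin]
  simp only [stdVec, Matrix.mulVec, dotProduct]
  rw [Finset.sum_eq_single ⟨j + 1, hj⟩]
  · simp only [bidiag, Matrix.conjTranspose_apply, Matrix.of_apply, PiLp.add_apply,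
      PiLp.smul_apply, smul_eq_mul]
    by_cases h : i.val = j + 1
    · simp [h]
    · by_cases h' : i.val = j
      · simp [h']
      · simp [h, h', Ne.symm h, Ne.symm h']
  · intro l _ hl
    have : l.val ≠ j + 1 := fun h ↦ hl (Fin.ext h)
    simp [this]
  · simp

lemma sampleCov_toEuclideanLin (X : Matrix (Fin N) (Fin M) 𝕜) (v : EuclideanSpace 𝕜 (Fin N)) :
    (sampleCov X).toEuclideanLin v
      = (M : 𝕜)⁻¹ • X.toEuclideanLin (X.conjTranspose.toEuclideanLin v) := by
  ext i
  rw [WithLp.ofLp_smul, ofLp_toEuclideanLin, ofLp_toEuclideanLin, ofLp_toEuclideanLin, sampleCov,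
    Matrix.smul_mulVec, Matrix.mulVec_mulVec]

lemma inner_sampleCov (X : Matrix (Fin N) (Fin M) 𝕜) (v : EuclideanSpace 𝕜 (Fin N)) :
    inner 𝕜 v ((sampleCov X).toEuclideanLin v)
      = (((M : ℝ)⁻¹ * ‖X.conjTranspose.toEuclideanLin v‖ ^ 2 : ℝ) : 𝕜) := by
  rw [sampleCov_toEuclideanLin, inner_smul_right, Matrix.toEuclideanLin_conjTranspose_eq_adjoint,
    ← LinearMap.adjoint_inner_left, inner_self_eq_norm_sq_to_K]
  push_cast
  rfl

open scoped ComplexOrder in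
lemma posSemidef_sampleCov (X : Matrix (Fin N) (Fin M) 𝕜) : (sampleCov X).PosSemidef := by
  refine (Matrix.posSemidef_self_mul_conjTranspose X).smul ?_
  rw [← RCLike.ofReal_natCast, ← RCLike.ofReal_inv, RCLike.ofReal_nonneg]
  positivity

open scoped ComplexOrder in
lemma posDef_sampleCov {X : Matrix (Fin N) (Fin M) 𝕜} (h : (sampleCov X).det ≠ 0) :
    (sampleCov X).PosDef :=
  (posSemidef_sampleCov X).posDef_iff_isUnit.2 ((Matrix.isUnit_iff_isUnit_det _).2 h.isUnit)

variable (𝕜) in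
/-- For the bidiagonal matrix `H` with the diagonal `a` and the subdiagonal `b`, the vectors
that are mapped to the standard basis vectors by `H*`. -/
def dualVec (N : ℕ) (a b : ℕ → ℝ) : ℕ → EuclideanSpace 𝕜 (Fin N)
  | 0 => (a 0 : 𝕜)⁻¹ • stdVec 𝕜 N 0
  | j + 1 => (a (j + 1) : 𝕜)⁻¹ • (stdVec 𝕜 N (j + 1) - (b j : 𝕜) • dualVec N a b j)

section

variable {a b : ℕ → ℝ} (hNM : N ≤ M) (ha : ∀ j < N, 0 < a j) (hb : ∀ j, j + 1 < N → 0 < b j)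

include hNM ha

lemma conjTranspose_dualVec {j : ℕ} (hj : j < N) :
    (bidiag 𝕜 N M a b).conjTranspose.toEuclideanLin (dualVec 𝕜 N a b j) = stdVec 𝕜 M j := by
  induction j with
  | zero =>
    have h : (a 0 : 𝕜) ≠ 0 := by exact_mod_cast (ha 0 hj).ne'
    rw [dualVec, map_smul, bidiag_conjTranspose_stdVec_zero a b hj, inv_smul_smul₀ h]
  | succ j ih =>
    have h : (a (j + 1) : 𝕜) ≠ 0 := by exact_mod_cast (ha _ hj).ne'
    rw [dualVec, map_smul, map_sub, map_smul, ih (by omega),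
      bidiag_conjTranspose_stdVec_succ a b hj, add_sub_cancel_right, inv_smul_smul₀ h]

lemma sampleCov_dualVec {j : ℕ} (hj : j < N) :
    (sampleCov (bidiag 𝕜 N M a b)).toEuclideanLin (dualVec 𝕜 N a b j)
      = (M : 𝕜)⁻¹ • ((a j : 𝕜) • stdVec 𝕜 N j + (b j : 𝕜) • stdVec 𝕜 N (j + 1)) := by
  rw [sampleCov_toEuclideanLin, conjTranspose_dualVec hNM ha hj, bidiag_stdVec hNM a b hj]

omit hNM in
lemma stdVec_zero_eq (hN : 0 < N) : stdVec 𝕜 N 0 = (a 0 : 𝕜) • dualVec 𝕜 N a b 0 := by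
  have h : (a 0 : 𝕜) ≠ 0 := by exact_mod_cast (ha 0 hN).ne'
  rw [dualVec, smul_inv_smul₀ h]

omit hNM in
lemma stdVec_succ_eq {j : ℕ} (hj : j + 1 < N) : stdVec 𝕜 N (j + 1)
    = (a (j + 1) : 𝕜) • dualVec 𝕜 N a b (j + 1) + (b j : 𝕜) • dualVec 𝕜 N a b j := by
  have h : (a (j + 1) : 𝕜) ≠ 0 := by exact_mod_cast (ha _ hj).ne'
  rw [dualVec, smul_inv_smul₀ h, sub_add_cancel]

omit hNM ha in
lemma inner_dualVec_stdVec {j k : ℕ} (hjk : j < k) (hk : k < N) :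
    inner 𝕜 (dualVec 𝕜 N a b j) (stdVec 𝕜 N k) = 0 := by
  induction j with
  | zero => rw [dualVec, inner_smul_left, inner_stdVec (by omega), if_neg (by omega), mul_zero]
  | succ j ih =>
    rw [dualVec, inner_smul_left, inner_sub_left, inner_smul_left, ih (by omega),
      inner_stdVec (by omega), if_neg (by omega)]
    simp

/-- The span of the first `k` vectors `dualVec`. -/
def dualSpan (𝕜 : Type*) [RCLike 𝕜] (N : ℕ) (a b : ℕ → ℝ) (k : ℕ) :
    Submodule 𝕜 (EuclideanSpace 𝕜 (Fin N)) :=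
  Submodule.span 𝕜 (dualVec 𝕜 N a b '' Set.Iio k)

omit hNM ha in
lemma dualVec_mem_dualSpan {j k : ℕ} (h : j < k) : dualVec 𝕜 N a b j ∈ dualSpan 𝕜 N a b k :=
  Submodule.subset_span ⟨j, h, rfl⟩

omit hNM ha in
lemma dualSpan_mono {k l : ℕ} (h : k ≤ l) : dualSpan 𝕜 N a b k ≤ dualSpan 𝕜 N a b l :=
  Submodule.span_mono (Set.image_mono (Set.Iio_subset_Iio h))

omit hNM in
lemma stdVec_mem_dualSpan {j k : ℕ} (h : j < k) : stdVec 𝕜 N j ∈ dualSpan 𝕜 N a b k := by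
  rcases le_or_gt N j with hj | hj
  · rw [stdVec_of_le hj]
    exact zero_mem _
  rcases j with - | j
  · rw [stdVec_zero_eq ha hj]
    exact Submodule.smul_mem _ _ (dualVec_mem_dualSpan h)
  · rw [stdVec_succ_eq ha hj]
    exact Submodule.add_mem _ (Submodule.smul_mem _ _ (dualVec_mem_dualSpan h))
      (Submodule.smul_mem _ _ (dualVec_mem_dualSpan (by omega)))

omit hNM ha in
lemma krylov_mono (W : Matrix (Fin N) (Fin N) 𝕜) (v : EuclideanSpace 𝕜 (Fin N)) {k l : ℕ}
    (h : k ≤ l) : krylov W v k ≤ krylov W v l := by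
  refine Submodule.span_mono ?_
  rintro _ ⟨i, rfl⟩
  exact ⟨Fin.castLE h i, rfl⟩

omit hNM ha in
lemma mem_krylov_succ (W : Matrix (Fin N) (Fin N) 𝕜) (v : EuclideanSpace 𝕜 (Fin N)) {k : ℕ}
    {x : EuclideanSpace 𝕜 (Fin N)} (hx : x ∈ krylov W v k) :
    W.toEuclideanLin x ∈ krylov W v (k + 1) := by
  induction hx using Submodule.span_induction with
  | mem x hx =>
    obtain ⟨i, rfl⟩ := hx
    refine Submodule.subset_span ⟨i.succ, ?_⟩
    ext l
    simp only [ofLp_toEuclideanLin, Fin.val_succ, pow_succ', Matrix.mulVec_mulVec]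
  | zero => simp
  | add u w _ _ hu hw => rw [map_add]; exact add_mem hu hw
  | smul c w _ hw => rw [map_smul]; exact Submodule.smul_mem _ _ hw

include hb

/-- The Krylov spaces of the bidiagonal model started at a multiple of the first basis vector. -/
lemma krylov_eq_dualSpan {t : ℝ} (ht : t ≠ 0) {k : ℕ} (hk : k ≤ N) :
    krylov (sampleCov (bidiag 𝕜 N M a b)) ((t : 𝕜) • stdVec 𝕜 N 0) k = dualSpan 𝕜 N a b k := by
  set W := sampleCov (bidiag 𝕜 N M a b) with hW
  have ht' : (t : 𝕜) ≠ 0 := by exact_mod_cast ht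
  apply le_antisymm
  · have hstep : ∀ {x : EuclideanSpace 𝕜 (Fin N)} {l : ℕ}, l ≤ N → x ∈ dualSpan 𝕜 N a b l →
        W.toEuclideanLin x ∈ dualSpan 𝕜 N a b (l + 1) := by
      intro x l hl hx
      induction hx using Submodule.span_induction with
      | mem x hx =>
        obtain ⟨j, hj, rfl⟩ := hx
        have hj : j < l := hj
        rw [sampleCov_dualVec hNM ha (by omega)]
        exact Submodule.smul_mem _ _ (Submodule.add_mem _
          (Submodule.smul_mem _ _ (stdVec_mem_dualSpan ha (by omega)))
          (Submodule.smul_mem _ _ (stdVec_mem_dualSpan ha (by omega))))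
      | zero => simp
      | add u w _ _ hu hw => rw [map_add]; exact add_mem hu hw
      | smul c w _ hw => rw [map_smul]; exact Submodule.smul_mem _ _ hw
    have hpow : ∀ i < N, (W ^ i).toEuclideanLin ((t : 𝕜) • stdVec 𝕜 N 0)
        ∈ dualSpan 𝕜 N a b (i + 1) := by
      intro i hi
      induction i with
      | zero =>
        have : (W ^ 0).toEuclideanLin ((t : 𝕜) • stdVec 𝕜 N 0) = (t : 𝕜) • stdVec 𝕜 N 0 := by
          ext l
          rw [ofLp_toEuclideanLin, pow_zero, Matrix.one_mulVec]
        rw [this]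
        exact Submodule.smul_mem _ _ (stdVec_mem_dualSpan ha (by omega))
      | succ i ih =>
        have : (W ^ (i + 1)).toEuclideanLin ((t : 𝕜) • stdVec 𝕜 N 0)
            = W.toEuclideanLin ((W ^ i).toEuclideanLin ((t : 𝕜) • stdVec 𝕜 N 0)) := by
          ext l
          simp only [ofLp_toEuclideanLin, pow_succ', Matrix.mulVec_mulVec]
        rw [this]
        exact hstep (by omega) (ih (by omega))
    refine Submodule.span_le.2 ?_
    rintro _ ⟨i, rfl⟩
    exact dualSpan_mono (by omega) (hpow i (by omega))
  · have key : ∀ j < N, stdVec 𝕜 N j ∈ krylov W ((t : 𝕜) • stdVec 𝕜 N 0) (j + 1) ∧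
        dualVec 𝕜 N a b j ∈ krylov W ((t : 𝕜) • stdVec 𝕜 N 0) (j + 1) := by
      intro j hj
      induction j with
      | zero =>
        have h0 : stdVec 𝕜 N 0 ∈ krylov W ((t : 𝕜) • stdVec 𝕜 N 0) (0 + 1) := by
          have h1 : (t : 𝕜) • stdVec 𝕜 N 0 ∈ krylov W ((t : 𝕜) • stdVec 𝕜 N 0) (0 + 1) := by
            refine Submodule.subset_span ⟨0, ?_⟩
            ext l
            rw [ofLp_toEuclideanLin, Fin.val_zero, pow_zero, Matrix.one_mulVec]
          have h2 := Submodule.smul_mem _ (t : 𝕜)⁻¹ h1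
          rwa [inv_smul_smul₀ ht'] at h2
        exact ⟨h0, Submodule.smul_mem _ _ h0⟩
      | succ j ih =>
        obtain ⟨h1, h2⟩ := ih (by omega)
        have hbj : (b j : 𝕜) ≠ 0 := by exact_mod_cast (hb j hj).ne'
        have hM : (M : 𝕜) ≠ 0 := by exact_mod_cast (by omega : M ≠ 0)
        have h3 : stdVec 𝕜 N (j + 1) = (b j : 𝕜)⁻¹ • ((M : 𝕜) • W.toEuclideanLin
            (dualVec 𝕜 N a b j) - (a j : 𝕜) • stdVec 𝕜 N j) := by
          rw [sampleCov_dualVec hNM ha (by omega), smul_inv_smul₀ hM, add_sub_cancel_left,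
            inv_smul_smul₀ hbj]
        have h4 : stdVec 𝕜 N (j + 1) ∈ krylov W ((t : 𝕜) • stdVec 𝕜 N 0) (j + 1 + 1) := by
          rw [h3]
          exact Submodule.smul_mem _ _ (Submodule.sub_mem _ (Submodule.smul_mem _ _
            (mem_krylov_succ W _ h2)) (Submodule.smul_mem _ _ (krylov_mono W _ (by omega) h1)))
        exact ⟨h4, Submodule.smul_mem _ _ (Submodule.sub_mem _ h4 (Submodule.smul_mem _ _
          (krylov_mono W _ (by omega) h2)))⟩
    refine Submodule.span_le.2 ?_
    rintro _ ⟨j, hj, rfl⟩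
    have hj : j < k := hj
    exact krylov_mono W _ (by omega) (key j (by omega)).2

omit hb in
/-- The image of a partial sum of the series for the preimage of a standard basis vector under the
sample covariance matrix `W` of a bidiagonal matrix; as `stdVec` vanishes at the index `N`, the
remainder is `0` for `n = N`. -/
lemma sampleCov_sum_dualVec {k n : ℕ} (hkn : k < n) (hn : n ≤ N) :
    (sampleCov (bidiag 𝕜 N M a b)).toEuclideanLin (∑ i ∈ Finset.Ico k n,
      ((M * ((-1) ^ (i + k) * (∏ j ∈ Finset.Ico k i, b j / a j) / a i) : ℝ) : 𝕜)
        • dualVec 𝕜 N a b i)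
      = stdVec 𝕜 N k - (((-1) ^ (n + k) * ∏ j ∈ Finset.Ico k n, b j / a j : ℝ) : 𝕜)
        • stdVec 𝕜 N n := by
  have hM : (M : 𝕜) ≠ 0 := by exact_mod_cast (by omega : M ≠ 0)
  induction n, (show k + 1 ≤ n from hkn) using Nat.le_induction with
  | base =>
    have hak : (a k : 𝕜) ≠ 0 := by exact_mod_cast (ha k (by omega)).ne'
    have hk1 : (-1 : ℝ) ^ (k + k) = 1 := Even.neg_one_pow ⟨k, rfl⟩
    have hk2 : (-1 : ℝ) ^ (k + 1 + k) = -1 := Odd.neg_one_pow ⟨k, by ring⟩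
    rw [Nat.Ico_succ_singleton, Finset.sum_singleton, Finset.prod_singleton, map_smul,
      sampleCov_dualVec hNM ha (by omega), Finset.Ico_self, Finset.prod_empty, hk1, hk2]
    push_cast
    simp only [smul_add, smul_smul]
    have e1 : (M : 𝕜) * (1 * 1 / (a k : 𝕜)) * ((M : 𝕜)⁻¹ * (a k : 𝕜)) = 1 := by field_simp
    have e2 : (M : 𝕜) * (1 * 1 / (a k : 𝕜)) * ((M : 𝕜)⁻¹ * (b k : 𝕜))
        = -(-1 * ((b k : 𝕜) / (a k : 𝕜))) := by field_simp
    rw [e1, e2, one_smul, neg_smul, sub_eq_add_neg]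
  | succ n hkn ih =>
    have han : (a n : 𝕜) ≠ 0 := by exact_mod_cast (ha n (by omega)).ne'
    rw [Finset.sum_Ico_succ_top (by omega), map_add, ih (by omega) (by omega), map_smul,
      sampleCov_dualVec hNM ha (by omega), Finset.prod_Ico_succ_top (by omega)]
    set p := ∏ j ∈ Finset.Ico k n, b j / a j
    have hs : (-1 : ℝ) ^ (n + 1 + k) = -(-1) ^ (n + k) := by
      rw [show n + 1 + k = n + k + 1 by ring, pow_succ, mul_neg_one]
    rw [hs]
    set s : ℝ := (-1) ^ (n + k)
    push_cast
    simp only [smul_add, smul_smul]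
    have e1 : (M : 𝕜) * ((s : 𝕜) * (p : 𝕜) / (a n : 𝕜)) * ((M : 𝕜)⁻¹ * (a n : 𝕜))
        = (s : 𝕜) * (p : 𝕜) := by field_simp
    have e2 : (M : 𝕜) * ((s : 𝕜) * (p : 𝕜) / (a n : 𝕜)) * ((M : 𝕜)⁻¹ * (b n : 𝕜))
        = -(-(s : 𝕜) * ((p : 𝕜) * ((b n : 𝕜) / (a n : 𝕜)))) := by field_simp
    rw [e1, e2, neg_smul]
    abel

omit hb in
/-- The preimage `y` of the `k`-th standard basis vector under the sample covariance matrix of a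
bidiagonal matrix `H`, and the norm of `H* y`. -/
lemma exists_sampleCov_eq_stdVec {k : ℕ} (hk : k < N) :
    ∃ y, (sampleCov (bidiag 𝕜 N M a b)).toEuclideanLin y = stdVec 𝕜 N k ∧
      ‖(bidiag 𝕜 N M a b).conjTranspose.toEuclideanLin y‖ ^ 2
        = M ^ 2 * ∑ i ∈ Finset.Ico k N, (∏ j ∈ Finset.Ico k i, b j ^ 2 / a j ^ 2) / a i ^ 2 := by
  refine ⟨_, (sampleCov_sum_dualVec hNM ha hk le_rfl).trans (by
    rw [stdVec_of_le le_rfl, smul_zero, sub_zero]), ?_⟩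
  rw [map_sum]
  simp_rw [map_smul]
  rw [Finset.sum_congr rfl (fun i hi ↦ by
    rw [conjTranspose_dualVec hNM ha (Finset.mem_Ico.1 hi).2]), norm_sq_sum_smul_stdVec _
    (fun i hi ↦ by have := (Finset.mem_Ico.1 hi).2; omega), Finset.mul_sum]
  refine Finset.sum_congr rfl fun i _ ↦ ?_
  rw [RCLike.norm_ofReal, sq_abs, mul_pow, div_pow, mul_pow, ← pow_mul, mul_comm _ 2, pow_mul,
    neg_one_sq, one_pow, one_mul, ← Finset.prod_pow]
  simp_rw [div_pow]

omit hb in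
lemma det_sampleCov_bidiag_ne_zero : (sampleCov (bidiag 𝕜 N M a b)).det ≠ 0 := by
  have h : LinearMap.range (sampleCov (bidiag 𝕜 N M a b)).toEuclideanLin = ⊤ :=
    eq_top_of_stdVec_mem fun k hk ↦ by
      obtain ⟨y, hy, -⟩ := exists_sampleCov_eq_stdVec (𝕜 := 𝕜) (b := b) hNM ha hk
      exact ⟨y, hy⟩
  have hs : Function.Surjective (sampleCov (bidiag 𝕜 N M a b)).mulVec := fun v ↦ by
    obtain ⟨y, hy⟩ := LinearMap.range_eq_top.1 h (WithLp.toLp 2 v)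
    exact ⟨y.ofLp, congrArg WithLp.ofLp hy⟩
  exact ((Matrix.isUnit_iff_isUnit_det _).1 (Matrix.mulVec_surjective_iff_isUnit.1 hs)).ne_zero

lemma isRegular_bidiag {t : ℝ} (ht : t ≠ 0) :
    IsRegular (sampleCov (bidiag 𝕜 N M a b)) ((t : 𝕜) • stdVec 𝕜 N 0).ofLp := by
  set W := sampleCov (bidiag 𝕜 N M a b) with hW
  set v := (t : 𝕜) • stdVec 𝕜 N 0
  rw [IsRegular, Matrix.det_mul]
  refine mul_ne_zero (det_sampleCov_bidiag_ne_zero hNM ha) ?_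
  have htop : krylov W v N = ⊤ := by
    rw [krylov_eq_dualSpan hNM ha hb ht le_rfl]
    exact eq_top_of_stdVec_mem fun k hk ↦ stdVec_mem_dualSpan ha hk
  have hs : Function.Surjective (krylovMatrix W v.ofLp N).mulVec := fun u ↦ by
    have hu : WithLp.toLp 2 u ∈ krylov W v N := htop ▸ Submodule.mem_top
    obtain ⟨c, hc⟩ := (Submodule.mem_span_range_iff_exists_fun 𝕜).1 hu
    refine ⟨c, ?_⟩
    have := congrArg WithLp.ofLp hc
    refine Eq.trans ?_ this
    rw [WithLp.ofLp_sum]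
    ext i
    rw [Finset.sum_apply]
    simp only [WithLp.ofLp_smul, ofLp_toEuclideanLin, krylovMatrix]
    simp [Matrix.mulVec, dotProduct, mul_comm]
  exact ((Matrix.isUnit_iff_isUnit_det _).1 (Matrix.mulVec_surjective_iff_isUnit.1 hs)).ne_zero

omit hb in
/-- The explicit conjugate gradient residual is the residual of an element of the Krylov space. -/
lemma exists_residual_eq (t : ℝ) {k : ℕ} (hk : k < N) :
    ∃ x ∈ dualSpan 𝕜 N a b k, (t : 𝕜) • stdVec 𝕜 N 0
      - (sampleCov (bidiag 𝕜 N M a b)).toEuclideanLin x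
      = ((t * ((-1) ^ k * ∏ j ∈ Finset.range k, b j / a j) : ℝ) : 𝕜) • stdVec 𝕜 N k := by
  induction k with
  | zero => exact ⟨0, zero_mem _, by simp⟩
  | succ k ih =>
    obtain ⟨x, hx, h⟩ := ih (by omega)
    have hak : (a k : 𝕜) ≠ 0 := by exact_mod_cast (ha k (by omega)).ne'
    have hM : (M : 𝕜) ≠ 0 := by exact_mod_cast (by omega : M ≠ 0)
    set p := ∏ j ∈ Finset.range k, b j / a j
    refine ⟨x + ((M * (t * ((-1) ^ k * p)) / a k : ℝ) : 𝕜) • dualVec 𝕜 N a b k,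
      Submodule.add_mem _ (dualSpan_mono (by omega) hx)
        (Submodule.smul_mem _ _ (dualVec_mem_dualSpan (by omega))), ?_⟩
    have hp : ∏ j ∈ Finset.range (k + 1), b j / a j = p * (b k / a k) :=
      Finset.prod_range_succ _ _
    rw [map_add, ← sub_sub, h, map_smul, sampleCov_dualVec hNM ha (by omega), hp, pow_succ]
    set s : ℝ := (-1) ^ k
    push_cast
    simp only [smul_add, smul_smul]
    have e1 : (M : 𝕜) * ((t : 𝕜) * ((s : 𝕜) * (p : 𝕜))) / (a k : 𝕜) * ((M : 𝕜)⁻¹ * (a k : 𝕜))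
        = (t : 𝕜) * ((s : 𝕜) * (p : 𝕜)) := by field_simp
    have e2 : (M : 𝕜) * ((t : 𝕜) * ((s : 𝕜) * (p : 𝕜))) / (a k : 𝕜) * ((M : 𝕜)⁻¹ * (b k : 𝕜))
        = -((t : 𝕜) * ((s : 𝕜) * -1 * ((p : 𝕜) * ((b k : 𝕜) / (a k : 𝕜))))) := by field_simp
    rw [e1, e2, neg_smul]
    abel

lemma bidiag_isCGIterate {t : ℝ} (ht : t ≠ 0) {k : ℕ} (hk : k < N)
    {x : EuclideanSpace 𝕜 (Fin N)} (hx : x ∈ dualSpan 𝕜 N a b k) {c : 𝕜}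
    (h : (t : 𝕜) • stdVec 𝕜 N 0 - (sampleCov (bidiag 𝕜 N M a b)).toEuclideanLin x
      = c • stdVec 𝕜 N k) :
    IsCGIterate (sampleCov (bidiag 𝕜 N M a b)) ((t : 𝕜) • stdVec 𝕜 N 0) k x := by
  rw [← krylov_eq_dualSpan hNM ha hb ht hk.le] at hx
  refine isCGIterate_of_inner_eq_zero (posDef_sampleCov (det_sampleCov_bidiag_ne_zero hNM ha))
    hx fun w hw ↦ ?_
  rw [krylov_eq_dualSpan hNM ha hb ht hk.le] at hw
  rw [h, inner_smul_right]
  induction hw using Submodule.span_induction with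
  | mem x hx =>
    obtain ⟨j, hj, rfl⟩ := hx
    rw [inner_dualVec_stdVec hj hk, mul_zero]
  | zero => simp
  | add u w _ _ hu hw => rw [inner_add_left, mul_add, hu, hw, add_zero]
  | smul d w _ hw => rw [inner_smul_left, mul_left_comm, hw, mul_zero]

open scoped ComplexOrder in
/-- The `k`-th residual of the bidiagonal model is a multiple of the `k`-th basis vector. -/
theorem cgResidualFormula_bidiag {t : ℝ} (ht : 0 < t) {k : ℕ} (hk : k < N) :
    cgResidualFormula (sampleCov (bidiag 𝕜 N M a b)) ((t : 𝕜) • stdVec 𝕜 N 0).ofLp k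
      = t * ∏ j ∈ Finset.range k, b j / a j := by
  obtain ⟨x, hx, h⟩ := exists_residual_eq (𝕜 := 𝕜) (b := b) hNM ha t hk
  have hW := posDef_sampleCov (det_sampleCov_bidiag_ne_zero (𝕜 := 𝕜) (b := b) hNM ha)
  rw [← norm_cgResidual hW (isRegular_bidiag hNM ha hb ht.ne') hk.le, cgResidual,
    (bidiag_isCGIterate hNM ha hb ht.ne' hk hx h).eq_cgIterate hW, h, norm_smul]
  have h1 : ‖stdVec 𝕜 N k‖ = 1 := by
    rw [@norm_eq_sqrt_re_inner 𝕜, inner_stdVec hk]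
    simp
  have h2 : 0 ≤ ∏ j ∈ Finset.range k, b j / a j := Finset.prod_nonneg fun j hj ↦ by
    have hj := Finset.mem_range.1 hj
    exact (div_pos (hb j (by omega)) (ha j (by omega))).le
  rw [h1, RCLike.norm_ofReal, abs_mul, abs_mul, abs_pow, abs_neg, abs_one, one_pow,
    abs_of_pos ht, abs_of_nonneg h2]
  ring

open scoped ComplexOrder in
/-- The error is `W⁻¹ r_k`, a multiple of the preimage of the `k`-th basis vector under `W`, which
`exists_sampleCov_eq_stdVec` provides. -/
theorem cgErrorFormula_bidiag {t : ℝ} (ht : 0 < t) {k : ℕ} (hk : k < N) :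
    cgErrorFormula (sampleCov (bidiag 𝕜 N M a b)) ((t : 𝕜) • stdVec 𝕜 N 0).ofLp k
      = √(M * ∑ i ∈ Finset.Ico k N, (∏ j ∈ Finset.Ico k i, b j ^ 2 / a j ^ 2) / a i ^ 2)
        * (t * ∏ j ∈ Finset.range k, b j / a j) := by
  obtain ⟨x, hx, h⟩ := exists_residual_eq (𝕜 := 𝕜) (b := b) hNM ha t hk
  obtain ⟨y, hy, hny⟩ := exists_sampleCov_eq_stdVec (𝕜 := 𝕜) (b := b) hNM ha hk
  have hW := posDef_sampleCov (det_sampleCov_bidiag_ne_zero (𝕜 := 𝕜) (b := b) hNM ha)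
  set W := sampleCov (bidiag 𝕜 N M a b)
  have hinv : ∀ v, W⁻¹.toEuclideanLin (W.toEuclideanLin v) = v := by
    intro v
    ext i
    rw [ofLp_toEuclideanLin, ofLp_toEuclideanLin, Matrix.mulVec_mulVec,
      Matrix.nonsing_inv_mul _ ((Matrix.isUnit_iff_isUnit_det _).1 hW.isUnit), Matrix.one_mulVec]
  have h1 : W⁻¹.toEuclideanLin ((t : 𝕜) • stdVec 𝕜 N 0) - x
      = ((t * ((-1) ^ k * ∏ j ∈ Finset.range k, b j / a j) : ℝ) : 𝕜) • y := by
    have : (t : 𝕜) • stdVec 𝕜 N 0 = W.toEuclideanLin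
        (x + ((t * ((-1) ^ k * ∏ j ∈ Finset.range k, b j / a j) : ℝ) : 𝕜) • y) := by
      rw [map_add, map_smul, hy, ← h, add_sub_cancel]
    rw [this, hinv, add_sub_cancel_left]
  have h2 : 0 ≤ ∏ j ∈ Finset.range k, b j / a j := Finset.prod_nonneg fun j hj ↦ by
    have hj := Finset.mem_range.1 hj
    exact (div_pos (hb j (by omega)) (ha j (by omega))).le
  have hM : (M : ℝ) ≠ 0 := by exact_mod_cast (by omega : M ≠ 0)
  rw [← energyNorm_cgError hW (isRegular_bidiag hNM ha hb ht.ne') hk.le, cgError,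
    (bidiag_isCGIterate hNM ha hb ht.ne' hk hx h).eq_cgIterate hW, h1, energyNorm,
    inner_sampleCov, map_smul, norm_smul, mul_pow, hny, RCLike.ofReal_re, RCLike.norm_ofReal,
    sq_abs]
  rw [show t * ∏ j ∈ Finset.range k, b j / a j
    = √((t * ((-1) ^ k * ∏ j ∈ Finset.range k, b j / a j)) ^ 2) by
      rw [Real.sqrt_sq_eq_abs, abs_mul, abs_mul, abs_pow, abs_neg, abs_one, one_pow, one_mul,
        abs_of_pos ht, abs_of_nonneg h2], ← Real.sqrt_mul (mul_nonneg (Nat.cast_nonneg _)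
        (Finset.sum_nonneg fun i _ ↦ div_nonneg (Finset.prod_nonneg fun j _ ↦ by positivity)
          (sq_nonneg _)))]
  congr 1
  field_simp

open scoped ComplexOrder in
/-- The MINRES residual is the mean of the conjugate gradient residuals `r_0, …, r_k` with weights
proportional to `‖r_j‖⁻²`. -/
theorem minresResidualFormula_bidiag {t : ℝ} (ht : 0 < t) {k : ℕ} (hk : k < N) :
    minresResidualFormula (sampleCov (bidiag 𝕜 N M a b)) ((t : 𝕜) • stdVec 𝕜 N 0).ofLp k
      = (∑ j ∈ Finset.range (k + 1), ∏ l ∈ Finset.range j, a l ^ 2 / b l ^ 2) ^ (-(1 / 2) : ℝ)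
        * t := by
  set W := sampleCov (bidiag 𝕜 N M a b) with hWdef
  have hW : W.PosDef := posDef_sampleCov (det_sampleCov_bidiag_ne_zero (𝕜 := 𝕜) (b := b) hNM ha)
  set ρ : ℕ → ℝ := fun j ↦ ∏ l ∈ Finset.range j, b l / a l with hρ
  have hρpos : ∀ j < N, 0 < ρ j := fun j hj ↦ Finset.prod_pos fun l hl ↦ by
    have hl := Finset.mem_range.1 hl
    exact div_pos (hb l (by omega)) (ha l (by omega))
  set σ := ∑ j ∈ Finset.range (k + 1), ∏ l ∈ Finset.range j, a l ^ 2 / b l ^ 2 with hσ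
  have hσ' : σ = ∑ j ∈ Finset.range (k + 1), (ρ j)⁻¹ ^ 2 := by
    refine Finset.sum_congr rfl fun j _ ↦ ?_
    rw [hρ, ← Finset.prod_inv_distrib, ← Finset.prod_pow]
    refine Finset.prod_congr rfl fun l _ ↦ ?_
    rw [inv_div, div_pow]
  have hσpos : 0 < σ := by
    rw [hσ']
    refine Finset.sum_pos (fun j hj ↦ ?_) ⟨0, by simp⟩
    have := hρpos j (by have := Finset.mem_range.1 hj; omega)
    positivity
  have hex : ∀ j : ℕ, ∃ x, j < N → x ∈ dualSpan 𝕜 N a b j ∧ (t : 𝕜) • stdVec 𝕜 N 0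
      - W.toEuclideanLin x = ((t * ((-1) ^ j * ρ j) : ℝ) : 𝕜) • stdVec 𝕜 N j := by
    intro j
    by_cases hj : j < N
    · obtain ⟨x, hx, h⟩ := exists_residual_eq (𝕜 := 𝕜) (b := b) hNM ha t hj
      exact ⟨x, fun _ ↦ ⟨hx, h⟩⟩
    · exact ⟨0, fun h ↦ (hj h).elim⟩
  choose x hx using hex
  -- As the residual is affine in the iterate, the mean `z` of the conjugate gradient iterates has
  -- the mean of their residuals.
  set z := ∑ j ∈ Finset.range (k + 1), (((ρ j)⁻¹ ^ 2 / σ : ℝ) : 𝕜) • x j with hz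
  have hzmem : z ∈ dualSpan 𝕜 N a b k := Submodule.sum_mem _ fun j hj ↦ by
    have hj := Finset.mem_range.1 hj
    exact Submodule.smul_mem _ _ (dualSpan_mono (by omega) (hx j (by omega)).1)
  have hzres : (t : 𝕜) • stdVec 𝕜 N 0 - W.toEuclideanLin z
      = ∑ j ∈ Finset.range (k + 1), ((t / σ * ((-1) ^ j * (ρ j)⁻¹) : ℝ) : 𝕜) • stdVec 𝕜 N j := by
    have h1 : (t : 𝕜) • stdVec 𝕜 N 0 = ∑ j ∈ Finset.range (k + 1),
        (((ρ j)⁻¹ ^ 2 / σ : ℝ) : 𝕜) • (t : 𝕜) • stdVec 𝕜 N 0 := by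
      rw [← Finset.sum_smul, ← RCLike.ofReal_sum, ← Finset.sum_div, ← hσ', div_self hσpos.ne',
        RCLike.ofReal_one, one_smul]
    rw [h1, hz, map_sum, ← Finset.sum_sub_distrib]
    refine Finset.sum_congr rfl fun j hj ↦ ?_
    have hj := Finset.mem_range.1 hj
    rw [map_smul, ← smul_sub, (hx j (by omega)).2, smul_smul, ← RCLike.ofReal_mul]
    congr 2
    have := (hρpos j (by omega)).ne'
    field_simp
  have hit : IsMINRESIterate W ((t : 𝕜) • stdVec 𝕜 N 0) k z := by
    rw [← krylov_eq_dualSpan hNM ha hb ht.ne' hk.le] at hzmem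
    refine isMINRESIterate_of_inner_eq_zero hzmem fun w hw ↦ ?_
    rw [krylov_eq_dualSpan hNM ha hb ht.ne' hk.le] at hw
    rw [hzres]
    induction hw using Submodule.span_induction with
    | mem w hw =>
      obtain ⟨i, hi, rfl⟩ := hw
      have hi : i < k := hi
      have hin : ∀ l < k + 1, inner 𝕜 (stdVec 𝕜 N l) (∑ j ∈ Finset.range (k + 1),
          ((t / σ * ((-1) ^ j * (ρ j)⁻¹) : ℝ) : 𝕜) • stdVec 𝕜 N j)
          = ((t / σ * ((-1) ^ l * (ρ l)⁻¹) : ℝ) : 𝕜) := by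
        intro l hl
        rw [inner_sum, Finset.sum_eq_single l]
        · rw [inner_smul_right, inner_stdVec (by omega), if_pos rfl, mul_one]
        · intro j _ hj
          rw [inner_smul_right, inner_stdVec (by omega), if_neg hj.symm, mul_zero]
        · exact fun h ↦ (h (Finset.mem_range.2 hl)).elim
      rw [sampleCov_dualVec hNM ha (by omega), inner_smul_left, inner_add_left, inner_smul_left,
        inner_smul_left, hin i (by omega), hin (i + 1) (by omega), RCLike.conj_ofReal,
        RCLike.conj_ofReal, ← RCLike.ofReal_mul, ← RCLike.ofReal_mul, ← RCLike.ofReal_add]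
      have h0 : a i * (t / σ * ((-1) ^ i * (ρ i)⁻¹))
          + b i * (t / σ * ((-1) ^ (i + 1) * (ρ (i + 1))⁻¹)) = 0 := by
        have h1 : ρ (i + 1) = ρ i * (b i / a i) := Finset.prod_range_succ _ _
        have h2 := (hρpos i (by omega)).ne'
        have h3 := (ha i (by omega)).ne'
        have h4 := (hb i (by omega)).ne'
        rw [h1, pow_succ]
        field_simp
        ring
      rw [h0]
      simp
    | zero => simp
    | add u w _ _ hu hw => rw [map_add, inner_add_left, hu, hw, add_zero]
    | smul d w _ hw => rw [map_smul, inner_smul_left, hw, mul_zero]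
  rw [← norm_minresResidual hW (isRegular_bidiag hNM ha hb ht.ne') hk.le, minresResidual,
    hit.eq_minresIterate hW, hzres]
  have hsq := norm_sq_sum_smul_stdVec (𝕜 := 𝕜) (n := N) (Finset.range (k + 1))
    (fun i hi ↦ by have := Finset.mem_range.1 hi; omega)
    (fun j ↦ ((t / σ * ((-1) ^ j * (ρ j)⁻¹) : ℝ) : 𝕜))
  have h5 : ∑ j ∈ Finset.range (k + 1), ‖((t / σ * ((-1) ^ j * (ρ j)⁻¹) : ℝ) : 𝕜)‖ ^ 2
      = t ^ 2 / σ := by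
    have : ∀ j, ‖((t / σ * ((-1) ^ j * (ρ j)⁻¹) : ℝ) : 𝕜)‖ ^ 2 = (t / σ) ^ 2 * (ρ j)⁻¹ ^ 2 := by
      intro j
      rw [RCLike.norm_ofReal, sq_abs, mul_pow, mul_pow, ← pow_mul, mul_comm j, pow_mul,
        neg_one_sq, one_pow, one_mul]
    simp_rw [this]
    rw [← Finset.mul_sum, ← hσ']
    field_simp
  rw [h5] at hsq
  rw [← Real.sqrt_sq (norm_nonneg _), hsq, Real.sqrt_div (sq_nonneg t), Real.sqrt_sq ht.le,
    Real.rpow_neg hσpos.le, ← Real.sqrt_eq_rpow, div_eq_inv_mul]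

end

end Bidiagonal

/-! ### Transfer to chi distributed variables -/

section ChiModel

variable {N M : ℕ}

lemma ae_chiLaw_pos {d : ℕ} (hd : d ≠ 0) : ∀ᵐ x ∂chiLaw d, 0 < x := by
  have h1 : ∀ᵐ x ∂chiLaw d, 0 ≤ x := by
    rw [chiLaw, ae_map_iff (Measurable.aemeasurable (by fun_prop)) measurableSet_Ici]
    exact Filter.Eventually.of_forall fun g ↦ Real.sqrt_nonneg _
  have h2 : ∀ᵐ x ∂chiLaw d, x ≠ 0 := by
    rw [ae_iff]
    simpa using chiLaw_singleton hd 0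
  filter_upwards [h1, h2] with x hx hx'
  exact lt_of_le_of_ne hx hx'.symm

lemma measurePreserving_chiPairs_fst (B M : ℕ) (j : Fin N) :
    MeasurePreserving (fun p : Fin N → ℝ × ℝ ↦ (p j).1) (chiPairs B N M)
      (chiLaw (B * (M - j))) :=
  measurePreserving_fst.comp (measurePreserving_eval
    (fun j : Fin N ↦ (chiLaw (B * (M - j))).prod (chiLaw (B * (N - j - 1)))) j)

lemma measurePreserving_chiPairs_snd (B M : ℕ) (j : Fin N) :
    MeasurePreserving (fun p : Fin N → ℝ × ℝ ↦ (p j).2) (chiPairs B N M)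
      (chiLaw (B * (N - j - 1))) :=
  measurePreserving_snd.comp (measurePreserving_eval
    (fun j : Fin N ↦ (chiLaw (B * (M - j))).prod (chiLaw (B * (N - j - 1)))) j)

/-- The pairs for which the bidiagonal model is non-degenerate. The last of the `β_j`, which
vanishes, does not enter the model. -/
def IsPositive (p : Fin N → ℝ × ℝ) : Prop :=
  (∀ j, 0 < (p j).1) ∧ ∀ j : Fin N, j.val + 1 < N → 0 < (p j).2

lemma ae_chiPairs_isPositive {B : ℕ} (hB : 0 < B) (hNM : N ≤ M) :
    ∀ᵐ p ∂chiPairs B N M, IsPositive p := by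
  have h1 : ∀ j : Fin N, ∀ᵐ p ∂chiPairs B N M, 0 < (p j).1 := fun j ↦ by
    refine (measurePreserving_chiPairs_fst B M j).quasiMeasurePreserving.ae (ae_chiLaw_pos ?_)
    exact (Nat.mul_pos hB (by omega)).ne'
  have h2 : ∀ j : Fin N, ∀ᵐ p ∂chiPairs B N M, j.val + 1 < N → 0 < (p j).2 := fun j ↦ by
    by_cases hj : j.val + 1 < N
    · simp only [hj, true_imp_iff]
      refine (measurePreserving_chiPairs_snd B M j).quasiMeasurePreserving.ae (ae_chiLaw_pos ?_)
      exact (Nat.mul_pos hB (by omega)).ne'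
    · simp [hj]
  exact (ae_all_iff.2 h1).and (ae_all_iff.2 h2)

/-- The random variables `‖r_k‖ / ‖b‖` of the conjugate gradient algorithm, in terms of the pairs
`(α_j, β_j)`. -/
def residualRatio (p : Fin N → ℝ × ℝ) (k : Fin N) : ℝ :=
  ∏ j ∈ Finset.Iio k, (p j).2 / (p j).1

/-- The random variables `1 / Σ_k` in terms of the pairs `(α_j, β_j)`. Their squares are, up to
the factor `B * M`, the squared norms of the columns of the inverse of the lower bidiagonal matrix
with the diagonal `α` and the subdiagonal `β`. -/
def invSigma (B M : ℕ) (p : Fin N → ℝ × ℝ) (k : Fin N) : ℝ :=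
  √(B * M * ∑ i ∈ Finset.Ici k, (∏ j ∈ Finset.Ico k i, (p j).2 ^ 2 / (p j).1 ^ 2) / (p i).1 ^ 2)

/-- The random variables `‖r_k‖ / ‖b‖` of MINRES, in terms of the pairs `(α_j, β_j)`. -/
def minresRatio (p : Fin N → ℝ × ℝ) (k : Fin N) : ℝ :=
  (∑ j ∈ Finset.Iic k, ∏ l ∈ Finset.Iio j, (p l).1 ^ 2 / (p l).2 ^ 2) ^ (-(1 / 2) : ℝ)

lemma measurable_residualRatio (k : Fin N) :
    Measurable fun p : Fin N → ℝ × ℝ ↦ residualRatio p k := by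
  unfold residualRatio
  fun_prop

lemma measurable_invSigma (B M : ℕ) (k : Fin N) :
    Measurable fun p : Fin N → ℝ × ℝ ↦ invSigma B M p k := by
  unfold invSigma
  fun_prop

lemma measurable_minresRatio (k : Fin N) :
    Measurable fun p : Fin N → ℝ × ℝ ↦ minresRatio p k := by
  unfold minresRatio
  fun_prop

section FinIntervals

variable {R : Type*} [CommMonoid R] {f : ℕ → R}

@[to_additive]
lemma prod_Iio_fin (k : Fin N) : ∏ j ∈ Finset.Iio k, f j = ∏ j ∈ Finset.range k, f j := by
  rw [← Nat.Iio_eq_range, ← Fin.map_valEmbedding_Iio, Finset.prod_map]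
  rfl

@[to_additive]
lemma prod_Iic_fin (k : Fin N) : ∏ j ∈ Finset.Iic k, f j = ∏ j ∈ Finset.range (k + 1), f j := by
  rw [Nat.range_succ_eq_Iic, ← Fin.map_valEmbedding_Iic, Finset.prod_map]
  rfl

@[to_additive]
lemma prod_Ici_fin (k : Fin N) : ∏ j ∈ Finset.Ici k, f j = ∏ j ∈ Finset.Ico k.val N, f j := by
  rw [← Fin.map_valEmbedding_Ici, Finset.prod_map]
  rfl

@[to_additive]
lemma prod_Ico_fin (k l : Fin N) :
    ∏ j ∈ Finset.Ico k l, f j = ∏ j ∈ Finset.Ico k.val l.val, f j := by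
  rw [← Fin.map_valEmbedding_Ico, Finset.prod_map]
  rfl

end FinIntervals

section Values

lemma firstCoord_eq (t : ℝ) : firstCoord 𝕜 N t = ((t : 𝕜) • stdVec 𝕜 N 0).ofLp := by
  ext i
  by_cases h : i.val = 0 <;> simp [firstCoord, stdVec, h, RCLike.real_smul_eq_coe_mul]

variable {p : Fin N → ℝ × ℝ}

lemma sqrt_dyson_pos : 0 < √(dyson 𝕜 : ℝ) :=
  Real.sqrt_pos.2 (by exact_mod_cast dyson_pos 𝕜)

lemma IsPositive.diag_pos (hp : IsPositive p) :
    ∀ j < N, 0 < extendZero (fun j ↦ (p j).1) j / √(dyson 𝕜) := fun j hj ↦ by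
  have : extendZero (fun j ↦ (p j).1) j = (p ⟨j, hj⟩).1 := by simp [extendZero, hj]
  rw [this]
  exact div_pos (hp.1 _) sqrt_dyson_pos

lemma IsPositive.subdiag_pos (hp : IsPositive p) :
    ∀ j, j + 1 < N → 0 < extendZero (fun j ↦ (p j).2) j / √(dyson 𝕜) := fun j hj ↦ by
  have : extendZero (fun j ↦ (p j).2) j = (p ⟨j, by omega⟩).2 := by
    simp [extendZero, show j < N by omega]
  rw [this]
  exact div_pos (hp.2 ⟨j, by omega⟩ hj) sqrt_dyson_pos

variable (hNM : N ≤ M) (hp : IsPositive p) {t : ℝ} (ht : 0 < t) (k : Fin N)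

include hNM hp ht

lemma isRegular_chiBidiag :
    IsRegular (sampleCov (chiBidiag 𝕜 M p)) (firstCoord 𝕜 N t) := by
  rw [firstCoord_eq]
  exact isRegular_bidiag hNM hp.diag_pos hp.subdiag_pos ht.ne'

lemma cgResidualFormula_chiBidiag :
    cgResidualFormula (sampleCov (chiBidiag 𝕜 M p)) (firstCoord 𝕜 N t) k
      = t * residualRatio p k := by
  have hs := (sqrt_dyson_pos (𝕜 := 𝕜)).ne'
  rw [firstCoord_eq, chiBidiag,
    cgResidualFormula_bidiag hNM hp.diag_pos hp.subdiag_pos ht k.isLt, ← prod_Iio_fin,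
    residualRatio]
  simp_rw [extendZero_val, div_div_div_cancel_right₀ hs]

lemma cgErrorFormula_chiBidiag :
    cgErrorFormula (sampleCov (chiBidiag 𝕜 M p)) (firstCoord 𝕜 N t) k
      = invSigma (dyson 𝕜) M p k * (t * residualRatio p k) := by
  have hs := (sqrt_dyson_pos (𝕜 := 𝕜)).ne'
  have hd : (0 : ℝ) ≤ dyson 𝕜 := Nat.cast_nonneg _
  rw [firstCoord_eq, chiBidiag, cgErrorFormula_bidiag hNM hp.diag_pos hp.subdiag_pos ht k.isLt,
    ← prod_Iio_fin, residualRatio, ← sum_Ici_fin, invSigma]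
  simp_rw [← prod_Ico_fin, extendZero_val, ← div_pow, div_div_div_cancel_right₀ hs]
  simp_rw [div_pow _ (√(dyson 𝕜 : ℝ)), Real.sq_sqrt hd]
  rw [mul_comm (dyson 𝕜 : ℝ), mul_assoc (M : ℝ), Finset.mul_sum (a := (dyson 𝕜 : ℝ))]
  congr 3
  refine Finset.sum_congr rfl fun i _ ↦ ?_
  rw [div_div_eq_mul_div, mul_comm, mul_div_assoc]

lemma minresResidualFormula_chiBidiag :
    minresResidualFormula (sampleCov (chiBidiag 𝕜 M p)) (firstCoord 𝕜 N t) k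
      = minresRatio p k * t := by
  have hs := (sqrt_dyson_pos (𝕜 := 𝕜)).ne'
  rw [firstCoord_eq, chiBidiag,
    minresResidualFormula_bidiag hNM hp.diag_pos hp.subdiag_pos ht k.isLt, minresRatio,
    ← sum_Iic_fin]
  simp_rw [← prod_Iio_fin, extendZero_val, ← div_pow, div_div_div_cancel_right₀ hs]

end Values

end ChiModel

section Transfer

variable {N M : ℕ}

/-- A unitarily equivariant function of a Wishart matrix and a fixed non-zero vector has the law of
its value at the bidiagonal model. -/
theorem map_sampleCov_eq_map_chiPairs {E : Type*} [MeasurableSpace E] (hNM : N ≤ M)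
    {G : Matrix (Fin N) (Fin N) 𝕜 → (Fin N → 𝕜) → E} (hG : ∀ b, Measurable fun W ↦ G W b)
    (hGU : ∀ U ∈ Matrix.unitaryGroup (Fin N) 𝕜, ∀ W b,
      G (U * W * U.conjTranspose) (U.mulVec b) = G W b) (b : EuclideanSpace 𝕜 (Fin N))
    {g : (Fin N → ℝ × ℝ) → E} (hg : Measurable g)
    (h : ∀ p, IsPositive p → G (sampleCov (chiBidiag 𝕜 M p)) (firstCoord 𝕜 N ‖b‖) = g p) :
    (wishartLaw 𝕜 N M).map (fun W ↦ G W b.ofLp) = (chiPairs (dyson 𝕜) N M).map g := by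
  ext s hs
  rw [wishartLaw, Measure.map_map (hG _) measurable_sampleCov,
    ← lintegral_indicator_one hs, lintegral_map (measurable_one.indicator hs)
      ((hG _).comp measurable_sampleCov)]
  refine (lintegral_sampleCov_eq_bidiag (G := fun W b ↦ s.indicator 1 (G W b)) hNM
    (fun b ↦ (measurable_one.indicator hs).comp (hG b))
    (fun U hU W b ↦ by rw [hGU U hU]) b).trans ?_
  rw [← lintegral_indicator_one hs, lintegral_map (measurable_one.indicator hs) hg]
  refine lintegral_congr_ae ?_
  filter_upwards [ae_chiPairs_isPositive (dyson_pos 𝕜) hNM] with p hp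
  rw [h p hp]

lemma ae_wishartLaw_isRegular (hNM : N ≤ M) {b : EuclideanSpace 𝕜 (Fin N)} (hb : b ≠ 0) :
    ∀ᵐ W ∂wishartLaw 𝕜 N M, IsRegular W b.ofLp := by
  have hm : ∀ b : Fin N → 𝕜, MeasurableSet {W | IsRegular W b} := fun b ↦
    measurableSet_isRegular measurable_id measurable_const
  have h := map_sampleCov_eq_map_chiPairs (E := Prop) (M := M) hNM (G := IsRegular)
    (fun b ↦ measurableSet_setOfPred.1 (hm b))
    (fun U hU W b ↦ propext (isRegular_unitary_conj hU)) b
    (g := fun _ ↦ True) measurable_const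
    (fun p hp ↦ eq_true (isRegular_chiBidiag hNM hp (norm_pos_iff.2 hb)))
  have h2 : (wishartLaw 𝕜 N M) {W | IsRegular W b.ofLp}ᶜ = 0 := by
    have h3 := congrArg (fun μ ↦ μ {q : Prop | ¬ q}) h
    simp only at h3
    rw [Measure.map_apply (measurableSet_setOfPred.1 (hm _)) (MeasurableSet.of_discrete),
      Measure.map_apply measurable_const (MeasurableSet.of_discrete)] at h3
    simpa [Set.compl_def] using h3
  exact h2

instance {m n : Type*} [Finite m] [Finite n] : BorelSpace (Matrix m n 𝕜) :=
  inferInstanceAs (BorelSpace (m → n → 𝕜))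

instance : IsProbabilityMeasure (wishartLaw 𝕜 N M) :=
  Measure.isProbabilityMeasure_map measurable_sampleCov.aemeasurable

open scoped ComplexOrder

lemma measurableSet_posSemidef :
    MeasurableSet {W : Matrix (Fin N) (Fin N) 𝕜 | W.PosSemidef} := by
  have : {W : Matrix (Fin N) (Fin N) 𝕜 | W.PosSemidef}
      = {W | W.conjTranspose = W} ∩ ⋂ x : Fin N → 𝕜, {W | 0 ≤ star x ⬝ᵥ W.mulVec x} := by
    ext W
    simp [Matrix.posSemidef_iff_dotProduct_mulVec, Matrix.IsHermitian]
  rw [this]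
  refine (IsClosed.inter ?_ (isClosed_iInter fun x ↦ ?_)).measurableSet
  · exact isClosed_eq (by fun_prop) (by fun_prop)
  · exact isClosed_le (by fun_prop) (by fun_prop)

lemma ae_wishartLaw_posDef (hNM : N ≤ M) {b : EuclideanSpace 𝕜 (Fin N)} (hb : b ≠ 0) :
    ∀ᵐ W ∂wishartLaw 𝕜 N M, W.PosDef := by
  have h1 : ∀ᵐ W ∂wishartLaw 𝕜 N M, W.PosSemidef := by
    rw [wishartLaw, ae_map_iff measurable_sampleCov.aemeasurable measurableSet_posSemidef]
    exact Filter.Eventually.of_forall posSemidef_sampleCov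
  filter_upwards [h1, ae_wishartLaw_isRegular hNM hb] with W hW hr
  exact hW.posDef_iff_isUnit.2 ((Matrix.isUnit_iff_isUnit_det _).2 hr.det_ne_zero.isUnit)

/-- The pairs `(α_j, β_j)` of a family of independent chi variables have the law `chiPairs`. -/
lemma IsChiFamily.hasLaw_pairs {B : ℕ} {Ω : Type*} [MeasurableSpace Ω] {P : Measure Ω}
    {α β : Fin N → Ω → ℝ} (h : IsChiFamily B N M P α β) :
    HasLaw (fun ω j ↦ (α j ω, β j ω)) (chiPairs B N M) P := by
  have h1 := h.indep.hasLaw_pi (μ := Sum.elim (fun j : Fin N ↦ chiLaw (B * (M - j)))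
    (fun j : Fin N ↦ chiLaw (B * (N - j - 1)))) (fun i ↦ by
      rcases i with j | j
      · exact h.law_α j
      · exact h.law_β j)
  have : ∀ i, SigmaFinite (Sum.elim (fun j : Fin N ↦ chiLaw (B * (M - j)))
    (fun j : Fin N ↦ chiLaw (B * (N - j - 1))) i) := by
    rintro (j | j) <;> simp only [Sum.elim_inl, Sum.elim_inr] <;> infer_instance
  have h2 := measurePreserving_sumPiEquivProdPi (X := fun _ : Fin N ⊕ Fin N ↦ ℝ)
    (Sum.elim (fun j : Fin N ↦ chiLaw (B * (M - j))) (fun j : Fin N ↦ chiLaw (B * (N - j - 1))))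
  have h3 := (measurePreserving_arrowProdEquivProdArrow ℝ ℝ (Fin N)
    (fun j ↦ chiLaw (B * (M - j))) (fun j ↦ chiLaw (B * (N - j - 1)))).symm
  exact (h3.comp h2).comp_hasLaw h1

lemma isChiFamily_of_hasLaw {B : ℕ} {Ω : Type*} [MeasurableSpace Ω] {P : Measure Ω}
    [IsProbabilityMeasure P] {p : Ω → Fin N → ℝ × ℝ} (h : HasLaw p (chiPairs B N M) P) :
    IsChiFamily B N M P (fun j ω ↦ (p ω j).1) (fun j ω ↦ (p ω j).2) := by
  have hα : ∀ j, HasLaw (fun ω ↦ (p ω j).1) (chiLaw (B * (M - j))) P := fun j ↦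
    (measurePreserving_chiPairs_fst B M j).comp_hasLaw h
  have hβ : ∀ j, HasLaw (fun ω ↦ (p ω j).2) (chiLaw (B * (N - j - 1))) P := fun j ↦
    (measurePreserving_chiPairs_snd B M j).comp_hasLaw h
  refine ⟨?_, hα, hβ⟩
  have : ∀ i, SigmaFinite (Sum.elim (fun j : Fin N ↦ chiLaw (B * (M - j)))
    (fun j : Fin N ↦ chiLaw (B * (N - j - 1))) i) := by
    rintro (j | j) <;> simp only [Sum.elim_inl, Sum.elim_inr] <;> infer_instance
  refine (iIndepFun_iff_hasLaw_pi_pi (μ := Sum.elim (fun j : Fin N ↦ chiLaw (B * (M - j)))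
    (fun j : Fin N ↦ chiLaw (B * (N - j - 1)))) (fun i ↦ by
      rcases i with j | j
      · exact hα j
      · exact hβ j)).2 ?_
  have h2 := measurePreserving_sumPiEquivProdPi_symm (X := fun _ : Fin N ⊕ Fin N ↦ ℝ)
    (Sum.elim (fun j : Fin N ↦ chiLaw (B * (M - j))) (fun j : Fin N ↦ chiLaw (B * (N - j - 1))))
  have h3 := (measurePreserving_arrowProdEquivProdArrow ℝ ℝ (Fin N)
    (fun j ↦ chiLaw (B * (M - j))) (fun j ↦ chiLaw (B * (N - j - 1))))
  refine ((h2.comp h3).comp_hasLaw h).congr (Filter.Eventually.of_forall fun ω ↦ ?_)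
  ext i
  rcases i with j | j <;> rfl

variable {Ω Ω' E : Type*} [MeasurableSpace Ω] [MeasurableSpace Ω'] [MeasurableSpace E]
  {P : Measure Ω} {P' : Measure Ω'}

/-- Transfer from a Wishart matrix to the bidiagonal model, for a function that agrees with a
measurable and unitarily equivariant one on the regular positive definite matrices. -/
theorem identDistrib_wishart (hNM : N ≤ M) {W : Ω → Matrix (Fin N) (Fin N) 𝕜}
    (hW : HasLaw W (wishartLaw 𝕜 N M) P) {b : EuclideanSpace 𝕜 (Fin N)} (hb : b ≠ 0)
    {p : Ω' → Fin N → ℝ × ℝ} (hp : HasLaw p (chiPairs (dyson 𝕜) N M) P')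
    {G : Matrix (Fin N) (Fin N) 𝕜 → (Fin N → 𝕜) → E} (hG : ∀ b, Measurable fun W ↦ G W b)
    (hGU : ∀ U ∈ Matrix.unitaryGroup (Fin N) 𝕜, ∀ W b,
      G (U * W * U.conjTranspose) (U.mulVec b) = G W b)
    {f : Matrix (Fin N) (Fin N) 𝕜 → E}
    (hf : ∀ W, W.PosDef → IsRegular W b.ofLp → f W = G W b.ofLp)
    {g : (Fin N → ℝ × ℝ) → E} (hg : Measurable g)
    (h : ∀ p, IsPositive p → G (sampleCov (chiBidiag 𝕜 M p)) (firstCoord 𝕜 N ‖b‖) = g p) :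
    IdentDistrib (fun ω ↦ f (W ω)) (fun ω ↦ g (p ω)) P P' := by
  have hae : (fun ω ↦ G (W ω) b.ofLp) =ᵐ[P] fun ω ↦ f (W ω) := by
    have h1 := (ae_wishartLaw_posDef (M := M) hNM hb).and (ae_wishartLaw_isRegular hNM hb)
    rw [← hW.map_eq] at h1
    filter_upwards [ae_of_ae_map hW.aemeasurable h1] with ω hω
    exact (hf _ hω.1 hω.2).symm
  have hG1 : HasLaw (fun ω ↦ G (W ω) b.ofLp) ((chiPairs (dyson 𝕜) N M).map g) P :=
    ⟨(hG _).comp_aemeasurable hW.aemeasurable, by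
      rw [← map_sampleCov_eq_map_chiPairs hNM hG hGU b hg h, ← hW.map_eq,
        AEMeasurable.map_map_of_aemeasurable (hG _).aemeasurable hW.aemeasurable]
      rfl⟩
  have hg1 : HasLaw (fun ω ↦ g (p ω)) ((chiPairs (dyson 𝕜) N M).map g) P' :=
    ⟨hg.comp_aemeasurable hp.aemeasurable, by
      rw [← hp.map_eq, AEMeasurable.map_map_of_aemeasurable hg.aemeasurable hp.aemeasurable]
      rfl⟩
  have hf1 := hG1.congr hae.symm
  exact ⟨hf1.aemeasurable, hg1.aemeasurable, by rw [hf1.map_eq, hg1.map_eq]⟩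

end Transfer

/-! ### The law of the quotient of errors and residuals -/

section InverseEntry

variable {n m : ℕ}

lemma bordered_mul_bordered (c : ℝ) (z : Fin n → 𝕜) (a : ℝ) (y : Fin n → 𝕜)
    (X : Matrix (Fin n) (Fin m) 𝕜) :
    bordered c z (1 : Matrix (Fin n) (Fin n) 𝕜) * bordered a y X
      = bordered (c * a) ((a : 𝕜) • z + y) X := by
  ext i j
  refine Fin.cases ?_ (fun i ↦ ?_) i <;> refine Fin.cases ?_ (fun j ↦ ?_) j
  all_goals simp [bordered, consRow, consCol, firstCoord, Matrix.mul_apply, Fin.sum_univ_succ,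
    Matrix.one_apply, RCLike.real_smul_eq_coe_mul, mul_comm]

lemma bordered_zero_mul_conjTranspose (a : ℝ) (X : Matrix (Fin n) (Fin m) 𝕜) :
    bordered a 0 X * (bordered a 0 X).conjTranspose = bordered (a ^ 2) 0 (X * X.conjTranspose) := by
  ext i j
  refine Fin.cases ?_ (fun i ↦ ?_) i <;> refine Fin.cases ?_ (fun j ↦ ?_) j
  all_goals simp [bordered, consRow, consCol, firstCoord, Matrix.mul_apply, Fin.sum_univ_succ,
    sq]

lemma bordered_zero_mul_bordered_zero (a c : ℝ) (A D : Matrix (Fin n) (Fin n) 𝕜) :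
    bordered a 0 A * bordered c 0 D = bordered (a * c) 0 (A * D) := by
  ext i j
  refine Fin.cases ?_ (fun i ↦ ?_) i <;> refine Fin.cases ?_ (fun j ↦ ?_) j
  all_goals simp [bordered, consRow, consCol, firstCoord, Matrix.mul_apply, Fin.sum_univ_succ]

lemma det_bordered_zero (c : ℝ) (A : Matrix (Fin n) (Fin n) 𝕜) :
    (bordered c 0 A).det = c * A.det := by
  rw [Matrix.det_succ_row_zero, Fin.sum_univ_succ]
  have : (bordered c 0 A).submatrix Fin.succ (Fin.succAbove 0) = A := by
    ext i j
    simp [bordered, consRow, consCol]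
  rw [this]
  simp [bordered, consRow, firstCoord]

lemma inv_bordered_zero_succ {c : ℝ} (hc : c ≠ 0) (A : Matrix (Fin n) (Fin n) 𝕜)
    (i j : Fin n) :
    (bordered c 0 A)⁻¹ i.succ j.succ = A⁻¹ i j := by
  by_cases hA : IsUnit A.det
  · have h : bordered c 0 A * bordered c⁻¹ 0 A⁻¹ = 1 := by
      rw [bordered_zero_mul_bordered_zero, mul_inv_cancel₀ hc, Matrix.mul_nonsing_inv _ hA]
      exact oneBlock_one
    rw [Matrix.inv_eq_right_inv h]
    simp [bordered, consRow, consCol]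
  · have h : ¬ IsUnit (bordered c 0 A).det := by
      rw [det_bordered_zero]
      simpa [hc] using hA
    rw [Matrix.nonsing_inv_apply_not_isUnit _ hA, Matrix.nonsing_inv_apply_not_isUnit _ h]
    rfl

/-- The lower right block of the inverse Gram matrix does not feel the first row and column of a
bordered matrix, as these can be eliminated by row operations. -/
lemma inv_gram_bordered_succ {a : ℝ} (ha : a ≠ 0) (y : Fin n → 𝕜) (X : Matrix (Fin n) (Fin m) 𝕜)
    (i j : Fin n) :
    (bordered a y X * (bordered a y X).conjTranspose)⁻¹ i.succ j.succ
      = (X * X.conjTranspose)⁻¹ i j := by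
  have ha' : (a : 𝕜) ≠ 0 := by exact_mod_cast ha
  set R : Matrix (Fin (n + 1)) (Fin (n + 1)) 𝕜 := bordered 1 ((a : 𝕜)⁻¹ • y) 1 with hR
  set R' : Matrix (Fin (n + 1)) (Fin (n + 1)) 𝕜 := bordered 1 (-((a : 𝕜)⁻¹ • y)) 1 with hR'
  have h1 : bordered a y X = R * bordered a 0 X := by
    rw [hR, bordered_mul_bordered, one_mul, smul_inv_smul₀ ha', add_zero]
  have h2 : R * R' = 1 := by
    rw [hR, hR', bordered_mul_bordered, one_mul, RCLike.ofReal_one, one_smul, add_neg_cancel]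
    exact oneBlock_one
  have h3 : R.conjTranspose * R'.conjTranspose = 1 := by
    rw [← Matrix.conjTranspose_mul, mul_eq_one_comm.1 h2, Matrix.conjTranspose_one]
  have h4 : ∀ (Z : Matrix (Fin (n + 1)) (Fin (n + 1)) 𝕜) (l : Fin (n + 1)),
      (Z * R') l j.succ = Z l j.succ := by
    intro Z l
    rw [Matrix.mul_apply, Fin.sum_univ_succ]
    simp [hR', bordered, consRow, consCol, firstCoord, Matrix.one_apply]
  have h5 : ∀ (Z : Matrix (Fin (n + 1)) (Fin (n + 1)) 𝕜) (l : Fin (n + 1)),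
      (R'.conjTranspose * Z) i.succ l = Z i.succ l := by
    intro Z l
    rw [Matrix.mul_apply, Fin.sum_univ_succ]
    simp [hR', bordered, consRow, consCol, firstCoord, Matrix.one_apply, apply_ite]
  rw [h1, Matrix.conjTranspose_mul, Matrix.mul_assoc, ← Matrix.mul_assoc (bordered a 0 X),
    bordered_zero_mul_conjTranspose, Matrix.mul_inv_rev, Matrix.mul_inv_rev,
    Matrix.inv_eq_right_inv h2, Matrix.inv_eq_right_inv h3, h4, h5,
    inv_bordered_zero_succ (pow_ne_zero 2 ha)]

/-- The law of a diagonal entry of the inverse Gram matrix of a Gaussian matrix. The first rows can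
be peeled off one by one, each time with one column, until a row of length `m + 1 - n` is left. -/
theorem lintegral_inv_gram_last (hnm : n ≤ m) {φ : ℝ → ℝ≥0∞} (hφ : Measurable φ) :
    ∫⁻ X, φ (RCLike.re ((X * X.conjTranspose)⁻¹ (Fin.last n) (Fin.last n)))
        ∂gaussianMatrixLaw 𝕜 (n + 1) (m + 1)
      = ∫⁻ a, φ ((a / √(dyson 𝕜)) ^ 2)⁻¹ ∂chiLaw (dyson 𝕜 * (m + 1 - n)) := by
  have hmeas : ∀ n m : ℕ, Measurable fun X : Matrix (Fin (n + 1)) (Fin (m + 1)) 𝕜 ↦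
      φ (RCLike.re ((X * X.conjTranspose)⁻¹ (Fin.last n) (Fin.last n))) := fun n m ↦ by
    refine hφ.comp (RCLike.measurable_re.comp ?_)
    exact (Measurable.matrix_inv (by fun_prop)).matrix_entry _ _
  have hinv : ∀ n m : ℕ, ∀ V ∈ Matrix.unitaryGroup (Fin (m + 1)) 𝕜,
      ∀ X : Matrix (Fin (n + 1)) (Fin (m + 1)) 𝕜,
      φ (RCLike.re ((X * V * (X * V).conjTranspose)⁻¹ (Fin.last n) (Fin.last n)))
        = φ (RCLike.re ((X * X.conjTranspose)⁻¹ (Fin.last n) (Fin.last n))) := by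
    intro n m V hV X
    have hVV : V * V.conjTranspose = 1 := (Matrix.mem_unitaryGroup_iff).1 hV
    rw [Matrix.conjTranspose_mul, Matrix.mul_assoc X, ← Matrix.mul_assoc V, hVV, Matrix.one_mul]
  induction n generalizing m with
  | zero =>
    rw [lintegral_gaussianMatrixLaw_succ (hmeas 0 m) (hinv 0 m)]
    refine lintegral_congr fun a ↦ ?_
    have h : ∀ (y : Fin 0 → 𝕜) (X : Matrix (Fin 0) (Fin m) 𝕜),
        RCLike.re ((bordered (a / √(dyson 𝕜)) y X
          * (bordered (a / √(dyson 𝕜)) y X).conjTranspose)⁻¹ (Fin.last 0) (Fin.last 0))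
          = ((a / √(dyson 𝕜)) ^ 2)⁻¹ := by
      intro y X
      rw [Subsingleton.elim y 0, bordered_zero_mul_conjTranspose, Matrix.inv_def,
        det_bordered_zero, Matrix.det_fin_zero, mul_one, Matrix.smul_apply,
        @Matrix.adjugate_subsingleton _ _ _ _ _ (inferInstanceAs (Subsingleton (Fin 1))), Matrix.one_apply_eq, smul_eq_mul, mul_one,
        Ring.inverse_eq_inv', ← RCLike.ofReal_inv, RCLike.ofReal_re]
    simp_rw [h]
    simp
  | succ n ih =>
    obtain ⟨m, rfl⟩ : ∃ l, m = l + 1 := ⟨m - 1, by omega⟩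
    rw [lintegral_gaussianMatrixLaw_succ (hmeas (n + 1) (m + 1)) (hinv (n + 1) (m + 1))]
    have hpos : ∀ᵐ a ∂chiLaw (dyson 𝕜 * (m + 1 + 1)), 0 < a :=
      ae_chiLaw_pos (Nat.mul_pos (dyson_pos 𝕜) (by omega)).ne'
    have h : ∀ᵐ a ∂chiLaw (dyson 𝕜 * (m + 1 + 1)),
        ∫⁻ y : Fin (n + 1) → 𝕜, ∫⁻ X : Matrix (Fin (n + 1)) (Fin (m + 1)) 𝕜,
          φ (RCLike.re ((bordered (a / √(dyson 𝕜)) y X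
            * (bordered (a / √(dyson 𝕜)) y X).conjTranspose)⁻¹ (Fin.last (n + 1))
              (Fin.last (n + 1)))) ∂gaussianMatrixLaw 𝕜 (n + 1) (m + 1)
            ∂(Measure.pi fun _ ↦ stdNormal 𝕜)
          = ∫⁻ c, φ ((c / √(dyson 𝕜)) ^ 2)⁻¹ ∂chiLaw (dyson 𝕜 * (m + 1 - n)) := by
      filter_upwards [hpos] with a ha
      have ha' : a / √(dyson 𝕜) ≠ 0 := (div_pos ha sqrt_dyson_pos).ne'
      have hl : ∀ (y : Fin (n + 1) → 𝕜) (X : Matrix (Fin (n + 1)) (Fin (m + 1)) 𝕜),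
          RCLike.re ((bordered (a / √(dyson 𝕜)) y X
            * (bordered (a / √(dyson 𝕜)) y X).conjTranspose)⁻¹ (Fin.last (n + 1))
              (Fin.last (n + 1)))
            = RCLike.re ((X * X.conjTranspose)⁻¹ (Fin.last n) (Fin.last n)) := fun y X ↦
        congrArg _ (inv_gram_bordered_succ ha' y X (Fin.last n) (Fin.last n))
      simp_rw [hl]
      rw [lintegral_const, ih (by omega)]
      simp
    rw [lintegral_congr_ae h, lintegral_const]
    simp

end InverseEntry

section InvSigmaLaw

variable {N M : ℕ}

open scoped ComplexOrder in
lemma cgErrorFormula_zero_sampleCov {n m : ℕ} (X : Matrix (Fin (n + 1)) (Fin (m + 1)) 𝕜) :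
    cgErrorFormula (sampleCov X) (Pi.single (Fin.last n) 1) 0
      = √((m + 1 : ℕ) * RCLike.re ((X * X.conjTranspose)⁻¹ (Fin.last n) (Fin.last n))) := by
  have h0 : cgFormula (sampleCov X) (Pi.single (Fin.last n) 1) 0 = 0 := by
    rw [cgFormula, galerkin, Subsingleton.elim (Matrix.mulVec _⁻¹ _) 0, Matrix.mulVec_zero]
  have hc : ((m + 1 : ℕ) : 𝕜) ≠ 0 := by exact_mod_cast Nat.succ_ne_zero m
  set A := X * X.conjTranspose with hA
  have hW : (sampleCov X)⁻¹ = ((m + 1 : ℕ) : 𝕜) • A⁻¹ := by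
    rw [sampleCov, ← hA]
    by_cases h : IsUnit A.det
    · refine Matrix.inv_eq_right_inv ?_
      rw [Matrix.smul_mul, Matrix.mul_smul, Matrix.mul_nonsing_inv _ h, smul_smul,
        inv_mul_cancel₀ hc, one_smul]
    · have h' : ¬ IsUnit ((((m + 1 : ℕ) : 𝕜)⁻¹ • A).det) := by
        rw [Matrix.det_smul]
        exact fun hu ↦ h (isUnit_iff_ne_zero.2 (right_ne_zero_of_mul (isUnit_iff_ne_zero.1 hu)))
      rw [Matrix.nonsing_inv_apply_not_isUnit _ h, Matrix.nonsing_inv_apply_not_isUnit _ h',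
        smul_zero]
  have h2 : (sampleCov X).toEuclideanLin
      (WithLp.toLp 2 ((sampleCov X)⁻¹.mulVec (Pi.single (Fin.last n) 1)))
      = WithLp.toLp 2 ((sampleCov X).mulVec ((sampleCov X)⁻¹.mulVec (Pi.single (Fin.last n) 1))) :=
    rfl
  rw [cgErrorFormula, h0, sub_zero, energyNorm, h2, EuclideanSpace.inner_toLp_toLp]
  congr 1
  by_cases h : IsUnit (sampleCov X).det
  · rw [Matrix.mulVec_mulVec, Matrix.mul_nonsing_inv _ h, Matrix.one_mulVec, hW,
      single_one_dotProduct, Pi.star_apply, Matrix.mulVec_single_one, Matrix.col_apply,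
      Matrix.smul_apply, smul_eq_mul, star_mul', RCLike.star_def, map_natCast,
      ← RCLike.ofReal_natCast, RCLike.re_ofReal_mul, RCLike.conj_re]
  · have h3 : (sampleCov X)⁻¹ = 0 := Matrix.nonsing_inv_apply_not_isUnit _ h
    have h4 : A⁻¹ = 0 := (smul_eq_zero.1 (hW.symm.trans h3)).resolve_left hc
    rw [h3, h4, Matrix.zero_mulVec, Matrix.mulVec_zero, zero_dotProduct, Matrix.zero_apply]
    simp

/-- The law of `1 / Σ_0`, obtained by evaluating a diagonal entry of the inverse of a Wishart
matrix in two ways. -/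
lemma chiPairs_map_invSigma_zero {n m : ℕ} (hnm : n ≤ m) :
    (chiPairs (dyson 𝕜) (n + 1) (m + 1)).map (fun p ↦ invSigma (dyson 𝕜) (m + 1) p 0)
      = (chiLaw (dyson 𝕜 * (m + 1 - n))).map fun x ↦ √((dyson 𝕜 : ℝ) * (m + 1 : ℕ)) / x := by
  have h1 := map_sampleCov_eq_map_chiPairs (𝕜 := 𝕜) (N := n + 1) (M := m + 1) (by omega)
    (G := fun W b ↦ cgErrorFormula W b 0)
    (fun b ↦ measurable_cgErrorFormula measurable_id measurable_const 0)
    (fun U hU W b ↦ cgErrorFormula_unitary_conj hU) (EuclideanSpace.single (Fin.last n) 1)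
    (g := fun p ↦ invSigma (dyson 𝕜) (m + 1) p 0) (measurable_invSigma _ _ _) (fun p hp ↦ by
      have := cgErrorFormula_chiBidiag (𝕜 := 𝕜) (show n + 1 ≤ m + 1 by omega) hp one_pos 0
      have h0 : residualRatio p 0 = 1 := by
        rw [residualRatio, Finset.Iio_eq_empty.2 (fun j _ ↦ Fin.zero_le j)]
        simp
      rw [h0, mul_one, mul_one] at this
      rw [PiLp.norm_single, norm_one]
      exact this)
  have hm : Measurable fun W : Matrix (Fin (n + 1)) (Fin (n + 1)) 𝕜 ↦
      cgErrorFormula W (EuclideanSpace.single (Fin.last n) (1 : 𝕜)).ofLp 0 :=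
    measurable_cgErrorFormula measurable_id measurable_const 0
  rw [← h1, wishartLaw, Measure.map_map hm measurable_sampleCov]
  ext s hs
  have hm1 : Measurable fun x : ℝ ↦ √((dyson 𝕜 : ℝ) * (m + 1 : ℕ)) / x := by fun_prop
  rw [← lintegral_indicator_one hs, ← lintegral_indicator_one hs,
    lintegral_map (measurable_one.indicator hs)
      (hm.comp measurable_sampleCov),
    lintegral_map (measurable_one.indicator hs) hm1]
  simp only [Function.comp_def]
  have h2 : ∀ X : Matrix (Fin (n + 1)) (Fin (m + 1)) 𝕜, cgErrorFormula (sampleCov X)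
      (EuclideanSpace.single (Fin.last n) (1 : 𝕜)).ofLp 0
      = √((m + 1 : ℕ) * RCLike.re ((X * X.conjTranspose)⁻¹ (Fin.last n) (Fin.last n))) :=
    cgErrorFormula_zero_sampleCov
  simp_rw [h2]
  rw [lintegral_inv_gram_last (φ := fun x ↦ s.indicator 1 (√((m + 1 : ℕ) * x))) hnm
    ((measurable_one.indicator hs).comp (by fun_prop))]
  refine lintegral_congr_ae ?_
  filter_upwards [ae_chiLaw_pos (d := dyson 𝕜 * (m + 1 - n))
    (Nat.mul_pos (dyson_pos 𝕜) (by omega)).ne'] with a ha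
  have hd := sqrt_dyson_pos (𝕜 := 𝕜)
  have h3 : √((m + 1 : ℕ) * ((a / √(dyson 𝕜 : ℝ)) ^ 2)⁻¹)
      = √((dyson 𝕜 : ℝ) * (m + 1 : ℕ)) / a := by
    rw [div_pow, Real.sq_sqrt (Nat.cast_nonneg _), inv_div, ← mul_div_assoc,
      mul_comm (dyson 𝕜 : ℝ), Real.sqrt_div' _ (sq_nonneg a), Real.sqrt_sq ha.le]
  rw [h3]

/-- The pairs with the indices `k, k + 1, …`. -/
def tailPairs (p : Fin N → ℝ × ℝ) (k : Fin N) (j : Fin (N - k - 1 + 1)) : ℝ × ℝ :=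
  p ⟨k + j, by omega⟩

lemma invSigma_eq_tailPairs (B M : ℕ) (p : Fin N → ℝ × ℝ) (k : Fin N) :
    invSigma B M p k = invSigma B M (tailPairs p k) 0 := by
  obtain ⟨q, rfl⟩ : ∃ q : ℕ → ℝ × ℝ, p = fun j : Fin N ↦ q j :=
    ⟨fun j ↦ if h : j < N then p ⟨j, h⟩ else 0, by ext j <;> simp⟩
  have h1 : tailPairs (fun j : Fin N ↦ q j) k = fun j : Fin (N - k - 1 + 1) ↦ q (k + j) := rfl
  rw [h1, invSigma, invSigma]
  have h2 : ∀ i : Fin N, (∏ j ∈ Finset.Ico k i, (q j).2 ^ 2 / (q j).1 ^ 2) / (q i).1 ^ 2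
      = (fun l : ℕ ↦ (∏ j ∈ Finset.Ico k.val l, (q j).2 ^ 2 / (q j).1 ^ 2) / (q l).1 ^ 2) i :=
    fun i ↦ by
      have := prod_Ico_fin (f := fun j ↦ (q j).2 ^ 2 / (q j).1 ^ 2) k i
      simp only [this]
  have h3 : ∀ i : Fin (N - k - 1 + 1),
      (∏ j ∈ Finset.Ico 0 i, (q (k + j)).2 ^ 2 / (q (k + j)).1 ^ 2) / (q (k + i)).1 ^ 2
      = (fun l : ℕ ↦ (∏ j ∈ Finset.Ico 0 l, (q (k + j)).2 ^ 2 / (q (k + j)).1 ^ 2)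
        / (q (k + l)).1 ^ 2) i :=
    fun i ↦ by
      have := prod_Ico_fin (f := fun j ↦ (q (k + j)).2 ^ 2 / (q (k + j)).1 ^ 2) 0 i
      simp only [this, Fin.val_zero]
  have h4 := (Finset.sum_congr rfl fun i _ ↦ h2 i).trans (sum_Ici_fin (f := fun l : ℕ ↦
    (∏ j ∈ Finset.Ico k.val l, (q j).2 ^ 2 / (q j).1 ^ 2) / (q l).1 ^ 2) k)
  have h5 := (Finset.sum_congr rfl fun i _ ↦ h3 i).trans (sum_Ici_fin (f := fun l : ℕ ↦
    (∏ j ∈ Finset.Ico 0 l, (q (k + j)).2 ^ 2 / (q (k + j)).1 ^ 2) / (q (k + l)).1 ^ 2)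
    (0 : Fin (N - k - 1 + 1)))
  rw [h4, h5, Fin.val_zero, Finset.sum_Ico_eq_sum_range, ← Finset.range_eq_Ico]
  congr 2
  refine Finset.sum_congr (by congr 1; omega) fun i _ ↦ ?_
  rw [Finset.prod_Ico_eq_prod_range, Nat.add_sub_cancel_left, ← Finset.range_eq_Ico]

lemma hasLaw_tailPairs (B : ℕ) (hNM : N ≤ M) (k : Fin N) :
    HasLaw (fun p : Fin N → ℝ × ℝ ↦ tailPairs p k)
      (chiPairs B (N - k - 1 + 1) (M - k - 1 + 1)) (chiPairs B N M) := by
  have h1 : iIndepFun (fun (j : Fin N) (p : Fin N → ℝ × ℝ) ↦ p j) (chiPairs B N M) :=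
    iIndepFun_pi (X := fun _ ↦ id) fun _ ↦ aemeasurable_id
  have h2 := h1.precomp (g := fun j : Fin (N - k - 1 + 1) ↦ (⟨k + j, by omega⟩ : Fin N))
    (fun i j hij ↦ by
      have := congrArg Fin.val hij
      simp only at this
      exact Fin.ext (by omega))
  refine h2.hasLaw_pi (fun j ↦ ?_)
  have h3 := measurePreserving_eval
    (fun j : Fin N ↦ (chiLaw (B * (M - j))).prod (chiLaw (B * (N - j - 1)))) ⟨k + j, by omega⟩
  have e1 : M - k - 1 + 1 - j = M - (k + j) := by omega
  have e2 : N - k - 1 + 1 - j - 1 = N - (k + j) - 1 := by omega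
  rw [e1, e2]
  exact h3.hasLaw

/-- The law of `1 / Σ_k` does not depend on `k`: the pairs with the indices from `k` on form the
model for `N - k` and `M - k`, which differ by as much as `N` and `M`. -/
theorem hasLaw_invSigma (hNM : N ≤ M) (k : Fin N) :
    HasLaw (fun p : Fin N → ℝ × ℝ ↦ invSigma (dyson 𝕜) M p k)
      ((chiLaw (dyson 𝕜 * (M - N + 1))).map fun x ↦ √((dyson 𝕜 : ℝ) * M) / x)
      (chiPairs (dyson 𝕜) N M) := by
  set m := M - k - 1 with hm
  set n := N - k - 1 with hn
  have hM : (0 : ℝ) ≤ M := Nat.cast_nonneg _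
  have hd : (0 : ℝ) ≤ dyson 𝕜 := Nat.cast_nonneg _
  have hm0 : ((m + 1 : ℕ) : ℝ) ≠ 0 := by exact_mod_cast Nat.succ_ne_zero m
  have hscale : ∀ q : Fin (n + 1) → ℝ × ℝ, invSigma (dyson 𝕜) M q 0
      = √(M / (m + 1 : ℕ)) * invSigma (dyson 𝕜) (m + 1) q 0 := by
    intro q
    rw [invSigma, invSigma, ← Real.sqrt_mul (by positivity)]
    congr 1
    field_simp
  have h1 : HasLaw (fun q : Fin (n + 1) → ℝ × ℝ ↦ invSigma (dyson 𝕜) M q 0)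
      ((chiLaw (dyson 𝕜 * (M - N + 1))).map fun x ↦ √((dyson 𝕜 : ℝ) * M) / x)
      (chiPairs (dyson 𝕜) (n + 1) (m + 1)) := by
    refine ⟨(measurable_invSigma _ _ _).aemeasurable, ?_⟩
    have h2 := chiPairs_map_invSigma_zero (𝕜 := 𝕜) (n := n) (m := m) (by omega)
    have h3 := congrArg (Measure.map fun x ↦ √(M / (m + 1 : ℕ)) * x) h2
    rw [Measure.map_map (by fun_prop) (measurable_invSigma _ _ _),
      Measure.map_map (by fun_prop) (by fun_prop)] at h3
    simp_rw [hscale]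
    refine h3.trans ?_
    rw [show m + 1 - n = M - N + 1 by omega]
    congr 1
    ext x
    simp only [Function.comp_apply]
    rw [← mul_div_assoc, ← Real.sqrt_mul (by positivity)]
    congr 2
    field_simp
  exact (h1.comp (hasLaw_tailPairs _ hNM k)).congr
    (Filter.Eventually.of_forall fun p ↦ invSigma_eq_tailPairs _ _ p k)

end InvSigmaLaw

section Independence

variable {N M B : ℕ} {Ω : Type*} [MeasurableSpace Ω] {P : Measure Ω} {p : Ω → Fin N → ℝ × ℝ}

/-- `invSigma` at `k` as a function of the pairs with the indices from `k` on. The missing pairs,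
which `invSigma` does not use, are replaced by `0`. -/
def invSigmaTail (B M : ℕ) (k : Fin N) (q : Set.Ici k → ℝ × ℝ) : ℝ :=
  invSigma B M (fun j ↦ if h : k ≤ j then q ⟨j, h⟩ else 0) k

lemma measurable_invSigmaTail (k : Fin N) : Measurable (invSigmaTail B M k) := by
  refine (measurable_invSigma B M k).comp (measurable_pi_lambda _ fun j ↦ ?_)
  by_cases h : k ≤ j
  · simpa [h] using measurable_pi_apply _
  · simp [h]

lemma invSigma_eq_invSigmaTail (q : Fin N → ℝ × ℝ) (k : Fin N) :
    invSigma B M q k = invSigmaTail B M k fun j : Set.Ici k ↦ q j := by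
  rw [invSigmaTail, invSigma, invSigma]
  congr 2
  refine Finset.sum_congr rfl fun i hi ↦ ?_
  rw [dif_pos (Finset.mem_Ici.1 hi)]
  refine congrArg₂ _ (Finset.prod_congr rfl fun j hj ↦ ?_) rfl
  rw [dif_pos (Finset.mem_Ico.1 hj).1]

lemma indepFun_invSigma [IsProbabilityMeasure P] (hp : HasLaw p (chiPairs B N M) P) (k : Fin N) :
    IndepFun (fun ω ↦ invSigma B M (p ω) k) (fun ω (j : Set.Iio k) ↦ p ω j) P := by
  have hlaw : ∀ j, HasLaw (fun ω ↦ p ω j)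
      ((chiLaw (B * (M - j))).prod (chiLaw (B * (N - j - 1)))) P := fun j ↦
    (measurePreserving_eval
      (fun j : Fin N ↦ (chiLaw (B * (M - j))).prod (chiLaw (B * (N - j - 1)))) j).comp_hasLaw hp
  have h1 : iIndepFun (fun j ω ↦ p ω j) P := (iIndepFun_iff_hasLaw_pi_pi hlaw).2 hp
  have h2 := h1.indepFun_finset₀ (Finset.Ici k) (Finset.Iio k) (by
    rw [Finset.disjoint_left]
    intro j hj hj'
    exact absurd (Finset.mem_Ici.1 hj) (not_le.2 (Finset.mem_Iio.1 hj')))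
    fun j ↦ (hlaw j).aemeasurable
  have h3 := h2.comp (φ := fun q ↦ invSigmaTail B M k fun j : Set.Ici k ↦
      q ⟨j.1, Finset.mem_Ici.2 j.2⟩)
    (ψ := fun q (j : Set.Iio k) ↦ q ⟨j.1, Finset.mem_Iio.2 j.2⟩)
    ((measurable_invSigmaTail k).comp (by fun_prop)) (by fun_prop)
  simp_rw [invSigma_eq_invSigmaTail]
  exact h3

/-- A random variable that is independent of itself is almost surely constant. -/
lemma exists_ae_eq_const_of_indepFun_self [IsProbabilityMeasure P] {X : Ω → ℝ}
    (hX : AEMeasurable X P) (h : IndepFun X X P) : ∃ c, ∀ᵐ ω ∂P, X ω = c := by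
  refine Filter.exists_eventuallyEq_const_of_forall_separating MeasurableSet fun s hs ↦ ?_
  have h1 := h.measure_inter_preimage_eq_mul s s hs hs
  rw [Set.inter_self] at h1
  by_cases h0 : P (X ⁻¹' s) = 0
  · exact Or.inr (measure_eq_zero_iff_ae_notMem.1 h0)
  · exact Or.inl ((mem_ae_iff_prob_eq_one₀ (hX.nullMeasurableSet_preimage hs)).2
      ((ENNReal.mul_eq_left h0 (measure_ne_top _ _)).1 h1.symm))

/-- As `1 / Σ_k` is a function of the pairs with the indices from `k` on, it would be constant if
it were independent of them; but its law has no atoms. -/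
lemma not_indepFun_invSigma [IsProbabilityMeasure P] (hNM : N ≤ M)
    (hp : HasLaw p (chiPairs (dyson 𝕜) N M) P) (k : Fin N) :
    ¬ IndepFun (fun ω ↦ invSigma (dyson 𝕜) M (p ω) k) (fun ω (j : Set.Ici k) ↦ p ω j) P := by
  intro h
  have h1 : IndepFun (fun ω ↦ invSigma (dyson 𝕜) M (p ω) k)
      (fun ω ↦ invSigma (dyson 𝕜) M (p ω) k) P := by
    have := h.comp measurable_id (measurable_invSigmaTail (B := dyson 𝕜) (M := M) k)
    simpa only [Function.comp_def, id_eq, ← invSigma_eq_invSigmaTail] using this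
  obtain ⟨c, hc⟩ := exists_ae_eq_const_of_indepFun_self
    ((measurable_invSigma _ _ k).comp_aemeasurable hp.aemeasurable) h1
  have hlaw := (hasLaw_invSigma (𝕜 := 𝕜) hNM k).comp hp
  have h2 : P {ω | invSigma (dyson 𝕜) M (p ω) k = c} = 1 := by
    rw [← prob_compl_eq_zero_iff₀]
    · exact hc
    · exact AEMeasurable.nullMeasurableSet_preimage
        ((measurable_invSigma _ _ k).comp_aemeasurable hp.aemeasurable) (measurableSet_singleton c)
  have h3 := hlaw.measure_eq (p := fun x ↦ x = c) (measurableSet_singleton c)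
  have h4 : P {ω | invSigma (dyson 𝕜) M (p ω) k = c} = 0 := by
    refine h3.trans ?_
    have hM : (0 : ℝ) < M := by exact_mod_cast (by have := k.isLt; omega : 0 < M)
    have hd : (0 : ℝ) < dyson 𝕜 := by exact_mod_cast dyson_pos 𝕜
    have hs : 0 < √((dyson 𝕜 : ℝ) * M) := Real.sqrt_pos.2 (mul_pos hd hM)
    have hmz : Measurable fun x : ℝ ↦ √((dyson 𝕜 : ℝ) * M) / x := by fun_prop
    have hd0 : dyson 𝕜 * (M - N + 1) ≠ 0 := (Nat.mul_pos (dyson_pos 𝕜) (Nat.succ_pos _)).ne'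
    rw [Set.ofPred_eq_eq_singleton, Measure.map_apply hmz (measurableSet_singleton c)]
    refine measure_mono_null (t := {0} ∪ {√((dyson 𝕜 : ℝ) * M) / c}) ?_
      (measure_union_null (chiLaw_singleton hd0 _) (chiLaw_singleton hd0 _))
    intro x hx
    have hx : √((dyson 𝕜 : ℝ) * M) / x = c := hx
    by_cases hx0 : x = 0
    · exact Or.inl hx0
    · right
      rw [Set.mem_singleton_iff, ← hx, div_div_cancel₀ hs.ne']
  rw [h2] at h4
  exact one_ne_zero h4

end Independence

/-! ### Polar decomposition and the parts of a Gaussian vector -/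

section Factorization

variable {N M : ℕ}

section Hermitian

variable {P : Matrix (Fin N) (Fin N) 𝕜}

/-- For a Hermitian `P`, the conjugate gradient algorithm for `P² x = P c` runs through the images
of the MINRES iterates for `P² x = c`. -/
lemma cgFormula_mulVec_sqrt (hP : P.conjTranspose = P) (c : Fin N → 𝕜) (k : ℕ) :
    cgFormula (P * P) (P.mulVec c) k = P.mulVec (minresFormula (P * P) c k) := by
  have h1 : krylovMatrix (P * P) (P.mulVec c) k = P * krylovMatrix (P * P) c k :=
    krylovMatrix_mulVec_of_intertwining (Matrix.mul_assoc P P P) c k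
  rw [cgFormula, minresFormula, h1, galerkin, galerkin, Matrix.conjTranspose_mul, hP]
  simp only [Matrix.mulVec_mulVec, Matrix.mul_assoc]

/-- The square root isometrically identifies the energy norms of the conjugate gradient errors with
the norms of the MINRES residuals. -/
lemma cgErrorFormula_mulVec_sqrt (hP : P.conjTranspose = P) (hdet : P.det ≠ 0) (c : Fin N → 𝕜)
    (k : ℕ) :
    cgErrorFormula (P * P) (P.mulVec c) k = minresResidualFormula (P * P) c k := by
  have hu : IsUnit P.det := hdet.isUnit
  have h1 : (P * P)⁻¹.mulVec (P.mulVec c) = P⁻¹.mulVec c := by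
    rw [Matrix.mul_inv_rev, Matrix.mulVec_mulVec, Matrix.mul_assoc, Matrix.nonsing_inv_mul _ hu,
      Matrix.mul_one]
  have h2 : P.mulVec (minresFormula (P * P) c k)
      = P⁻¹.mulVec ((P * P).mulVec (minresFormula (P * P) c k)) := by
    rw [Matrix.mulVec_mulVec, ← Matrix.mul_assoc, Matrix.nonsing_inv_mul _ hu, Matrix.one_mul]
  rw [cgErrorFormula, cgFormula_mulVec_sqrt hP, h1, h2, ← Matrix.mulVec_sub,
    minresResidualFormula]
  set v := c - (P * P).mulVec (minresFormula (P * P) c k)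
  have h3 : (P * P).toEuclideanLin (WithLp.toLp 2 (P⁻¹.mulVec v)) = WithLp.toLp 2 (P.mulVec v) := by
    change WithLp.toLp 2 ((P * P).mulVec (P⁻¹.mulVec v)) = _
    rw [Matrix.mulVec_mulVec, Matrix.mul_assoc, Matrix.mul_nonsing_inv _ hu, Matrix.mul_one]
  rw [energyNorm, h3, EuclideanSpace.inner_toLp_toLp, Matrix.star_mulVec,
    Matrix.conjTranspose_nonsing_inv, hP, dotProduct_comm, Matrix.dotProduct_mulVec,
    Matrix.vecMul_vecMul, Matrix.nonsing_inv_mul _ hu, Matrix.vecMul_one, dotProduct_comm,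
    ← EuclideanSpace.inner_toLp_toLp, ← norm_eq_sqrt_re_inner]

lemma isRegular_mulVec_sqrt (hdet : P.det ≠ 0) (c : Fin N → 𝕜) :
    IsRegular (P * P) (P.mulVec c) ↔ IsRegular (P * P) c := by
  unfold IsRegular
  rw [krylovMatrix_mulVec_of_intertwining (Matrix.mul_assoc P P P) c N]
  simp [Matrix.det_mul, hdet]

end Hermitian

open scoped ComplexOrder

/-- The polar decomposition `X / √M = P Q`, where `P` is the square root of `X X* / M`. -/
lemma exists_polar {X : Matrix (Fin N) (Fin M) 𝕜} (hX : (sampleCov X).det ≠ 0) :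
    ∃ (P : Matrix (Fin N) (Fin N) 𝕜) (Q : Matrix (Fin N) (Fin M) 𝕜), P.conjTranspose = P ∧
      P.det ≠ 0 ∧ sampleCov X = P * P ∧ Q * Q.conjTranspose = 1 ∧
      ((√M : ℝ) : 𝕜)⁻¹ • X = P * Q := by
  obtain ⟨P, hP, hPP⟩ : ∃ P : Matrix (Fin N) (Fin N) 𝕜, P.conjTranspose = P ∧
      sampleCov X = P * P := by
    open scoped MatrixOrder in
    exact ⟨CFC.sqrt (sampleCov X),
      (Matrix.nonneg_iff_posSemidef.1 (CFC.sqrt_nonneg (sampleCov X))).isHermitian.eq,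
      (CFC.sqrt_mul_sqrt_self (sampleCov X)
        (Matrix.nonneg_iff_posSemidef.2 (posSemidef_sampleCov X))).symm⟩
  have hdet : P.det ≠ 0 := fun h ↦ hX (by rw [hPP, Matrix.det_mul, h, mul_zero])
  have hu : IsUnit P.det := hdet.isUnit
  have hM : ((√M : ℝ) : 𝕜)⁻¹ * ((√M : ℝ) : 𝕜)⁻¹ = (M : 𝕜)⁻¹ := by
    rw [← mul_inv, ← RCLike.ofReal_mul, Real.mul_self_sqrt (Nat.cast_nonneg _),
      RCLike.ofReal_natCast]
  refine ⟨P, P⁻¹ * ((√M : ℝ) : 𝕜)⁻¹ • X, hP, hdet, hPP, ?_, ?_⟩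
  · have h : (((√M : ℝ) : 𝕜)⁻¹ • X) * (((√M : ℝ) : 𝕜)⁻¹ • X).conjTranspose = P * P := by
      rw [← hPP, sampleCov, Matrix.conjTranspose_smul, Matrix.smul_mul, Matrix.mul_smul, smul_smul,
        RCLike.star_def, map_inv₀, RCLike.conj_ofReal, hM]
    rw [Matrix.conjTranspose_mul, Matrix.conjTranspose_nonsing_inv, hP, Matrix.mul_assoc,
      ← Matrix.mul_assoc (((√M : ℝ) : 𝕜)⁻¹ • X), h, Matrix.mul_assoc, Matrix.mul_nonsing_inv _ hu,
      Matrix.mul_one, Matrix.nonsing_inv_mul _ hu]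
  · rw [← Matrix.mul_assoc, Matrix.mul_nonsing_inv _ hu, Matrix.one_mul]

/-- A matrix with orthonormal rows gives the leading coordinates in some orthonormal basis. -/
lemma exists_isometry_of_mul_conjTranspose {κ : Type*} [Fintype κ]
    (hκ : M = N + Fintype.card κ) {Q : Matrix (Fin N) (Fin M) 𝕜}
    (hQ : Q * Q.conjTranspose = 1) :
    ∃ f : EuclideanSpace 𝕜 (Fin M) ≃ₗᵢ[ℝ] EuclideanSpace 𝕜 (Fin N ⊕ κ),
      ∀ g i, f g (Sum.inl i) = Q.mulVec g.ofLp i := by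
  set u : Fin N → EuclideanSpace 𝕜 (Fin M) := fun i ↦ WithLp.toLp 2 (star (Q i)) with hu
  have hin : ∀ i g, inner 𝕜 (u i) g = Q.mulVec g.ofLp i := fun i g ↦ by
    rw [EuclideanSpace.inner_eq_star_dotProduct, dotProduct_comm, hu, star_star]
    rfl
  have hon : Orthonormal 𝕜 u := by
    rw [orthonormal_iff_ite]
    intro i j
    rw [hin]
    have := congrFun (congrFun hQ i) j
    rw [Matrix.one_apply] at this
    exact this
  set v : Fin N ⊕ κ → EuclideanSpace 𝕜 (Fin M) := Sum.elim u 0 with hv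
  have hcard : Module.finrank 𝕜 (EuclideanSpace 𝕜 (Fin M)) = Fintype.card (Fin N ⊕ κ) := by
    simp [hκ]
  obtain ⟨b, hb⟩ := Orthonormal.exists_orthonormalBasis_extension_of_card_eq hcard (v := v)
    (s := Set.range Sum.inl) (by
      refine ⟨?_, ?_⟩
      · rintro ⟨_, i, rfl⟩
        exact hon.1 i
      · rintro ⟨_, i, rfl⟩ ⟨_, j, rfl⟩ hij
        exact hon.2 fun h ↦ hij (by subst h; rfl))
  refine ⟨{ b.repr.toLinearEquiv.restrictScalars ℝ with norm_map' := b.repr.norm_map }, ?_⟩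
  intro g i
  change b.repr g (Sum.inl i) = _
  rw [b.repr_apply_apply, hb _ ⟨i, rfl⟩, hv, Sum.elim_inl, hin]

end Factorization

section SumLaws

variable {α E F ι κ : Type*} [MeasurableSpace α] [MeasurableSpace E] [MeasurableSpace F]
  [Fintype ι] [Fintype κ]

lemma pi_map_sum_prod (μ : Measure α) [IsProbabilityMeasure μ] {A : (ι → α) → E}
    {B : (κ → α) → F} (hA : Measurable A) (hB : Measurable B) :
    (Measure.pi fun _ : ι ⊕ κ ↦ μ).map
        (fun f ↦ (A fun i ↦ f (Sum.inl i), B fun j ↦ f (Sum.inr j)))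
      = ((Measure.pi fun _ ↦ μ).map A).prod ((Measure.pi fun _ ↦ μ).map B) := by
  have h := (measurePreserving_sumPiEquivProdPi (X := fun _ : ι ⊕ κ ↦ α) fun _ ↦ μ).map_eq
  rw [Measure.map_prod_map _ _ hA hB, ← h, Measure.map_map (by fun_prop) (by fun_prop)]
  rfl

/-- The quotient of chi-squared variables with `p` and `p + q` degrees of freedom, in terms of two
independent chi variables. -/
lemma chiSqRatioLaw_add (p q : ℕ) : chiSqRatioLaw p (p + q)
    = ((chiLaw p).prod (chiLaw q)).map fun x ↦ x.1 ^ 2 / (x.1 ^ 2 + x.2 ^ 2) := by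
  have h := (measurePreserving_arrowCongr' (fun _ : Fin p ⊕ Fin q ↦ gaussianReal 0 1)
    (fun _ : Fin (p + q) ↦ gaussianReal 0 1) finSumFinEquiv (MeasurableEquiv.refl ℝ)
    fun _ ↦ MeasurePreserving.id _).map_eq
  rw [chiSqRatioLaw, ← h, Measure.map_map (by fun_prop) (by fun_prop), chiLaw, chiLaw,
    ← pi_map_sum_prod _ (by fun_prop) (by fun_prop),
    Measure.map_map (by fun_prop) (by fun_prop)]
  congr 1
  ext g
  have hs : ∀ {n : ℕ} (x : Fin n → ℝ), √(∑ i, x i ^ 2) ^ 2 = ∑ i, x i ^ 2 := fun x ↦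
    Real.sq_sqrt (Finset.sum_nonneg fun i _ ↦ sq_nonneg _)
  have hg1 : ∀ i : Fin p, (MeasurableEquiv.arrowCongr' finSumFinEquiv (MeasurableEquiv.refl ℝ)) g
      (Fin.castAdd q i) = g (Sum.inl i) := fun i ↦
    congrArg g (finSumFinEquiv_symm_apply_castAdd i)
  have hg2 : ∀ i : Fin q, (MeasurableEquiv.arrowCongr' finSumFinEquiv (MeasurableEquiv.refl ℝ)) g
      (Fin.natAdd p i) = g (Sum.inr i) := fun i ↦
    congrArg g (finSumFinEquiv_symm_apply_natAdd i)
  simp only [Function.comp_apply, hs]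
  rw [Finset.sum_filter, Fin.sum_univ_add, Fin.sum_univ_add]
  simp [hg1, hg2]

/-- The coordinates of a vector with the indices in the first summand. -/
def leadPart (h : EuclideanSpace 𝕜 (ι ⊕ κ)) : EuclideanSpace 𝕜 ι :=
  WithLp.toLp 2 fun i ↦ h (Sum.inl i)

lemma measurable_leadPart {ι κ : Type*} :
    Measurable (leadPart : EuclideanSpace 𝕜 (ι ⊕ κ) → _) := by
  unfold leadPart
  fun_prop

/-- The two parts of a Gaussian vector have independent norms with chi distributions. -/
lemma gaussianVec_map_norm_prod : (gaussianVec 𝕜 (ι ⊕ κ)).map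
      (fun h ↦ (√(dyson 𝕜) * ‖leadPart h‖,
        √(dyson 𝕜) * ‖WithLp.toLp 2 fun j ↦ h (Sum.inr j)‖))
    = (chiLaw (dyson 𝕜 * Fintype.card ι)).prod (chiLaw (dyson 𝕜 * Fintype.card κ)) := by
  have hι : (Measure.pi fun _ : ι ↦ stdNormal 𝕜).map
      (fun x ↦ √(dyson 𝕜) * ‖WithLp.toLp 2 x‖) = chiLaw (dyson 𝕜 * Fintype.card ι) := by
    rw [← gaussianVec_map_norm, gaussianVec, Measure.map_map (by fun_prop) (by fun_prop)]
    rfl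
  have hκ : (Measure.pi fun _ : κ ↦ stdNormal 𝕜).map
      (fun x ↦ √(dyson 𝕜) * ‖WithLp.toLp 2 x‖) = chiLaw (dyson 𝕜 * Fintype.card κ) := by
    rw [← gaussianVec_map_norm, gaussianVec, Measure.map_map (by fun_prop) (by fun_prop)]
    rfl
  have hm := measurable_leadPart (𝕜 := 𝕜) (ι := ι) (κ := κ)
  rw [← hι, ← hκ, ← pi_map_sum_prod _ (by fun_prop) (by fun_prop), gaussianVec,
    Measure.map_map (by fun_prop) (by fun_prop)]
  rfl

lemma gaussianVec_map_ratio : (gaussianVec 𝕜 (ι ⊕ κ)).map (fun h ↦ ‖leadPart h‖ ^ 2 / ‖h‖ ^ 2)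
    = chiSqRatioLaw (dyson 𝕜 * Fintype.card ι)
        (dyson 𝕜 * Fintype.card ι + dyson 𝕜 * Fintype.card κ) := by
  have hm := measurable_leadPart (𝕜 := 𝕜) (ι := ι) (κ := κ)
  rw [chiSqRatioLaw_add, ← gaussianVec_map_norm_prod,
    Measure.map_map (by fun_prop) (by fun_prop)]
  congr 1
  ext h
  have hd : (dyson 𝕜 : ℝ) ≠ 0 := by exact_mod_cast (dyson_pos 𝕜).ne'
  simp only [Function.comp_apply]
  rw [mul_pow, mul_pow, Real.sq_sqrt (Nat.cast_nonneg _), ← mul_add, mul_div_mul_left _ _ hd,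
    EuclideanSpace.norm_sq_eq h, Fintype.sum_sum_type, EuclideanSpace.norm_sq_eq (leadPart h),
    EuclideanSpace.norm_sq_eq (WithLp.toLp 2 fun i ↦ h (Sum.inr i))]
  rfl

lemma ae_leadPart_ne_zero [Nonempty ι] : ∀ᵐ h ∂gaussianVec 𝕜 (ι ⊕ κ), leadPart h ≠ 0 := by
  have hm := measurable_leadPart (𝕜 := 𝕜) (ι := ι) (κ := κ)
  have h0 : ∀ᵐ x ∂(chiLaw (dyson 𝕜 * Fintype.card ι)).prod (chiLaw (dyson 𝕜 * Fintype.card κ)),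
      x.1 ≠ 0 :=
    Measure.quasiMeasurePreserving_fst.ae (p := fun x : ℝ ↦ x ≠ 0) (by
      simpa [ae_iff] using chiLaw_singleton (Nat.mul_pos (dyson_pos 𝕜) Fintype.card_pos).ne' 0)
  rw [← gaussianVec_map_norm_prod] at h0
  filter_upwards [ae_of_ae_map (by fun_prop) h0] with h hh hl
  simp [hl] at hh

lemma ae_gaussianVec_ne_zero [Nonempty ι] : ∀ᵐ g ∂gaussianVec 𝕜 ι, g ≠ 0 := by
  have h0 : ∀ᵐ x ∂chiLaw (dyson 𝕜 * Fintype.card ι), x ≠ 0 := by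
    simpa [ae_iff] using chiLaw_singleton (Nat.mul_pos (dyson_pos 𝕜) Fintype.card_pos).ne' 0
  rw [← gaussianVec_map_norm (𝕜 := 𝕜)] at h0
  filter_upwards [ae_of_ae_map (by fun_prop) h0] with h hh hl
  simp [hl] at hh

end SumLaws

/-! ### The normal equations -/

section NormalEquations

variable {N M : ℕ}

lemma ofLp_normalRhs (X : Matrix (Fin N) (Fin M) 𝕜) (b : EuclideanSpace 𝕜 (Fin M)) :
    (normalRhs X b).ofLp = ((√M : ℝ) : 𝕜)⁻¹ • X.mulVec b.ofLp := rfl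

lemma measurable_normalRhs : Measurable
    fun x : Matrix (Fin N) (Fin M) 𝕜 × EuclideanSpace 𝕜 (Fin M) ↦ (normalRhs x.1 x.2).ofLp := by
  have h : Measurable fun x : Matrix (Fin N) (Fin M) 𝕜 × EuclideanSpace 𝕜 (Fin M) ↦
      x.1.mulVec x.2.ofLp :=
    measurable_fst.matrix_mulVec ((WithLp.measurable_ofLp 2 _).comp measurable_snd)
  exact h.const_smul (((√M : ℝ) : 𝕜)⁻¹)

lemma measurable_normalRhs_left (b : EuclideanSpace 𝕜 (Fin M)) :
    Measurable fun X : Matrix (Fin N) (Fin M) 𝕜 ↦ (normalRhs X b).ofLp := by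
  have h : Measurable fun X : Matrix (Fin N) (Fin M) 𝕜 ↦ X.mulVec b.ofLp :=
    measurable_id.matrix_mulVec measurable_const
  exact h.const_smul (((√M : ℝ) : 𝕜)⁻¹)

section Averaging

variable {Ψ Ψ' : Matrix (Fin N) (Fin N) 𝕜 → (Fin N → 𝕜) → ℝ≥0∞}

/-- By the right invariance of the Gaussian matrix, only the norm of `b` matters in the normal
equations. -/
lemma lintegral_normalRhs_congr (hΨ : Measurable (Function.uncurry Ψ))
    {b b' : EuclideanSpace 𝕜 (Fin M)} (h : ‖b‖ = ‖b'‖) :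
    ∫⁻ X, Ψ (sampleCov X) (normalRhs X b).ofLp ∂gaussianMatrixLaw 𝕜 N M
      = ∫⁻ X, Ψ (sampleCov X) (normalRhs X b').ofLp ∂gaussianMatrixLaw 𝕜 N M := by
  have key : ∀ b : EuclideanSpace 𝕜 (Fin M),
      ∫⁻ X, Ψ (sampleCov X) (normalRhs X b).ofLp ∂gaussianMatrixLaw 𝕜 N M
        = ∫⁻ X, Ψ (sampleCov X) (normalRhs X (WithLp.toLp 2 (firstCoord 𝕜 M ‖b‖))).ofLp
          ∂gaussianMatrixLaw 𝕜 N M := by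
    intro b
    obtain ⟨V, hV, hVb⟩ := exists_unitary_mulVec_eq_firstCoord b
    have hm : Measurable fun X : Matrix (Fin N) (Fin M) 𝕜 ↦
        Ψ (sampleCov X) (normalRhs X b).ofLp :=
      hΨ.comp (measurable_sampleCov.prodMk
        (measurable_normalRhs_left b))
    rw [← gaussianMatrixLaw_map_mul (one_mem (Matrix.unitaryGroup (Fin N) 𝕜)) hV,
      lintegral_map hm (by fun_prop), gaussianMatrixLaw_map_mul (one_mem _) hV]
    refine lintegral_congr fun X ↦ ?_
    rw [Matrix.one_mul, sampleCov_mul_unitary hV, ofLp_normalRhs, ofLp_normalRhs, ← hVb,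
      Matrix.mulVec_mulVec]
  rw [key b, key b', h]

/-- The law of a function of a Gaussian matrix `X` and of `X b / √M` that can be expressed by the
factors of the polar decomposition `X / √M = P Q`. As the law depends on the norm of `b` only, `b`
may be replaced by a random vector with a uniform direction, which makes `Q b` independent
of `X`. -/
theorem lintegral_normalRhs (hNM : N ≤ M) (hN : 0 < N) (hΨ : Measurable (Function.uncurry Ψ))
    (hΨ' : Measurable (Function.uncurry Ψ'))
    (h : ∀ P : Matrix (Fin N) (Fin N) 𝕜, P.conjTranspose = P → P.det ≠ 0 → ∀ c,
      Ψ (P * P) (P.mulVec c) = Ψ' (P * P) c)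
    (hU : ∀ U ∈ Matrix.unitaryGroup (Fin N) 𝕜, ∀ W c,
      Ψ' (U * W * U.conjTranspose) (U.mulVec c) = Ψ' W c) (b : EuclideanSpace 𝕜 (Fin M)) :
    ∫⁻ X, Ψ (sampleCov X) (normalRhs X b).ofLp ∂gaussianMatrixLaw 𝕜 N M
      = ∫⁻ g, ∫⁻ p, Ψ' (sampleCov (chiBidiag 𝕜 M p))
            (firstCoord 𝕜 N (‖b‖ * (‖leadPart g‖ / ‖g‖))) ∂chiPairs (dyson 𝕜) N M
          ∂gaussianVec 𝕜 (Fin N ⊕ Fin (M - N)) := by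
  have : Nonempty (Fin M) := ⟨⟨0, by omega⟩⟩
  have hlead := measurable_leadPart (𝕜 := 𝕜) (ι := Fin N) (κ := Fin (M - N))
  have hm1 : Measurable fun x : EuclideanSpace 𝕜 (Fin M) × Matrix (Fin N) (Fin M) 𝕜 ↦
      Ψ (sampleCov x.2) (normalRhs x.2 (((‖b‖ / ‖x.1‖ : ℝ) : 𝕜) • x.1)).ofLp := by
    have h1 : Measurable fun x : EuclideanSpace 𝕜 (Fin M) × Matrix (Fin N) (Fin M) 𝕜 ↦
        ((‖b‖ / ‖x.1‖ : ℝ) : 𝕜) • x.1 := by fun_prop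
    exact hΨ.comp ((measurable_sampleCov.comp measurable_snd).prodMk
      (measurable_normalRhs.comp (measurable_snd.prodMk h1)))
  have hm2 : Measurable fun x : Matrix (Fin N) (Fin M) 𝕜 ×
      EuclideanSpace 𝕜 (Fin N ⊕ Fin (M - N)) ↦
      Ψ' (sampleCov x.1) (((‖b‖ / ‖x.2‖ : ℝ) : 𝕜) • leadPart x.2).ofLp := by
    have h1 : Measurable fun x : Matrix (Fin N) (Fin M) 𝕜 ×
        EuclideanSpace 𝕜 (Fin N ⊕ Fin (M - N)) ↦
        (((‖b‖ / ‖x.2‖ : ℝ) : 𝕜) • leadPart x.2).ofLp := by fun_prop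
    exact hΨ'.comp ((measurable_sampleCov.comp measurable_fst).prodMk h1)
  have hdet : ∀ᵐ X ∂gaussianMatrixLaw 𝕜 N M, (sampleCov X).det ≠ 0 := by
    have h1 := ae_wishartLaw_isRegular (M := M) hNM
      (b := EuclideanSpace.single (⟨0, hN⟩ : Fin N) (1 : 𝕜)) (by simp)
    filter_upwards [ae_of_ae_map measurable_sampleCov.aemeasurable h1] with X hX
    exact hX.det_ne_zero
  calc ∫⁻ X, Ψ (sampleCov X) (normalRhs X b).ofLp ∂gaussianMatrixLaw 𝕜 N M
      = ∫⁻ g, ∫⁻ X, Ψ (sampleCov X) (normalRhs X (((‖b‖ / ‖g‖ : ℝ) : 𝕜) • g)).ofLp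
          ∂gaussianMatrixLaw 𝕜 N M ∂gaussianVec 𝕜 (Fin M) := by
        have h1 : ∀ᵐ g ∂gaussianVec 𝕜 (Fin M),
            ∫⁻ X, Ψ (sampleCov X) (normalRhs X (((‖b‖ / ‖g‖ : ℝ) : 𝕜) • g)).ofLp
              ∂gaussianMatrixLaw 𝕜 N M
            = ∫⁻ X, Ψ (sampleCov X) (normalRhs X b).ofLp ∂gaussianMatrixLaw 𝕜 N M := by
          filter_upwards [ae_gaussianVec_ne_zero] with g hg
          refine lintegral_normalRhs_congr hΨ ?_
          rw [norm_smul, RCLike.norm_ofReal, abs_of_nonneg (by positivity),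
            div_mul_cancel₀ _ (norm_ne_zero_iff.2 hg)]
        rw [lintegral_congr_ae h1, lintegral_const, measure_univ, mul_one]
    _ = ∫⁻ X, ∫⁻ g, Ψ (sampleCov X) (normalRhs X (((‖b‖ / ‖g‖ : ℝ) : 𝕜) • g)).ofLp
          ∂gaussianVec 𝕜 (Fin M) ∂gaussianMatrixLaw 𝕜 N M :=
        lintegral_lintegral_swap hm1.aemeasurable
    _ = ∫⁻ X, ∫⁻ g, Ψ' (sampleCov X) (((‖b‖ / ‖g‖ : ℝ) : 𝕜) • leadPart g).ofLp
          ∂gaussianVec 𝕜 (Fin N ⊕ Fin (M - N)) ∂gaussianMatrixLaw 𝕜 N M := by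
        refine lintegral_congr_ae ?_
        filter_upwards [hdet] with X hX
        obtain ⟨P, Q, hP, hPd, hW, hQ, hXPQ⟩ := exists_polar hX
        obtain ⟨f, hf⟩ := exists_isometry_of_mul_conjTranspose (κ := Fin (M - N))
          (by rw [Fintype.card_fin]; omega) hQ
        have hm3 : Measurable fun g : EuclideanSpace 𝕜 (Fin N ⊕ Fin (M - N)) ↦
            Ψ' (sampleCov X) (((‖b‖ / ‖g‖ : ℝ) : 𝕜) • leadPart g).ofLp :=
          hm2.comp (measurable_const.prodMk measurable_id)
        rw [← gaussianVec_map f, lintegral_map hm3 f.continuous.measurable]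
        refine lintegral_congr fun g ↦ ?_
        have h1 : leadPart (f g) = WithLp.toLp 2 (Q.mulVec g.ofLp) := by
          ext i
          exact hf g i
        have h2 : ∀ v : EuclideanSpace 𝕜 (Fin M),
            (normalRhs X v).ofLp = P.mulVec (Q.mulVec v.ofLp) := fun v ↦ by
          rw [ofLp_normalRhs, ← Matrix.smul_mulVec, hXPQ, Matrix.mulVec_mulVec]
        rw [h1, f.norm_map, h2, hW, h P hP hPd, WithLp.ofLp_smul, WithLp.ofLp_smul,
          Matrix.mulVec_smul]
    _ = ∫⁻ g, ∫⁻ X, Ψ' (sampleCov X) (((‖b‖ / ‖g‖ : ℝ) : 𝕜) • leadPart g).ofLp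
          ∂gaussianMatrixLaw 𝕜 N M ∂gaussianVec 𝕜 (Fin N ⊕ Fin (M - N)) :=
        lintegral_lintegral_swap hm2.aemeasurable
    _ = _ := by
        refine lintegral_congr fun g ↦ ?_
        rw [lintegral_sampleCov_eq_bidiag (G := Ψ') hNM
          (fun b ↦ hΨ'.comp (measurable_id.prodMk measurable_const)) hU, norm_smul,
          RCLike.norm_ofReal, abs_of_nonneg (by positivity), div_mul_eq_mul_div, mul_div_assoc]

end Averaging

instance (p q : ℕ) : IsProbabilityMeasure (chiSqRatioLaw p q) :=
  Measure.isProbabilityMeasure_map (Measurable.aemeasurable (by fun_prop))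

/-- The law of a function of a Gaussian matrix `X` and of `X b / √M` in the bidiagonal model. -/
theorem map_normalRhs_eq {E : Type*} [MeasurableSpace E] (hNM : N ≤ M) (hN : 0 < N)
    {G G' : Matrix (Fin N) (Fin N) 𝕜 → (Fin N → 𝕜) → E} (hG : Measurable (Function.uncurry G))
    (hG' : Measurable (Function.uncurry G'))
    (h : ∀ P : Matrix (Fin N) (Fin N) 𝕜, P.conjTranspose = P → P.det ≠ 0 → ∀ c,
      G (P * P) (P.mulVec c) = G' (P * P) c)
    (hU : ∀ U ∈ Matrix.unitaryGroup (Fin N) 𝕜, ∀ W c,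
      G' (U * W * U.conjTranspose) (U.mulVec c) = G' W c)
    {b : EuclideanSpace 𝕜 (Fin M)} (hb : b ≠ 0) {φ : (Fin N → ℝ × ℝ) → ℝ → E}
    (hφ : Measurable (Function.uncurry φ))
    (hval : ∀ p, IsPositive p → ∀ t, 0 < t →
      G' (sampleCov (chiBidiag 𝕜 M p)) (firstCoord 𝕜 N t) = φ p t) :
    (gaussianMatrixLaw 𝕜 N M).map (fun X ↦ G (sampleCov X) (normalRhs X b).ofLp)
      = ((chiPairs (dyson 𝕜) N M).prod (chiSqRatioLaw (dyson 𝕜 * N) (dyson 𝕜 * M))).map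
        fun ω ↦ φ ω.1 (‖b‖ * √ω.2) := by
  have : Nonempty (Fin N) := ⟨⟨0, hN⟩⟩
  have hlead := measurable_leadPart (𝕜 := 𝕜) (ι := Fin N) (κ := Fin (M - N))
  have hratio := gaussianVec_map_ratio (𝕜 := 𝕜) (ι := Fin N) (κ := Fin (M - N))
  have hrm : Measurable fun h : EuclideanSpace 𝕜 (Fin N ⊕ Fin (M - N)) ↦
    ‖leadPart h‖ ^ 2 / ‖h‖ ^ 2 := by fun_prop
  rw [Fintype.card_fin, Fintype.card_fin, ← mul_add, Nat.add_sub_cancel' hNM] at hratio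
  have hm1 : Measurable fun X : Matrix (Fin N) (Fin M) 𝕜 ↦ G (sampleCov X) (normalRhs X b).ofLp :=
    hG.comp (measurable_sampleCov.prodMk
      (measurable_normalRhs_left b))
  have hm2 : Measurable fun ω : (Fin N → ℝ × ℝ) × ℝ ↦ φ ω.1 (‖b‖ * √ω.2) :=
    hφ.comp (measurable_fst.prodMk ((by fun_prop : Measurable fun r : ℝ ↦ ‖b‖ * √r).comp
      measurable_snd))
  ext s hs
  have hs1 : Measurable (s.indicator (1 : E → ℝ≥0∞)) := measurable_one.indicator hs
  have hm3 : Measurable fun ω : (Fin N → ℝ × ℝ) × ℝ ↦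
      s.indicator (1 : E → ℝ≥0∞) (φ ω.1 (‖b‖ * √ω.2)) := hs1.comp hm2
  rw [← lintegral_indicator_one hs, ← lintegral_indicator_one hs, lintegral_map hs1 hm1,
    lintegral_map hs1 hm2, lintegral_prod_symm _ hm3.aemeasurable, ← hratio,
    lintegral_map hm3.lintegral_prod_left' hrm]
  refine (lintegral_normalRhs (Ψ := fun W c ↦ s.indicator 1 (G W c))
    (Ψ' := fun W c ↦ s.indicator 1 (G' W c)) hNM hN (hs1.comp hG) (hs1.comp hG')
    (fun P hP hd c ↦ by rw [h P hP hd]) (fun U hUU W c ↦ by rw [hU U hUU]) b).trans ?_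
  refine lintegral_congr_ae ?_
  filter_upwards [ae_leadPart_ne_zero] with g hg
  have hg0 : g ≠ 0 := by
    rintro rfl
    exact hg rfl
  refine lintegral_congr_ae ?_
  filter_upwards [ae_chiPairs_isPositive (dyson_pos 𝕜) hNM] with p hp
  have ht : 0 < ‖b‖ * (‖leadPart g‖ / ‖g‖) :=
    mul_pos (norm_pos_iff.2 hb) (div_pos (norm_pos_iff.2 hg) (norm_pos_iff.2 hg0))
  rw [hval p hp _ ht, ← div_pow, Real.sqrt_sq (by positivity)]

lemma ae_isRegular_normalRhs (hNM : N ≤ M) (hN : 0 < N) {b : EuclideanSpace 𝕜 (Fin M)}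
    (hb : b ≠ 0) :
    ∀ᵐ X ∂gaussianMatrixLaw 𝕜 N M, IsRegular (sampleCov X) (normalRhs X b).ofLp := by
  have hm : Measurable (Function.uncurry (IsRegular : Matrix (Fin N) (Fin N) 𝕜 → _ → Prop)) :=
    measurableSet_setOfPred.1 (measurableSet_isRegular measurable_fst measurable_snd)
  have h := map_normalRhs_eq (G := IsRegular) (G' := IsRegular) hNM hN hm hm
    (fun P _ hd c ↦ propext (isRegular_mulVec_sqrt hd c))
    (fun U hU W c ↦ propext (isRegular_unitary_conj hU)) hb (φ := fun _ _ ↦ True)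
    measurable_const (fun p hp t ht ↦ eq_true (isRegular_chiBidiag hNM hp ht))
  have hms : MeasurableSet {X : Matrix (Fin N) (Fin M) 𝕜 |
      IsRegular (sampleCov X) (normalRhs X b).ofLp} :=
    measurableSet_isRegular measurable_sampleCov (measurable_normalRhs_left b)
  have hm1 : Measurable fun X : Matrix (Fin N) (Fin M) 𝕜 ↦
      IsRegular (sampleCov X) (normalRhs X b).ofLp := measurableSet_setOfPred.1 hms
  have h2 : (gaussianMatrixLaw 𝕜 N M)
      {X | IsRegular (sampleCov X) (normalRhs X b).ofLp}ᶜ = 0 := by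
    have h3 := congrArg (fun μ ↦ μ {q : Prop | ¬ q}) h
    simp only at h3
    rw [Measure.map_apply hm1 (MeasurableSet.of_discrete),
      Measure.map_apply measurable_const (MeasurableSet.of_discrete)] at h3
    simpa [Set.compl_def] using h3
  exact h2

variable {Ω : Type*} [MeasurableSpace Ω] {P : Measure Ω}

/-- The conjugate gradient errors for the normal equations have the law of the MINRES residuals,
scaled by the relative norm of a projection of an independent Gaussian vector. -/
theorem identDistrib_normalEquations [IsProbabilityMeasure P] (hNM : N ≤ M)
    {X : Ω → Matrix (Fin N) (Fin M) 𝕜} (hX : HasLaw X (gaussianMatrixLaw 𝕜 N M) P)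
    {b : EuclideanSpace 𝕜 (Fin M)} (hb : b ≠ 0) :
    IdentDistrib
      (fun ω (k : Fin N) ↦ energyNorm (sampleCov (X ω))
        (cgError (sampleCov (X ω)) (normalRhs (X ω) b) k))
      (fun (ω : (Fin N → ℝ × ℝ) × ℝ) (k : Fin N) ↦ √ω.2 * minresRatio ω.1 k * ‖b‖) P
      ((chiPairs (dyson 𝕜) N M).prod (chiSqRatioLaw (dyson 𝕜 * N) (dyson 𝕜 * M))) := by
  -- For `N = 0`, both sides are laws on a one-point space.
  rcases Nat.eq_zero_or_pos N with rfl | hN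
  · refine ⟨(measurable_of_subsingleton_codomain _).aemeasurable,
      (measurable_of_subsingleton_codomain _).aemeasurable, ?_⟩
    have h1 := Measure.isProbabilityMeasure_map (μ := P) (measurable_of_subsingleton_codomain
      (fun ω (k : Fin 0) ↦ energyNorm (sampleCov (X ω))
        (cgError (sampleCov (X ω)) (normalRhs (X ω) b) k))).aemeasurable
    have h2 := Measure.isProbabilityMeasure_map
      (μ := (chiPairs (dyson 𝕜) 0 M).prod (chiSqRatioLaw (dyson 𝕜 * 0) (dyson 𝕜 * M)))
      (measurable_of_subsingleton_codomain (fun (ω : (Fin 0 → ℝ × ℝ) × ℝ) (k : Fin 0) ↦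
        √ω.2 * minresRatio ω.1 k * ‖b‖)).aemeasurable
    ext s -
    rcases Set.eq_empty_or_nonempty s with rfl | hs
    · simp only [measure_empty]
    · rw [Subsingleton.eq_univ_of_nonempty hs, measure_univ, measure_univ]
  have hreg : ∀ᵐ ω ∂P, IsRegular (sampleCov (X ω)) (normalRhs (X ω) b).ofLp := by
    have h1 := ae_isRegular_normalRhs (N := N) hNM hN hb
    rw [← hX.map_eq] at h1
    exact ae_of_ae_map hX.aemeasurable h1
  have hm : Measurable (Function.uncurry fun (W : Matrix (Fin N) (Fin N) 𝕜) c (k : Fin N) ↦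
      cgErrorFormula W c k) :=
    measurable_pi_lambda _ fun k ↦ measurable_cgErrorFormula measurable_fst measurable_snd k
  have hm' : Measurable (Function.uncurry fun (W : Matrix (Fin N) (Fin N) 𝕜) c (k : Fin N) ↦
      minresResidualFormula W c k) :=
    measurable_pi_lambda _ fun k ↦ measurable_minresResidualFormula measurable_fst measurable_snd k
  have hφ : Measurable (Function.uncurry fun (p : Fin N → ℝ × ℝ) t (k : Fin N) ↦
      minresRatio p k * t) :=
    measurable_pi_lambda _ fun k ↦ ((measurable_minresRatio k).comp measurable_fst).mul
      measurable_snd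
  have hlaw := map_normalRhs_eq
    (G := fun (W : Matrix (Fin N) (Fin N) 𝕜) c (k : Fin N) ↦ cgErrorFormula W c k)
    (G' := fun W c (k : Fin N) ↦ minresResidualFormula W c k)
    (φ := fun p t (k : Fin N) ↦ minresRatio p k * t) hNM hN hm hm'
    (fun P hP hd c ↦ funext fun k ↦ cgErrorFormula_mulVec_sqrt hP hd c k)
    (fun U hU W c ↦ funext fun k ↦ minresResidualFormula_unitary_conj hU) hb hφ
    (fun p hp t ht ↦ funext fun k ↦ minresResidualFormula_chiBidiag hNM hp ht k)
  have hm1 : Measurable fun (X : Matrix (Fin N) (Fin M) 𝕜) (k : Fin N) ↦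
      cgErrorFormula (sampleCov X) (normalRhs X b).ofLp k :=
    measurable_pi_lambda _ fun k ↦ measurable_cgErrorFormula measurable_sampleCov
      (measurable_normalRhs_left b) k
  have heq : (fun ω (k : Fin N) ↦ energyNorm (sampleCov (X ω))
      (cgError (sampleCov (X ω)) (normalRhs (X ω) b) k)) =ᵐ[P]
      (fun X (k : Fin N) ↦ cgErrorFormula (sampleCov X) (normalRhs X b).ofLp k) ∘ X := by
    filter_upwards [hreg] with ω hω
    funext k
    exact energyNorm_cgError (posDef_sampleCov hω.det_ne_zero) hω k.isLt.le
  have hcomm : ∀ (ω : (Fin N → ℝ × ℝ) × ℝ) (k : Fin N),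
      √ω.2 * minresRatio ω.1 k * ‖b‖ = minresRatio ω.1 k * (‖b‖ * √ω.2) := fun ω k ↦ by ring
  simp_rw [hcomm]
  refine ⟨(hm1.comp_aemeasurable hX.aemeasurable).congr heq.symm, Measurable.aemeasurable ?_, ?_⟩
  · exact hφ.comp (measurable_fst.prodMk
      ((by fun_prop : Measurable fun r : ℝ ↦ ‖b‖ * √r).comp measurable_snd))
  · rw [Measure.map_congr heq, ← AEMeasurable.map_map_of_aemeasurable hm1.aemeasurable
      hX.aemeasurable, hX.map_eq, hlaw]

end NormalEquations

end KrylovWishart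

end

theorem theorem1p2 (𝕜 : Type*) [RCLike 𝕜] (N M : ℕ) (hNM : N ≤ M)
    {Ω Ω' : Type*} [MeasurableSpace Ω] [MeasurableSpace Ω']
    (P : Measure Ω) [IsProbabilityMeasure P] (P' : Measure Ω') [IsProbabilityMeasure P'] :
    (∀ W : Ω → Matrix (Fin N) (Fin N) 𝕜, HasLaw W (wishartLaw 𝕜 N M) P →
      ∀ b : EuclideanSpace 𝕜 (Fin N), b ≠ 0 →
      ∀ α β : Fin N → Ω' → ℝ, IsChiFamily (dyson 𝕜) N M P' α β →
        -- (a), conjugate gradient residuals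
        IdentDistrib (fun ω (k : Fin N) ↦ ‖cgResidual (W ω) b k‖)
          (fun ω (k : Fin N) ↦ ‖b‖ * ∏ j ∈ Finset.Iio k, β j ω / α j ω) P P' ∧
        -- (a), conjugate gradient errors; `S k` is the variable `1 / Σ_k`
        (∃ S : Fin N → Ω' → ℝ,
          (∀ k, HasLaw (S k)
            ((chiLaw (dyson 𝕜 * (M - N + 1))).map fun x ↦ √((dyson 𝕜 : ℝ) * M) / x) P') ∧
          (∀ k, IndepFun (S k) (fun ω (j : Set.Iio k) ↦ (α j ω, β j ω)) P') ∧
          (∀ k, Measurable[MeasurableSpace.comap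
            (fun ω (j : Set.Ici k) ↦ (α j ω, β j ω)) inferInstance] (S k)) ∧
          (∀ k, ¬ IndepFun (S k) (fun ω (j : Set.Ici k) ↦ (α j ω, β j ω)) P') ∧
          IdentDistrib
            (fun ω (k : Fin N) ↦ (‖cgResidual (W ω) b k‖, energyNorm (W ω) (cgError (W ω) b k)))
            (fun ω (k : Fin N) ↦ (‖b‖ * ∏ j ∈ Finset.Iio k, β j ω / α j ω,
              S k ω * (‖b‖ * ∏ j ∈ Finset.Iio k, β j ω / α j ω))) P P') ∧
        -- (b), MINRES residuals
        IdentDistrib (fun ω (k : Fin N) ↦ ‖minresResidual (W ω) b k‖)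
          (fun ω (k : Fin N) ↦ (∑ j ∈ Finset.Iic k, ∏ l ∈ Finset.Iio j,
            α l ω ^ 2 / β l ω ^ 2) ^ (-(1 / 2) : ℝ) * ‖b‖) P P') ∧
    -- (c), conjugate gradient errors for the normal equations
    (∃ (Ω₀ : Type) (_ : MeasurableSpace Ω₀) (P₀ : Measure Ω₀)
        (α β : Fin N → Ω₀ → ℝ) (Δ : Ω₀ → ℝ),
      IsProbabilityMeasure P₀ ∧ IsChiFamily (dyson 𝕜) N M P₀ α β ∧
      HasLaw Δ (chiSqRatioLaw (dyson 𝕜 * N) (dyson 𝕜 * M)) P₀ ∧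
      ∀ X : Ω → Matrix (Fin N) (Fin M) 𝕜, HasLaw X (gaussianMatrixLaw 𝕜 N M) P →
      ∀ b : EuclideanSpace 𝕜 (Fin M), b ≠ 0 →
        IdentDistrib
          (fun ω (k : Fin N) ↦ energyNorm (sampleCov (X ω))
            (cgError (sampleCov (X ω)) (normalRhs (X ω) b) k))
          (fun ω (k : Fin N) ↦ √(Δ ω) * (∑ j ∈ Finset.Iic k, ∏ l ∈ Finset.Iio j,
            α l ω ^ 2 / β l ω ^ 2) ^ (-(1 / 2) : ℝ) * ‖b‖) P P₀) := by
  refine ⟨fun W hW b hb α β hαβ ↦ ?_, ?_⟩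
  · set p : Ω' → Fin N → ℝ × ℝ := fun ω j ↦ (α j ω, β j ω) with hpdef
    have hp : HasLaw p (chiPairs (dyson 𝕜) N M) P' := hαβ.hasLaw_pairs
    refine ⟨?_, ⟨fun k ω ↦ invSigma (dyson 𝕜) M (p ω) k,
      fun k ↦ (hasLaw_invSigma hNM k).comp hp, indepFun_invSigma hp, fun k ↦ ?_,
      not_indepFun_invSigma hNM hp, ?_⟩, ?_⟩
    · exact identDistrib_wishart hNM hW hb hp
        (G := fun W c (k : Fin N) ↦ cgResidualFormula W c k)
        (fun b ↦ measurable_pi_lambda _ fun k ↦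
          measurable_cgResidualFormula measurable_id measurable_const k)
        (fun U hU W c ↦ funext fun k ↦ cgResidualFormula_unitary_conj hU)
        (f := fun W (k : Fin N) ↦ ‖cgResidual W b k‖)
        (fun W hW hr ↦ funext fun k ↦ norm_cgResidual hW hr k.isLt.le)
        (g := fun p k ↦ ‖b‖ * residualRatio p k)
        (measurable_pi_lambda _ fun k ↦ (measurable_residualRatio k).const_mul _)
        (fun p hp ↦ funext fun k ↦ cgResidualFormula_chiBidiag hNM hp (norm_pos_iff.2 hb) k)
    · have h : (fun ω ↦ invSigma (dyson 𝕜) M (p ω) k)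
          = invSigmaTail (dyson 𝕜) M k ∘ fun ω (j : Set.Ici k) ↦ (α j ω, β j ω) :=
        funext fun ω ↦ invSigma_eq_invSigmaTail (p ω) k
      beta_reduce
      rw [h]
      exact (measurable_invSigmaTail k).comp (comap_measurable _)
    · exact identDistrib_wishart hNM hW hb hp
        (G := fun W c (k : Fin N) ↦ (cgResidualFormula W c k, cgErrorFormula W c k))
        (fun b ↦ measurable_pi_lambda _ fun k ↦
          (measurable_cgResidualFormula measurable_id measurable_const k).prodMk
            (measurable_cgErrorFormula measurable_id measurable_const k))
        (fun U hU W c ↦ funext fun k ↦ Prod.ext (cgResidualFormula_unitary_conj hU)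
          (cgErrorFormula_unitary_conj hU))
        (f := fun W (k : Fin N) ↦ (‖cgResidual W b k‖, energyNorm W (cgError W b k)))
        (fun W hW hr ↦ funext fun k ↦ Prod.ext (norm_cgResidual hW hr k.isLt.le)
          (energyNorm_cgError hW hr k.isLt.le))
        (g := fun p k ↦ (‖b‖ * residualRatio p k,
          invSigma (dyson 𝕜) M p k * (‖b‖ * residualRatio p k)))
        (measurable_pi_lambda _ fun k ↦ ((measurable_residualRatio k).const_mul _).prodMk
          ((measurable_invSigma _ _ k).mul ((measurable_residualRatio k).const_mul _)))
        (fun p hp ↦ funext fun k ↦ Prod.ext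
          (cgResidualFormula_chiBidiag hNM hp (norm_pos_iff.2 hb) k)
          (cgErrorFormula_chiBidiag hNM hp (norm_pos_iff.2 hb) k))
    · exact identDistrib_wishart hNM hW hb hp
        (G := fun W c (k : Fin N) ↦ minresResidualFormula W c k)
        (fun b ↦ measurable_pi_lambda _ fun k ↦
          measurable_minresResidualFormula measurable_id measurable_const k)
        (fun U hU W c ↦ funext fun k ↦ minresResidualFormula_unitary_conj hU)
        (f := fun W (k : Fin N) ↦ ‖minresResidual W b k‖)
        (fun W hW hr ↦ funext fun k ↦ norm_minresResidual hW hr k.isLt.le)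
        (g := fun p k ↦ minresRatio p k * ‖b‖)
        (measurable_pi_lambda _ fun k ↦ (measurable_minresRatio k).mul_const _)
        (fun p hp ↦ funext fun k ↦ minresResidualFormula_chiBidiag hNM hp (norm_pos_iff.2 hb) k)
  · refine ⟨(Fin N → ℝ × ℝ) × ℝ, inferInstance,
      (chiPairs (dyson 𝕜) N M).prod (chiSqRatioLaw (dyson 𝕜 * N) (dyson 𝕜 * M)),
      fun j ω ↦ (ω.1 j).1, fun j ω ↦ (ω.1 j).2, Prod.snd, inferInstance,
      isChiFamily_of_hasLaw measurePreserving_fst.hasLaw, measurePreserving_snd.hasLaw,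
      fun X hX b hb ↦ identDistrib_normalEquations hNM hX hb⟩
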